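/- Let $G=(V,A)$ be a finite digraph with $n$ vertices and $m$ arcs (parallel arcs allowed), let $s\neq t$ be vertices of $G$, and let $d\in\mathbb N$. Let $A^{(d)}=\{B\subseteq A: |B|\le d\}$. An order-$d$ cost function is a map $q\colon A^{(d)}\to\mathbb R$, i.e. a vector $q\in\mathbb R^{A^{(d)}}$. The cost of a simple directed $s$-$t$-path $P$ (identified with its set of arcs) is $\mathrm{SPP}_d(P,q)=\sum_{B\subseteq P,\,|B|\le d} q(B)$. Call $q$ linearizable if there is $c\colon A\to\mathbb R$ with $\mathrm{SPP}_d(P,q)=\sum_{a\in P}c(a)$ for every simple directed $s$-$t$-path $P$. The digraph $G$ is called $\mathcal P_{st}$-covered if every arc of $G$ lies on at least one simple directed $s$-$t$-path. Theorem. For every constant $d\in\mathbb N$ there are an algorithm and a polynomial $T$ (both depending only on $d$) such that the following holds for every acyclic, $\mathcal P_{st}$-covered digraph $G$ with source $s$ and sink $t\ne s$. The linearizable order-$d$ cost functions form a linear subspace $\mathcal L_d$ of $\mathbb R^{A^{(d)}}$. Given $(G,s,t)$, the algorithm halts after at most $T(n+m)$ steps and outputs a listing of $A^{(d)}$ together with,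 with respect to this listing, an integer matrix $M$ with $\ker M=\mathcal L_d$, whose numbers of rows and columns are at most $T(n+m)$, and a basis of $\mathcal L_d$ consisting of integer vectors. Here an algorithm is a program for a random access machine on integers with indirect addressing, in which each addition, subtraction, comparison, memory access, test and output of a number counts as one step, and which has no multiplication instruction (so that the step count is polynomially related to the running time of a Turing machine). -/

import Mathlib

/-! ## Digraphs, paths and order-`d` costs -/

/-- A finite digraph with vertices `0, …, n-1` and arcs `0, …, m-1`; the arc `a` goes from
`tail a` to `head a`. Parallel arcs are allowed. -/
structure ArcDigraph (n m : ℕ) where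
  tail : Fin m → Fin n
  head : Fin m → Fin n

/-- The sets of at most `d` arcs, `A^{(d)} = {B ⊆ A : |B| ≤ d}`. -/
abbrev ArcSubset (m d : ℕ) : Type := {B : Finset (Fin m) // B.card ≤ d}

/-- Order-`d` cost functions `q : {B ⊆ A : |B| ≤ d} → ℝ`, as vectors of `ℝ^{A^{(d)}}`. -/
abbrev OrderCost (m d : ℕ) : Type := ArcSubset m d → ℝ

namespace ArcDigraph

variable {n m : ℕ}

/-- `G.IsWalk u v p`: the sequence of arcs `p` is a directed walk from `u` to `v`. -/
def IsWalk (G : ArcDigraph n m) : Fin n → Fin n → List (Fin m) → Prop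
  | u, v, [] => u = v
  | u, v, a :: p => G.tail a = u ∧ IsWalk G (G.head a) v p

/-- `G.IsPath u v p`: the sequence of arcs `p` is a simple directed path from `u` to `v`, that is,
a walk that visits no vertex twice. -/
def IsPath (G : ArcDigraph n m) (u v : Fin n) (p : List (Fin m)) : Prop :=
  G.IsWalk u v p ∧ (u :: p.map G.head).Nodup

/-- There is no directed cycle. -/
def Acyclic (G : ArcDigraph n m) : Prop :=
  ∀ (v : Fin n) (p : List (Fin m)), G.IsWalk v v p → p = []

/-- Every arc lies on at least one simple `s`-`t`-path. -/
def PathCovered (G : ArcDigraph n m) (s t : Fin n) : Prop :=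
  ∀ a : Fin m, ∃ p : List (Fin m), G.IsPath s t p ∧ a ∈ p

/-- The cost `SPP(P, c)`, the sum of the costs `c a` of the arcs `a` of the path `P = p`. -/
def linearCost (c : Fin m → ℝ) (p : List (Fin m)) : ℝ :=
  ∑ a ∈ p.toFinset, c a

/-- The cost `SPP_d(P, q)`, the sum of the interaction costs `q B` over all sets `B` of at most `d`
arcs of the path `P = p`. -/
def orderCost {d : ℕ} (q : OrderCost m d) (p : List (Fin m)) : ℝ :=
  ∑ B : ArcSubset m d with B.1 ⊆ p.toFinset, q B

/-- The instance `(G, s, t, q)` of the order-`d` shortest path problem is linearizable. -/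
def Linearizable (G : ArcDigraph n m) (s t : Fin n) {d : ℕ} (q : OrderCost m d) : Prop :=
  ∃ c : Fin m → ℝ, ∀ p : List (Fin m), G.IsPath s t p → orderCost q p = linearCost c p

/-- The input word: `n, m, s, t`, then the tails of all arcs, then the heads of all arcs. -/
def inputWord (G : ArcDigraph n m) (s t : Fin n) : List ℤ :=
  [(n : ℤ), (m : ℤ), ((s : ℕ) : ℤ), ((t : ℕ) : ℤ)]
    ++ List.ofFn (fun a => ((G.tail a : ℕ) : ℤ)) ++ List.ofFn (fun a => ((G.head a : ℕ) : ℤ))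

end ArcDigraph

/-! ## The machine model

Structured programs for a random access machine. The memory consists of arrays of integer cells,
of which a program can name only finitely many; cell addresses can be computed (indirect
addressing). Every elementary operation (constant, memory read, addition, subtraction, comparison,
assignment, test, output) takes one step. There is no multiplication, so that the bit length of the
largest number in use (constants of the program included) grows by at most one with each step, and
the step count is polynomially related to the running time of a Turing machine. -/

namespace RAM

/-- Integer expressions; `read a i` is the content of cell `i` of the array named `a`. -/
inductive Expr : Type
  | const (k : ℤ) : Expr
  | read (a : ℕ) (i : Expr) : Expr
  | add (x y : Expr) : Expr
  | sub (x y : Expr) : Expr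
  | lt (x y : Expr) : Expr
  | eq (x y : Expr) : Expr

/-- Programs. -/
inductive Prog : Type
  | skip : Prog
  | write (a : ℕ) (i x : Expr) : Prog
  | emit (x : Expr) : Prog
  | seq (p q : Prog) : Prog
  | ite (x : Expr) (p q : Prog) : Prog
  | while (x : Expr) (p : Prog) : Prog

/-- A state of the machine: the memory (array name, cell address, content) and the word that has
been output so far. -/
structure State : Type where
  mem : ℕ → ℤ → ℤ
  out : List ℤ

/-- The value of an expression; comparisons yield `1` for true and `0` for false. -/
def Expr.eval (μ : ℕ → ℤ → ℤ) : Expr → ℤ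
  | .const k => k
  | .read a i => μ a (i.eval μ)
  | .add x y => x.eval μ + y.eval μ
  | .sub x y => x.eval μ - y.eval μ
  | .lt x y => if x.eval μ < y.eval μ then 1 else 0
  | .eq x y => if x.eval μ = y.eval μ then 1 else 0

/-- The number of steps of an evaluation, one for each operation. -/
def Expr.cost : Expr → ℕ
  | .const _ => 1
  | .read _ i => i.cost + 1
  | .add x y => x.cost + y.cost + 1
  | .sub x y => x.cost + y.cost + 1
  | .lt x y => x.cost + y.cost + 1
  | .eq x y => x.cost + y.cost + 1

/-- Write `v` to cell `i` of array `a`. -/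
def State.write (σ : State) (a : ℕ) (i v : ℤ) : State :=
  { σ with mem := Function.update σ.mem a (Function.update (σ.mem a) i v) }

/-- Append `v` to the output. -/
def State.emit (σ : State) (v : ℤ) : State :=
  { σ with out := σ.out ++ [v] }

/-- `Exec p σ k τ`: started in the state `σ`, the program `p` halts after exactly `k` steps in the
state `τ`. -/
inductive Exec : Prog → State → ℕ → State → Prop
  | skip (σ : State) : Exec .skip σ 1 σ
  | write (σ : State) (a : ℕ) (i x : Expr) :
      Exec (.write a i x) σ (i.cost + x.cost + 1) (σ.write a (i.eval σ.mem) (x.eval σ.mem))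
  | emit (σ : State) (x : Expr) :
      Exec (.emit x) σ (x.cost + 1) (σ.emit (x.eval σ.mem))
  | seq {p q : Prog} {σ τ υ : State} {k l : ℕ} :
      Exec p σ k τ → Exec q τ l υ → Exec (.seq p q) σ (k + l) υ
  | ite_true {x : Expr} {p q : Prog} {σ τ : State} {k : ℕ} :
      x.eval σ.mem ≠ 0 → Exec p σ k τ → Exec (.ite x p q) σ (x.cost + 1 + k) τ
  | ite_false {x : Expr} {p q : Prog} {σ τ : State} {k : ℕ} :
      x.eval σ.mem = 0 → Exec q σ k τ → Exec (.ite x p q) σ (x.cost + 1 + k) τ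
  | while_true {x : Expr} {p : Prog} {σ τ υ : State} {k l : ℕ} :
      x.eval σ.mem ≠ 0 → Exec p σ k τ → Exec (.while x p) τ l υ →
      Exec (.while x p) σ (x.cost + 1 + k + l) υ
  | while_false {x : Expr} {p : Prog} {σ : State} :
      x.eval σ.mem = 0 → Exec (.while x p) σ (x.cost + 1) σ

/-- The initial state for the input word `w`: cell `i` of array `0` holds the entry `w i`, all
other cells hold `0`, and nothing has been output. -/
def initial (w : List ℤ) : State where
  mem a i := if a = 0 ∧ 0 ≤ i then w.getD i.toNat 0 else 0
  out := []

/-- A matrix as a word: the number of rows, the number of columns, and the entries row by row. -/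
def matrixWord {r c : ℕ} (X : Matrix (Fin r) (Fin c) ℤ) : List ℤ :=
  [(r : ℤ), (c : ℤ)] ++ (List.ofFn fun i => List.ofFn (X i)).flatten

end RAM

/-- The listing of `A^{(d)}` in the order `e`, as a 0/1-matrix whose `i`-th row is the
characteristic vector of the set `e i`. -/
def ArcSubset.listing {m d N : ℕ} (e : Fin N ≃ ArcSubset m d) : Matrix (Fin N) (Fin m) ℤ :=
  fun i a => if a ∈ (e i).1 then 1 else 0

/-! In an acyclic digraph the simple paths are exactly the walks. For every target `w`, each vertex
`u ≠ w` that reaches `w` gets one canonical arc towards `w`; following these arcs yields the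
canonical path `canon u w`. If a walk from `s` to `w` is cut at an arc `a`, replacing the end `a ::
canon (head a) w` by `canon (tail a) w` changes a function of walks by a difference that depends
only on the prefix, a walk from `s` to `tail a`. Telescoping these replacements along the walk, and
treating each difference in the same way with the new target `tail a`, expands the indicator of `B ⊆
P` into a sum over those `D ⊆ P` that are reduced, i.e. contain no arc that is canonical towards the
next target (`incl_eq_sum`). The coefficients `coeff` are integers, and they are mixed differences
of the function along `D` (`diff_incl`), so they depend only on its values on walks (`diff_congr`).

Two properties of the coefficients carry the theorem. A mixed difference along `D` annihilates
monomials of degree less than `|D|` (`coeff_eq_zero_of_length`), and the mixed differences are dual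
to the reduced monomials (`coeff_reduced`). By the first, a sum of arc costs has no coefficients
with `|D| ≥ 2`. Conversely, a cost function without such coefficients is a constant plus a sum of
arc costs along each path, and the constant can be charged to the unique arc of the path that leaves
`s`. Thus linearizability is the vanishing of the coefficients with `|D| ≥ 2` (`linearizable_iff`),
where `|D| ≤ d` may be assumed. These equations form an integer matrix which, by duality, has an
identity block in the reduced columns. Its kernel therefore has an explicit integer basis, and no
elimination is needed (`exists_basis_of_reduced`).

For the running time, all ingredients (reachability, canonical arcs and paths, keys, sorted lists,
reducedness, coefficients) are defined by recursions whose arguments are at most four vertices,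
arcs, counters or lists of at most `d` arcs. With `A = n + m + 2`, such arguments are coded by
numbers below `A ^ (4 * (d + 1))`, and every recursive call goes to a smaller code, so one pass
through a table computes the recursion (`fill_spec`). The rules are written in a small language with
bounded sums, whose compiler comes with polynomial time bounds (`TExpr.runs_compile`,
`Out.runs_compile`, `exists_exec`); products, quotients and remainders are also obtained from
tables. -/

namespace RAM

/-! ## Running programs -/

/-- Started in `σ`, the program halts within `c` steps in a state with the property `Post`. -/
def Runs (p : Prog) (σ : State) (c : ℕ) (Post : State → Prop) : Prop :=
  ∃ k τ, Exec p σ k τ ∧ k ≤ c ∧ Post τ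

theorem Runs.mono {p : Prog} {σ : State} {c c' : ℕ} {Post Post' : State → Prop}
    (h : Runs p σ c Post) (hc : c ≤ c') (hP : ∀ τ, Post τ → Post' τ) : Runs p σ c' Post' := by
  obtain ⟨k, τ, h1, h2, h3⟩ := h
  exact ⟨k, τ, h1, h2.trans hc, hP τ h3⟩

theorem Runs.seq {p q : Prog} {σ : State} {c c' : ℕ} {Mid Post : State → Prop}
    (h : Runs p σ c Mid) (h' : ∀ τ, Mid τ → Runs q τ c' Post) :
    Runs (.seq p q) σ (c + c') Post := by
  obtain ⟨k, τ, h1, h2, h3⟩ := h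
  obtain ⟨l, υ, h4, h5, h6⟩ := h' τ h3
  exact ⟨k + l, υ, .seq h1 h4, by omega, h6⟩

theorem Runs.skip {σ : State} {Post : State → Prop} (h : Post σ) : Runs .skip σ 1 Post :=
  ⟨1, σ, .skip σ, le_rfl, h⟩

theorem Runs.write {σ : State} {a : ℕ} {i x : Expr} {Post : State → Prop}
    (h : Post (σ.write a (i.eval σ.mem) (x.eval σ.mem))) :
    Runs (.write a i x) σ (i.cost + x.cost + 1) Post :=
  ⟨_, _, .write σ a i x, le_rfl, h⟩

theorem Runs.emit {σ : State} {x : Expr} {Post : State → Prop}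
    (h : Post (σ.emit (x.eval σ.mem))) : Runs (.emit x) σ (x.cost + 1) Post :=
  ⟨_, _, .emit σ x, le_rfl, h⟩

/-- The two bounds are added instead of taking their maximum, so that all time bounds remain
polynomials. -/
theorem Runs.ite {x : Expr} {p q : Prog} {σ : State} {c c' : ℕ} {Post : State → Prop}
    (h : x.eval σ.mem ≠ 0 → Runs p σ c Post) (h' : x.eval σ.mem = 0 → Runs q σ c' Post) :
    Runs (.ite x p q) σ (x.cost + 1 + (c + c')) Post := by
  by_cases hx : x.eval σ.mem = 0
  · obtain ⟨k, τ, h1, h2, h3⟩ := h' hx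
    exact ⟨_, τ, .ite_false hx h1, by omega, h3⟩
  · obtain ⟨k, τ, h1, h2, h3⟩ := h hx
    exact ⟨_, τ, .ite_true hx h1, by omega, h3⟩

/-- The invariant carries the number of the round and determines the guard, so there are exactly `R`
rounds; the induction is on the number of rounds still to come. -/
theorem Runs.while {g : Expr} {p : Prog} {R c : ℕ} {I : ℕ → State → Prop}
    (hg : ∀ j ≤ R, ∀ σ, I j σ → g.eval σ.mem = if j < R then 1 else 0)
    (hp : ∀ j < R, ∀ σ, I j σ → Runs p σ c (I (j + 1))) {σ : State} (h0 : I 0 σ) :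
    Runs (.while g p) σ (R * (c + g.cost + 1) + g.cost + 1) (I R) := by
  suffices H : ∀ r j, j + r = R → ∀ σ, I j σ →
      Runs (.while g p) σ (r * (c + g.cost + 1) + g.cost + 1) (I R) from H R 0 (by omega) σ h0
  intro r
  induction r with
  | zero =>
    intro j hj σ hσ
    obtain rfl : j = R := by omega
    exact ⟨_, σ, .while_false (by rw [hg j le_rfl σ hσ, if_neg (lt_irrefl _)]), by omega, hσ⟩
  | succ r ih =>
    intro j hj σ hσ
    obtain ⟨k, τ, h1, h2, h3⟩ := hp j (by omega) σ hσ
    obtain ⟨l, υ, h4, h5, h6⟩ := ih (j + 1) (by omega) τ h3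
    refine ⟨_, υ, .while_true (x := g) ?_ h1 h4, ?_, h6⟩
    · rw [hg j (by omega) σ hσ, if_pos (by omega)]; exact one_ne_zero
    · rw [Nat.succ_mul]; omega

/-! ## Expressions with bounded sums -/

/-- Integer expressions over named variables and tables, with conditionals and with sums
`∑ x < R` over a global range `R`. -/
inductive TExpr : Type
  | const (k : ℤ) : TExpr
  | var (x : ℕ) : TExpr
  | tab (t : ℕ) (i : TExpr) : TExpr
  | add (x y : TExpr) : TExpr
  | sub (x y : TExpr) : TExpr
  | lt (x y : TExpr) : TExpr
  | eq (x y : TExpr) : TExpr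
  | ite (c x y : TExpr) : TExpr
  | sum (x : ℕ) (e : TExpr) : TExpr

/-- The value of an expression, given the tables `T` and the values `ρ` of the variables. -/
def TExpr.eval (R : ℕ) (T : ℕ → ℤ → ℤ) : TExpr → (ℕ → ℤ) → ℤ
  | .const k, _ => k
  | .var x, ρ => ρ x
  | .tab t i, ρ => T t (i.eval R T ρ)
  | .add x y, ρ => x.eval R T ρ + y.eval R T ρ
  | .sub x y, ρ => x.eval R T ρ - y.eval R T ρ
  | .lt x y, ρ => if x.eval R T ρ < y.eval R T ρ then 1 else 0
  | .eq x y, ρ => if x.eval R T ρ = y.eval R T ρ then 1 else 0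
  | .ite c x y, ρ => if c.eval R T ρ = 0 then y.eval R T ρ else x.eval R T ρ
  | .sum x e, ρ => ∑ j ∈ Finset.range R, e.eval R T (Function.update ρ x j)

/-- Cell `k` of the array of registers. -/
def reg (k : ℕ) : Expr := .read 1 (.const k)

/-- The cell of the variable `x`. -/
def vcell (x : ℕ) : Expr := .read 2 (.const x)

/-- The cell that holds the range of the sums. -/
def bound : Expr := .read 3 (.const 0)

/-- Run `p` for the values `0, …, R - 1` of the variable `x`, whose value is saved in register `k`
and restored afterwards. -/
def forLoop (x k : ℕ) (p : Prog) : Prog :=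
  .seq (.write 1 (.const k) (vcell x)) (.seq (.write 2 (.const x) (.const 0))
    (.seq (.while (.lt (vcell x) bound)
        (.seq p (.write 2 (.const x) (.add (vcell x) (.const 1)))))
      (.write 2 (.const x) (reg k))))

/-- A program that puts the value of the expression into register `k`, using as work space the
registers from `k` on. -/
def TExpr.compile : TExpr → ℕ → Prog
  | .const c, k => .write 1 (.const k) (.const c)
  | .var x, k => .write 1 (.const k) (vcell x)
  | .tab t i, k => .seq (i.compile k) (.write 1 (.const k) (.read (4 * t) (reg k)))
  | .add x y, k => .seq (x.compile k)
      (.seq (y.compile (k + 1)) (.write 1 (.const k) (.add (reg k) (reg (k + 1)))))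
  | .sub x y, k => .seq (x.compile k)
      (.seq (y.compile (k + 1)) (.write 1 (.const k) (.sub (reg k) (reg (k + 1)))))
  | .lt x y, k => .seq (x.compile k)
      (.seq (y.compile (k + 1)) (.write 1 (.const k) (.lt (reg k) (reg (k + 1)))))
  | .eq x y, k => .seq (x.compile k)
      (.seq (y.compile (k + 1)) (.write 1 (.const k) (.eq (reg k) (reg (k + 1)))))
  | .ite c x y, k => .seq (c.compile k) (.ite (reg k) (x.compile k) (y.compile k))
  | .sum x e, k => .seq (.write 1 (.const k) (.const 0)) (forLoop x (k + 1)
      (.seq (e.compile (k + 2)) (.write 1 (.const k) (.add (reg k) (reg (k + 2))))))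

/-- The cost of a loop with body cost `c`, as a polynomial in the range. -/
noncomputable def loopCost (c : Polynomial ℕ) : Polynomial ℕ :=
  Polynomial.X * (c + 20) + 30

/-- A bound for the running time of the compiled expression, as a polynomial in the range. -/
noncomputable def TExpr.cost : TExpr → Polynomial ℕ
  | .const _ => 5
  | .var _ => 5
  | .tab _ i => i.cost + 10
  | .add x y => x.cost + y.cost + 10
  | .sub x y => x.cost + y.cost + 10
  | .lt x y => x.cost + y.cost + 10
  | .eq x y => x.cost + y.cost + 10
  | .ite c x y => c.cost + x.cost + y.cost + 10
  | .sum _ e => loopCost (e.cost + 10) + 5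

/-- The memory `μ` represents the tables `T`, the variables `ρ` and the range `R`. -/
structure Represents (R : ℕ) (T : ℕ → ℤ → ℤ) (ρ : ℕ → ℤ) (μ : ℕ → ℤ → ℤ) : Prop where
  tab : ∀ t, μ (4 * t) = T t
  var : ∀ x : ℕ, μ 2 x = ρ x
  bound : μ 3 0 = R

/-- Array `1` holds only registers: tables occupy the arrays whose number is divisible by four,
variables array `2`, the range array `3`. -/
theorem Represents.congr {R : ℕ} {T : ℕ → ℤ → ℤ} {ρ : ℕ → ℤ} {μ ν : ℕ → ℤ → ℤ}
    (h : Represents R T ρ μ) (hν : ∀ a ≠ 1, ν a = μ a) : Represents R T ρ ν where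
  tab t := by rw [hν _ (by omega), h.tab]
  var x := by rw [hν _ (by omega), h.var]
  bound := by rw [hν _ (by omega), h.bound]

@[simp] theorem State.write_mem (σ : State) (a : ℕ) (i v : ℤ) (b : ℕ) (j : ℤ) :
    (σ.write a i v).mem b j = if b = a ∧ j = i then v else σ.mem b j := by
  unfold State.write
  by_cases hb : b = a
  · subst hb
    by_cases hj : j = i <;> simp [hj]
  · simp [hb]

@[simp] theorem State.write_out (σ : State) (a : ℕ) (i v : ℤ) : (σ.write a i v).out = σ.out := rfl

theorem State.write_mem_of_ne (σ : State) {a b : ℕ} (i v : ℤ) (h : b ≠ a) :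
    (σ.write a i v).mem b = σ.mem b := by
  funext j; simp [h]

/-- `τ` arises from `σ` by changes of the registers from `k` on. -/
structure Keeps (k : ℕ) (σ τ : State) : Prop where
  mem : ∀ a ≠ 1, τ.mem a = σ.mem a
  reg : ∀ i : ℕ, i < k → τ.mem 1 i = σ.mem 1 i

theorem Keeps.trans {k l : ℕ} {σ τ υ : State} (h : Keeps k σ τ) (h' : Keeps l τ υ) (hl : k ≤ l) :
    Keeps k σ υ :=
  ⟨fun a ha => (h'.mem a ha).trans (h.mem a ha),
    fun i hi => (h'.reg i (hi.trans_le hl)).trans (h.reg i hi)⟩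

theorem Keeps.write {k l : ℕ} (σ : State) (v : ℤ) (hl : k ≤ l) : Keeps k σ (σ.write 1 l v) :=
  ⟨fun _ ha => σ.write_mem_of_ne _ _ ha, fun i hi => by
    rw [State.write_mem, if_neg]; omega⟩

/-- The rule for loops over the range. `J j` is the invariant at the beginning of round `j`; it may
refer to everything but the variable `x` and the registers from `k` on. -/
theorem Runs.forLoop {x k : ℕ} {p : Prog} {R : ℕ} {c : Polynomial ℕ}
    {J : ℕ → State → Prop} {σ : State} (hb : σ.mem 3 0 = R)
    (hJ : ∀ j ≤ R, ∀ σ τ : State, J j σ → τ.out = σ.out → (∀ a ≠ 1, a ≠ 2 → τ.mem a = σ.mem a) →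
      (∀ i : ℕ, i < k → τ.mem 1 i = σ.mem 1 i) → J j τ)
    (h0 : J 0 σ)
    (hp : ∀ j < R, ∀ τ : State, J j τ → τ.mem 2 = Function.update (σ.mem 2) x (j : ℤ) →
      τ.mem 3 0 = R →
      Runs p τ (c.eval R) fun υ => J (j + 1) υ ∧ υ.mem 2 = τ.mem 2 ∧ υ.mem 3 0 = τ.mem 3 0 ∧
        υ.mem 1 k = τ.mem 1 k) :
    Runs (RAM.forLoop x k p) σ ((loopCost c).eval R) fun υ =>
      J R υ ∧ υ.mem 2 = σ.mem 2 ∧ υ.mem 3 0 = R := by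
  -- The summands belong to saving the variable, setting it to zero, the rounds (body, increment and
  -- guard) with the last guard, and restoring the variable.
  have key : Runs (RAM.forLoop x k p) σ
      (4 + (3 + (((R * (c.eval R + 7 + 5 + 1) + 5 + 1)) + 4))) fun υ =>
      J R υ ∧ υ.mem 2 = σ.mem 2 ∧ υ.mem 3 0 = R := by
    refine Runs.seq (Mid := fun τ => J 0 τ ∧ τ.mem 2 = σ.mem 2 ∧ τ.mem 3 0 = R ∧
      τ.mem 1 k = σ.mem 2 x) (Runs.write ?_) fun τ hτ => ?_
    · refine ⟨hJ 0 (Nat.zero_le _) σ _ h0 rfl (fun a ha _ => σ.write_mem_of_ne _ _ ha)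
        (fun i hi => ?_), σ.write_mem_of_ne _ _ (by omega), ?_, ?_⟩
      · rw [State.write_mem, if_neg]; simp [Expr.eval]; omega
      · rw [State.write_mem_of_ne _ _ _ (by omega), hb]
      · simp [Expr.eval, vcell]
    · obtain ⟨h1, h2, h3, h4⟩ := hτ
      refine Runs.seq (Mid := fun υ => J 0 υ ∧ υ.mem 2 = Function.update (σ.mem 2) x ((0 : ℕ) : ℤ) ∧
        υ.mem 3 0 = R ∧ υ.mem 1 k = σ.mem 2 x) (Runs.write ?_) fun τ hτ => ?_
      · refine ⟨hJ 0 (Nat.zero_le _) τ _ h1 rfl (fun a _ ha => State.write_mem_of_ne _ _ _ ha)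
          (fun i hi => ?_), ?_, ?_, ?_⟩
        · rw [State.write_mem, if_neg]; omega
        · funext y; simp [Expr.eval, h2, Function.update_apply]
        · rw [State.write_mem_of_ne _ _ _ (by omega), h3]
        · rw [State.write_mem_of_ne _ _ _ (by omega), h4]
      · refine Runs.seq (Runs.while (R := R) (c := c.eval R + 7) (I := fun j υ => J j υ ∧
          υ.mem 2 = Function.update (σ.mem 2) x (j : ℤ) ∧
          υ.mem 3 0 = R ∧ υ.mem 1 k = σ.mem 2 x) ?_ ?_ hτ) fun υ hυ => Runs.write ?_
        · rintro j hj υ ⟨_, h2, h3, _⟩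
          simp [Expr.eval, vcell, bound, h2, h3]
        · rintro j hj υ ⟨h1, h2, h3, h4⟩
          refine Runs.seq (hp j hj υ h1 h2 h3) fun υ' hυ' => Runs.mono (Runs.write ?_) (by simp [Expr.cost, vcell])
            fun _ h => h
          obtain ⟨g1, g2, g3, g4⟩ := hυ'
          refine ⟨hJ (j + 1) hj υ' _ g1 rfl (fun a _ ha => State.write_mem_of_ne _ _ _ ha)
            (fun i hi => ?_), ?_, ?_, ?_⟩
          · rw [State.write_mem, if_neg]; omega
          · funext y
            simp only [Expr.eval, vcell, g2, h2, Function.update_apply, State.write_mem, true_and,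
              if_true]
            split_ifs <;> simp
          · rw [State.write_mem_of_ne _ _ _ (by omega), g3, h3]
          · rw [State.write_mem_of_ne _ _ _ (by omega), g4, h4]
        · obtain ⟨g1, g2, g3, g4⟩ := hυ
          refine ⟨hJ R le_rfl υ _ g1 rfl (fun a _ ha => State.write_mem_of_ne _ _ _ ha)
            (fun i hi => ?_), ?_, ?_⟩
          · rw [State.write_mem, if_neg]; omega
          · funext y
            simp only [Expr.eval, reg, State.write_mem, g2, g4, Function.update_apply, true_and]
            split_ifs with h <;> simp [h]
          · rw [State.write_mem_of_ne _ _ _ (by omega), g3]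
  refine key.mono ?_ fun _ h => h
  simp only [loopCost, Polynomial.eval_add, Polynomial.eval_mul, Polynomial.eval_X,
    Polynomial.eval_ofNat]
  have : R * (c.eval R + 7 + 5 + 1) ≤ R * (c.eval R + 20) := Nat.mul_le_mul_left _ (by omega)
  omega

/-- The compiled expression computes the value of the expression. -/
theorem TExpr.runs_compile {R : ℕ} {T : ℕ → ℤ → ℤ} (e : TExpr) :
    ∀ (k : ℕ) (ρ : ℕ → ℤ) (σ : State), Represents R T ρ σ.mem →
      Runs (e.compile k) σ (e.cost.eval R) fun τ =>
        τ.out = σ.out ∧ Keeps k σ τ ∧ τ.mem 1 k = e.eval R T ρ := by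
  -- The binary operations share one argument: the second operand is evaluated from register `k + 1`
  -- on, so the first one survives in register `k`.
  have bin : ∀ (x y : TExpr) (f : ℤ → ℤ → ℤ) (g : Expr → Expr → Expr),
      (∀ a b μ, (g a b).eval μ = f (a.eval μ) (b.eval μ)) →
      (∀ a b, (g a b).cost = a.cost + b.cost + 1) →
      (∀ (k : ℕ) (ρ : ℕ → ℤ) (σ : State), Represents R T ρ σ.mem →
        Runs (x.compile k) σ (x.cost.eval R) fun τ =>
          τ.out = σ.out ∧ Keeps k σ τ ∧ τ.mem 1 k = x.eval R T ρ) →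
      (∀ (k : ℕ) (ρ : ℕ → ℤ) (σ : State), Represents R T ρ σ.mem →
        Runs (y.compile k) σ (y.cost.eval R) fun τ =>
          τ.out = σ.out ∧ Keeps k σ τ ∧ τ.mem 1 k = y.eval R T ρ) →
      ∀ (k : ℕ) (ρ : ℕ → ℤ) (σ : State), Represents R T ρ σ.mem →
        Runs (.seq (x.compile k) (.seq (y.compile (k + 1))
          (.write 1 (.const k) (g (reg k) (reg (k + 1)))))) σ
          ((x.cost + y.cost + 10).eval R) fun τ =>
          τ.out = σ.out ∧ Keeps k σ τ ∧ τ.mem 1 k = f (x.eval R T ρ) (y.eval R T ρ) := by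
    intro x y f g hg hc hx hy k ρ σ hσ
    refine (Runs.seq (hx k ρ σ hσ) fun τ hτ => Runs.seq (hy (k + 1) ρ τ (hσ.congr hτ.2.1.mem))
      fun υ hυ => Runs.write ?_).mono ?_ fun _ h => h
    · obtain ⟨h1, h2, h3⟩ := hτ
      obtain ⟨g1, g2, g3⟩ := hυ
      refine ⟨by rw [State.write_out, g1, h1],
        (h2.trans g2 (by omega)).trans (Keeps.write υ _ le_rfl) le_rfl, ?_⟩
      have : υ.mem 1 (k : ℤ) = x.eval R T ρ := by rw [g2.reg k (by omega), h3]
      push_cast at g3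
      simp [Expr.eval, hg, reg, this, g3]
    · simp only [Polynomial.eval_add, Polynomial.eval_ofNat, hc, reg, Expr.cost]
      omega
  induction e with
  | const c =>
    intro k ρ σ hσ
    refine (Runs.write ?_).mono (c := 3) ?_ fun _ h => h
    · exact ⟨rfl, Keeps.write σ _ le_rfl, by simp [Expr.eval, TExpr.eval]⟩
    · simp [TExpr.cost]
  | var x =>
    intro k ρ σ hσ
    refine (Runs.write ?_).mono (c := 4) ?_ fun _ h => h
    · exact ⟨rfl, Keeps.write σ _ le_rfl, by simp [Expr.eval, TExpr.eval, vcell, hσ.var]⟩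
    · simp [TExpr.cost]
  | tab t i ih =>
    intro k ρ σ hσ
    refine (Runs.seq (ih k ρ σ hσ) fun τ hτ => Runs.write ?_).mono ?_ fun _ h => h
    · obtain ⟨h1, h2, h3⟩ := hτ
      refine ⟨h1, h2.trans (Keeps.write τ _ le_rfl) le_rfl, ?_⟩
      simp [Expr.eval, TExpr.eval, reg, h3, (hσ.congr h2.mem).tab]
    · simp [TExpr.cost, Expr.cost, reg]
  | add x y hx hy => exact bin x y (· + ·) .add (fun _ _ _ => rfl) (fun _ _ => rfl) hx hy
  | sub x y hx hy => exact bin x y (· - ·) .sub (fun _ _ _ => rfl) (fun _ _ => rfl) hx hy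
  | lt x y hx hy =>
    exact bin x y (fun a b => if a < b then 1 else 0) .lt (fun _ _ _ => rfl) (fun _ _ => rfl) hx hy
  | eq x y hx hy =>
    exact bin x y (fun a b => if a = b then 1 else 0) .eq (fun _ _ _ => rfl) (fun _ _ => rfl) hx hy
  | ite c x y hc hx hy =>
    intro k ρ σ hσ
    refine (Runs.seq (hc k ρ σ hσ) fun τ hτ => Runs.ite (c := x.cost.eval R) (c' := y.cost.eval R)
      (fun h => ?_) fun h => ?_).mono ?_ fun _ h => h
    · obtain ⟨h1, h2, h3⟩ := hτ
      refine (hx k ρ τ (hσ.congr h2.mem)).mono le_rfl fun υ ⟨g1, g2, g3⟩ =>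
        ⟨by rw [g1, h1], h2.trans g2 le_rfl, ?_⟩
      rw [g3, TExpr.eval, if_neg]
      simpa [Expr.eval, reg, h3] using h
    · obtain ⟨h1, h2, h3⟩ := hτ
      refine (hy k ρ τ (hσ.congr h2.mem)).mono le_rfl fun υ ⟨g1, g2, g3⟩ =>
        ⟨by rw [g1, h1], h2.trans g2 le_rfl, ?_⟩
      rw [g3, TExpr.eval, if_pos]
      simpa [Expr.eval, reg, h3] using h
    · simp only [TExpr.cost, Polynomial.eval_add, Polynomial.eval_ofNat, reg, Expr.cost]
      omega
  | sum x e ih =>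
    intro k ρ σ hσ
    refine (Runs.seq (Mid := fun τ => τ.out = σ.out ∧ Keeps k σ τ ∧ τ.mem 1 k = 0)
      (Runs.write ?_) fun τ hτ => (Runs.forLoop (R := R) (c := e.cost + 10)
      (J := fun j υ => υ.out = σ.out ∧ (∀ a ≠ 1, a ≠ 2 → υ.mem a = σ.mem a) ∧
        (∀ i : ℕ, i < k → υ.mem 1 i = σ.mem 1 i) ∧
        υ.mem 1 k = ∑ j ∈ Finset.range j, e.eval R T (Function.update ρ x j)) ?_ ?_ ?_ ?_).mono
          le_rfl ?_).mono ?_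
      fun _ h => h
    · exact ⟨rfl, Keeps.write σ _ le_rfl, by simp [Expr.eval]⟩
    · exact (hσ.congr hτ.2.1.mem).bound
    · rintro j - υ υ' ⟨h1, h2, h3, h4⟩ g1 g2 g3
      refine ⟨g1.trans h1, fun a ha ha' => (g2 a ha ha').trans (h2 a ha ha'), fun i hi => ?_, ?_⟩
      · rw [g3 i (by omega), h3 i hi]
      · rw [g3 k (by omega), h4]
    · obtain ⟨h1, h2, h3⟩ := hτ
      exact ⟨h1, fun a ha _ => h2.mem a ha, h2.reg, by simpa using h3⟩
    -- Register `k` holds the partial sum and `k + 1` the saved variable, so the summand is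
    -- evaluated from `k + 2` on.
    · rintro j hj υ ⟨h1, h2, h3, h4⟩ g2 g3
      have hrep : Represents R T (Function.update ρ x j) υ.mem := by
        refine ⟨fun t => ?_, fun y => ?_, g3⟩
        · rw [h2 _ (by omega) (by omega), hσ.tab]
        · rw [g2, hτ.2.1.mem 2 (by omega)]
          by_cases hy : y = x
          · simp [hy]
          · rw [Function.update_of_ne hy, Function.update_of_ne (by exact_mod_cast hy), hσ.var]
      refine (Runs.seq (ih (k + 2) _ υ hrep) fun υ' hυ' => Runs.write ?_).mono ?_ fun _ h => h
      · obtain ⟨f1, f2, f3⟩ := hυ'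
        refine ⟨⟨f1.trans h1, fun a ha ha' => ?_, fun i hi => ?_, ?_⟩, ?_, ?_, ?_⟩
        · rw [State.write_mem_of_ne _ _ _ ha, f2.mem a ha, h2 a ha ha']
        · rw [State.write_mem, if_neg, f2.reg i (by omega), h3 i hi]
          simp [Expr.eval]; omega
        · have : υ'.mem 1 (k : ℤ) = _ := (f2.reg k (by omega)).trans h4
          push_cast at f3
          simp [Expr.eval, reg, this, f3, Finset.sum_range_succ]
        · rw [State.write_mem_of_ne _ _ _ (by omega), f2.mem 2 (by omega)]
        · rw [State.write_mem_of_ne _ _ _ (by omega), f2.mem 3 (by omega)]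
        · rw [State.write_mem, if_neg, f2.reg (k + 1) (by omega)]
          simp [Expr.eval]
      · simp only [Polynomial.eval_add, Polynomial.eval_ofNat, reg, Expr.cost]
        omega
    · rintro υ ⟨⟨h1, h2, h3, h4⟩, g2, g3⟩
      refine ⟨h1, ⟨fun a ha => ?_, h3⟩, h4⟩
      by_cases ha' : a = 2
      · rw [ha', g2, hτ.2.1.mem 2 (by omega)]
      · exact h2 a ha ha'
    · simp only [TExpr.cost, Polynomial.eval_add, Polynomial.eval_ofNat, Expr.cost]
      omega

/-! ## Tables -/

/-- The tables after `i` rounds of filling table `t` by the rule `e`. -/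
def fill (R : ℕ) (t : ℕ) (e : TExpr) (T : ℕ → ℤ → ℤ) : ℕ → ℕ → ℤ → ℤ
  | 0 => T
  | i + 1 => Function.update (fill R t e T i) t (Function.update (fill R t e T i t) (i : ℤ)
      (e.eval R (fill R t e T i) (Function.update 0 0 (i : ℤ))))

/-- Fill table `t` by the rule `e`, in which variable `0` stands for the address. -/
def fillProg (t : ℕ) (e : TExpr) : Prog :=
  forLoop 0 0 (.seq (e.compile 1) (.write (4 * t) (vcell 0) (reg 1)))

/-- The invariant says that after `j` rounds of the loop the memory holds the tables after `j`
rounds of `fill`. Register `0` keeps the saved loop variable. -/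
theorem runs_fillProg {R : ℕ} {T : ℕ → ℤ → ℤ} (t : ℕ) (e : TExpr) (σ : State)
    (hσ : Represents R T 0 σ.mem) :
    Runs (fillProg t e) σ ((loopCost (e.cost + 10)).eval R) fun τ =>
      τ.out = σ.out ∧ Represents R (fill R t e T R) 0 τ.mem := by
  refine (Runs.forLoop (R := R) (J := fun j υ => υ.out = σ.out ∧
    ∀ t', υ.mem (4 * t') = fill R t e T j t') hσ.bound ?_ ?_ ?_).mono le_rfl ?_
  · rintro j - υ υ' ⟨h1, h2⟩ g1 g2 g3
    exact ⟨g1.trans h1, fun t' => (g2 _ (by omega) (by omega)).trans (h2 t')⟩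
  · exact ⟨rfl, hσ.tab⟩
  · rintro j hj υ ⟨h1, h2⟩ g2 g3
    have hrep : Represents R (fill R t e T j) (Function.update 0 0 (j : ℤ)) υ.mem := by
      refine ⟨h2, fun y => ?_, g3⟩
      rw [g2]
      by_cases hy : y = 0
      · simp [hy]
      · rw [Function.update_of_ne hy, Function.update_of_ne (by exact_mod_cast hy), hσ.var]
    refine (Runs.seq (e.runs_compile 1 _ υ hrep) fun υ' hυ' => Runs.write ?_).mono ?_ fun _ h => h
    · obtain ⟨f1, f2, f3⟩ := hυ'
      have hv : υ'.mem 2 0 = j := by rw [f2.mem 2 (by omega), g2]; simp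
      refine ⟨⟨f1.trans h1, fun t' => ?_⟩, ?_, ?_, ?_⟩
      · push_cast at f3
        funext i
        simp only [Expr.eval, vcell, reg, State.write_mem, fill, Nat.cast_zero, Nat.cast_one, hv, f3]
        by_cases ht : t' = t
        · subst ht
          simp only [Function.update_self, Function.update_apply, true_and]
          rw [f2.mem _ (by omega), h2]
        · rw [if_neg (by omega), Function.update_of_ne ht, f2.mem _ (by omega), h2]
      · rw [State.write_mem_of_ne _ _ _ (by omega), f2.mem 2 (by omega)]
      · rw [State.write_mem_of_ne _ _ _ (by omega), f2.mem 3 (by omega)]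
      · rw [State.write_mem_of_ne _ _ _ (by omega)]
        exact f2.reg 0 (by omega)
    · simp only [Polynomial.eval_add, Polynomial.eval_ofNat, reg, vcell, Expr.cost]
      omega
  · rintro υ ⟨⟨h1, h2⟩, g2, g3⟩
    exact ⟨h1, h2, fun x => by rw [g2, hσ.var], g3⟩

theorem fill_of_ne (R t : ℕ) (e : TExpr) (T : ℕ → ℤ → ℤ) (i : ℕ) {t' : ℕ} (h : t' ≠ t) :
    fill R t e T i t' = T t' := by
  induction i with
  | zero => rfl
  | succ i ih => rw [fill, Function.update_of_ne h, ih]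

/-- Round `i` writes only cell `i`, so a cell is final once its own round is over. -/
theorem fill_stable (R t : ℕ) (e : TExpr) (T : ℕ → ℤ → ℤ) (c : ℕ) {i : ℕ} (h : c < i) :
    fill R t e T i t c = fill R t e T (c + 1) t c := by
  induction i, (show c + 1 ≤ i from h) using Nat.le_induction with
  | base => rfl
  | succ i hi ih =>
    rw [fill, Function.update_self, Function.update_of_ne (by norm_cast; omega), ih hi]

/-- The contents of a table defined by recursion on the address. -/
theorem fill_spec {R t : ℕ} {e : TExpr} {T : ℕ → ℤ → ℤ} {ι : Type*} (enc : ι → ℕ) (f : ι → ℤ)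
    (henc : ∀ i, enc i < R)
    (step : ∀ i, ∀ T' : ℕ → ℤ → ℤ, (∀ t' ≠ t, T' t' = T t') →
      (∀ i', enc i' < enc i → T' t (enc i') = f i') →
      e.eval R T' (Function.update 0 0 (enc i : ℤ)) = f i) (i : ι) :
    fill R t e T R t (enc i) = f i := by
  induction h : enc i using Nat.strong_induction_on generalizing i with
  | _ c ih =>
    subst h
    -- The rule sees the table as it stands in round `enc i`; at smaller addresses it already agrees
    -- with the finished table, to which the induction hypothesis applies.
    rw [fill_stable R t e T _ (henc i), fill, Function.update_self, Function.update_self]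
    refine step i _ (fun t' ht => fill_of_ne _ _ _ _ _ ht) fun i' hi' => ?_
    rw [← ih (enc i') hi' i' rfl, fill_stable _ _ _ _ _ hi', fill_stable _ _ _ _ _ (henc i')]

/-- Fill several tables one after the other. -/
def fillAll : List (ℕ × TExpr) → Prog
  | [] => .skip
  | (t, e) :: l => .seq (fillProg t e) (fillAll l)

/-- The tables after `fillAll`. -/
def filled (R : ℕ) : List (ℕ × TExpr) → (ℕ → ℤ → ℤ) → ℕ → ℤ → ℤ
  | [], T => T
  | (t, e) :: l, T => filled R l (fill R t e T R)

/-- The running time of `fillAll`. -/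
noncomputable def fillCost : List (ℕ × TExpr) → Polynomial ℕ
  | [] => 1
  | (_, e) :: l => loopCost (e.cost + 10) + fillCost l

theorem runs_fillAll {R : ℕ} (l : List (ℕ × TExpr)) : ∀ (T : ℕ → ℤ → ℤ) (σ : State),
    Represents R T 0 σ.mem → Runs (fillAll l) σ ((fillCost l).eval R) fun τ =>
      τ.out = σ.out ∧ Represents R (filled R l T) 0 τ.mem := by
  induction l with
  | nil => exact fun T σ h => (Runs.skip ⟨rfl, h⟩).mono (by simp [fillCost]) fun _ h => h
  | cons a l ih =>
    intro T σ hσ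
    refine (Runs.seq (runs_fillProg a.1 a.2 σ hσ) fun τ hτ => (ih _ τ hτ.2).mono le_rfl
      (Post' := fun υ => υ.out = σ.out ∧ Represents R (filled R (a :: l) T) 0 υ.mem)
      fun υ hυ => ⟨hυ.1.trans hτ.1, hυ.2⟩).mono ?_ fun _ h => h
    simp [fillCost]

/-! ## Output -/

/-- Output programs. -/
inductive Out : Type
  | emit (e : TExpr) : Out
  | seq (p q : Out) : Out
  | when (e : TExpr) (p : Out) : Out
  | loop (x : ℕ) (p : Out) : Out

/-- The word that is output. -/
def Out.word (R : ℕ) (T : ℕ → ℤ → ℤ) : Out → (ℕ → ℤ) → List ℤ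
  | .emit e, ρ => [e.eval R T ρ]
  | .seq p q, ρ => p.word R T ρ ++ q.word R T ρ
  | .when e p, ρ => if e.eval R T ρ = 0 then [] else p.word R T ρ
  | .loop x p, ρ => (List.range R).flatMap fun j : ℕ => p.word R T (Function.update ρ x j)

/-- The translation into a program that uses the registers from `k` on. -/
def Out.compile : Out → ℕ → Prog
  | .emit e, k => .seq (e.compile k) (.emit (reg k))
  | .seq p q, k => .seq (p.compile k) (q.compile k)
  | .when e p, k => .seq (e.compile k) (.ite (reg k) (p.compile k) .skip)
  | .loop x p, k => forLoop x k (p.compile (k + 1))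

/-- The running time of the translation. -/
noncomputable def Out.cost : Out → Polynomial ℕ
  | .emit e => e.cost + 10
  | .seq p q => p.cost + q.cost
  | .when e p => e.cost + p.cost + 10
  | .loop _ p => loopCost p.cost

theorem Out.runs_compile {R : ℕ} {T : ℕ → ℤ → ℤ} (p : Out) :
    ∀ (k : ℕ) (ρ : ℕ → ℤ) (σ : State), Represents R T ρ σ.mem →
      Runs (p.compile k) σ (p.cost.eval R) fun τ =>
        τ.out = σ.out ++ p.word R T ρ ∧ Keeps k σ τ := by
  induction p with
  | emit e =>
    intro k ρ σ hσ
    refine (Runs.seq (e.runs_compile k ρ σ hσ) fun τ hτ => Runs.emit ?_).mono ?_ fun _ h => h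
    · obtain ⟨h1, h2, h3⟩ := hτ
      refine ⟨by simp [State.emit, Expr.eval, reg, h1, h3, Out.word], ⟨h2.mem, h2.reg⟩⟩
    · simp [Out.cost, Expr.cost, reg]
  | seq p q hp hq =>
    intro k ρ σ hσ
    refine (Runs.seq (hp k ρ σ hσ) fun τ hτ => (hq k ρ τ (hσ.congr hτ.2.mem)).mono le_rfl
      fun υ hυ => ?_).mono ?_ fun _ h => h
    · exact ⟨by rw [hυ.1, hτ.1, Out.word, List.append_assoc], hτ.2.trans hυ.2 le_rfl⟩
    · simp [Out.cost]
  | when e p hp =>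
    intro k ρ σ hσ
    refine (Runs.seq (e.runs_compile k ρ σ hσ) fun τ hτ => Runs.ite (c := p.cost.eval R) (c' := 1)
      (fun h => ?_) fun h => ?_).mono ?_ fun _ h => h
    · obtain ⟨h1, h2, h3⟩ := hτ
      refine (hp k ρ τ (hσ.congr h2.mem)).mono le_rfl fun υ hυ =>
        ⟨?_, h2.trans hυ.2 le_rfl⟩
      rw [hυ.1, h1, Out.word, if_neg]
      simpa [Expr.eval, reg, h3] using h
    · obtain ⟨h1, h2, h3⟩ := hτ
      refine Runs.skip ⟨?_, h2⟩
      rw [h1, Out.word, if_pos, List.append_nil]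
      simpa [Expr.eval, reg, h3] using h
    · simp only [Out.cost, Polynomial.eval_add, Polynomial.eval_ofNat, reg, Expr.cost]
      omega
  | loop x p hp =>
    intro k ρ σ hσ
    refine (Runs.forLoop (R := R)
      (J := fun j υ => (∀ a ≠ 1, a ≠ 2 → υ.mem a = σ.mem a) ∧
        (∀ i : ℕ, i < k → υ.mem 1 i = σ.mem 1 i) ∧
        υ.out = σ.out ++ (List.range j).flatMap fun j : ℕ => p.word R T (Function.update ρ x j))
        hσ.bound ?_ ?_ ?_).mono le_rfl ?_
    · rintro j - υ υ' ⟨h2, h3, h4⟩ g1 g2 g3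
      refine ⟨fun a ha ha' => (g2 a ha ha').trans (h2 a ha ha'), fun i hi => ?_, g1.trans h4⟩
      rw [g3 i (by omega), h3 i hi]
    · exact ⟨fun _ _ _ => rfl, fun _ _ => rfl, by simp⟩
    · rintro j hj υ ⟨h2, h3, h4⟩ g2 g3
      have hrep : Represents R T (Function.update ρ x j) υ.mem := by
        refine ⟨fun t => ?_, fun y => ?_, g3⟩
        · rw [h2 _ (by omega) (by omega), hσ.tab]
        · rw [g2]
          by_cases hy : y = x
          · simp [hy]
          · rw [Function.update_of_ne hy, Function.update_of_ne (by exact_mod_cast hy), hσ.var]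
      refine (hp (k + 1) _ υ hrep).mono le_rfl fun υ' hυ' => ?_
      obtain ⟨f1, f2⟩ := hυ'
      refine ⟨⟨fun a ha ha' => ?_, fun i hi => ?_, ?_⟩, ?_, ?_, ?_⟩
      · rw [f2.mem a ha, h2 a ha ha']
      · rw [f2.reg i (by omega), h3 i hi]
      · rw [f1, h4, List.range_succ, List.flatMap_append, List.append_assoc]
        simp
      · rw [f2.mem 2 (by omega)]
      · rw [f2.mem 3 (by omega)]
      · rw [f2.reg k (by omega)]
    · rintro υ ⟨⟨h2, h3, h4⟩, g2, g3⟩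
      refine ⟨h4, fun a ha => ?_, h3⟩
      by_cases ha' : a = 2
      · rw [ha', g2]
      · exact h2 a ha ha'

/-! ## Powers -/

/-- Multiply cell `1` of array `3` by cell `0` of array `4`. -/
def mulProg : Prog :=
  .seq (.write 3 (.const 2) (.const 0)) (.seq (.write 3 (.const 3) (.const 0))
    (.seq (.while (.lt (.read 3 (.const 3)) (.read 4 (.const 0)))
      (.seq (.write 3 (.const 2) (.add (.read 3 (.const 2)) (.read 3 (.const 1))))
        (.write 3 (.const 3) (.add (.read 3 (.const 3)) (.const 1)))))
    (.write 3 (.const 1) (.read 3 (.const 2)))))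

/-- Repeated addition: after `j` rounds cell `2` holds `j * v` and cell `3` the counter `j`. -/
theorem runs_mulProg {A : ℕ} {v : ℤ} (σ : State) (hA : σ.mem 4 0 = A) (hv : σ.mem 3 1 = v) :
    Runs mulProg σ (A * 30 + 30) fun τ =>
      τ.out = σ.out ∧ (∀ a ≠ 3, τ.mem a = σ.mem a) ∧ τ.mem 3 1 = A * v := by
  have key : Runs mulProg σ (3 + (3 + ((A * (20 + 5 + 1) + 5 + 1) + 4))) fun τ =>
      τ.out = σ.out ∧ (∀ a ≠ 3, τ.mem a = σ.mem a) ∧ τ.mem 3 1 = A * v := by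
    refine Runs.seq (Mid := fun τ => τ.out = σ.out ∧ (∀ a ≠ 3, τ.mem a = σ.mem a) ∧
      τ.mem 3 1 = v ∧ τ.mem 3 2 = 0) (Runs.write ?_) fun τ hτ => ?_
    · exact ⟨rfl, fun a ha => State.write_mem_of_ne _ _ _ ha, by simp [Expr.eval, hv],
        by simp [Expr.eval]⟩
    refine Runs.seq (Mid := fun τ => τ.out = σ.out ∧ (∀ a ≠ 3, τ.mem a = σ.mem a) ∧
      τ.mem 3 1 = v ∧ τ.mem 3 2 = (0 : ℕ) * v ∧ τ.mem 3 3 = (0 : ℕ)) (Runs.write ?_) fun τ hτ => ?_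
    · obtain ⟨h1, h2, h3, h4⟩ := hτ
      exact ⟨h1, fun a ha => (State.write_mem_of_ne _ _ _ ha).trans (h2 a ha),
        by simp [Expr.eval, h3], by simp [Expr.eval, h4], by simp [Expr.eval]⟩
    refine Runs.seq (Runs.while (R := A) (c := 20) (I := fun j τ => τ.out = σ.out ∧
      (∀ a ≠ 3, τ.mem a = σ.mem a) ∧ τ.mem 3 1 = v ∧ τ.mem 3 2 = j * v ∧ τ.mem 3 3 = j) ?_ ?_ hτ)
      fun υ hυ => Runs.write ?_
    · rintro j - υ ⟨h1, h2, h3, h4, h5⟩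
      simp [Expr.eval, h2, h5, hA]
    · rintro j - υ ⟨h1, h2, h3, h4, h5⟩
      refine (Runs.seq (Mid := fun τ => τ.out = σ.out ∧ (∀ a ≠ 3, τ.mem a = σ.mem a) ∧
        τ.mem 3 1 = v ∧ τ.mem 3 2 = (j + 1) * v ∧ τ.mem 3 3 = j) (Runs.write ?_)
        fun τ hτ => Runs.write ?_).mono ?_ fun _ h => h
      · exact ⟨h1, fun a ha => (State.write_mem_of_ne _ _ _ ha).trans (h2 a ha),
          by simp [Expr.eval, h3], by simp [Expr.eval, h3, h4]; ring, by simp [Expr.eval, h5]⟩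
      · obtain ⟨h1, h2, h3, h4, h5⟩ := hτ
        exact ⟨h1, fun a ha => (State.write_mem_of_ne _ _ _ ha).trans (h2 a ha),
          by simp [Expr.eval, h3], by simp [Expr.eval, h4], by simp [Expr.eval, h5]⟩
      · simp [Expr.cost]
    · obtain ⟨h1, h2, h3, h4, h5⟩ := hυ
      exact ⟨h1, fun a ha => (State.write_mem_of_ne _ _ _ ha).trans (h2 a ha),
        by simp [Expr.eval, h4]⟩
  exact key.mono (by omega) fun _ h => h

/-- Put the `k`-th power of cell `0` of array `4` into cell `1` of array `3`. -/
def powProg : ℕ → Prog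
  | 0 => .write 3 (.const 1) (.const 1)
  | k + 1 => .seq (powProg k) mulProg

theorem runs_powProg {A : ℕ} (σ : State) (hA : σ.mem 4 0 = A) (k : ℕ) :
    Runs (powProg k) σ (k * (A * 30 + 30) + 3) fun τ =>
      τ.out = σ.out ∧ (∀ a ≠ 3, τ.mem a = σ.mem a) ∧ τ.mem 3 1 = (A ^ k : ℕ) := by
  induction k with
  | zero =>
    refine (Runs.write ?_).mono (by simp [Expr.cost]) fun _ h => h
    exact ⟨rfl, fun a ha => State.write_mem_of_ne _ _ _ ha, by simp [Expr.eval]⟩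
  | succ k ih =>
    refine (Runs.seq ih fun τ hτ => (runs_mulProg τ (by rw [hτ.2.1 4 (by omega), hA])
      hτ.2.2).mono le_rfl fun υ hυ => ?_).mono (by rw [Nat.succ_mul]; omega) fun _ h => h
    refine ⟨hυ.1.trans hτ.1, fun a ha => (hυ.2.1 a ha).trans (hτ.2.1 a ha), ?_⟩
    rw [hυ.2.2, pow_succ]; push_cast; ring

/-- The initialization for inputs of the form `n, m, …`: with `A = n + m + 2`, the cells `0, 1, 2`
of table `1` receive `A`, `A ^ d` and `A ^ (d + 1)`, and the range becomes `A ^ (4 * (d + 1))`. -/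
def initProg (d : ℕ) : Prog :=
  .seq (.write 4 (.const 0) (.add (.add (.read 0 (.const 0)) (.read 0 (.const 1))) (.const 2)))
  (.seq (.seq (powProg d) (.write 4 (.const 1) (.read 3 (.const 1))))
  (.seq (.seq (powProg (d + 1)) (.write 4 (.const 2) (.read 3 (.const 1))))
  (.seq (powProg (4 * (d + 1))) (.write 3 (.const 0) (.read 3 (.const 1))))))

/-- The tables after the initialization. -/
def baseTables (w : List ℤ) (A d : ℕ) (t : ℕ) (i : ℤ) : ℤ :=
  if t = 0 then (if 0 ≤ i then w.getD i.toNat 0 else 0)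
  else if t = 1 then
    (if i = 0 then (A : ℤ) else if i = 1 then (A : ℤ) ^ d else if i = 2 then (A : ℤ) ^ (d + 1) else 0)
  else 0

/-- The running time of the initialization, as a polynomial in `A`. -/
noncomputable def initCost (d : ℕ) : Polynomial ℕ :=
  ((6 * d + 10 : ℕ) : Polynomial ℕ) * (Polynomial.X * 30 + 30) + 50

theorem runs_initProg (d : ℕ) {w : List ℤ} {n m : ℕ} (hn : w.getD 0 0 = n) (hm : w.getD 1 0 = m) :
    Runs (initProg d) (initial w) ((initCost d).eval (n + m + 2)) fun τ => τ.out = [] ∧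
      Represents ((n + m + 2) ^ (4 * (d + 1))) (baseTables w (n + m + 2) d) 0 τ.mem := by
  set A := n + m + 2 with hA
  set σ := initial w with hσ
  have h0 : ∀ a, a ≠ 0 → σ.mem a = 0 := fun a ha => by funext i; simp [hσ, initial, ha]
  refine (Runs.seq (Mid := fun τ => τ.out = [] ∧ (∀ a ≠ 4, τ.mem a = σ.mem a) ∧
    ∀ i, τ.mem 4 i = if i = 0 then (A : ℤ) else 0) (Runs.write ?_) fun τ hτ =>
    Runs.seq (Mid := fun τ => τ.out = [] ∧ (∀ a ≠ 4, a ≠ 3 → τ.mem a = σ.mem a) ∧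
      ∀ i, τ.mem 4 i = if i = 0 then (A : ℤ) else if i = 1 then (A : ℤ) ^ d else 0)
      (Runs.seq (runs_powProg (A := A) τ ?_ d) fun υ hυ => Runs.write ?_)
    fun τ hτ =>
    Runs.seq (Mid := fun τ => τ.out = [] ∧ (∀ a ≠ 4, a ≠ 3 → τ.mem a = σ.mem a) ∧
      ∀ i, τ.mem 4 i = if i = 0 then (A : ℤ) else if i = 1 then (A : ℤ) ^ d else
        if i = 2 then (A : ℤ) ^ (d + 1) else 0)
      (Runs.seq (runs_powProg (A := A) τ ?_ (d + 1)) fun υ hυ => Runs.write ?_)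
    fun τ hτ =>
      (Runs.seq (runs_powProg (A := A) τ ?_ (4 * (d + 1))) fun υ hυ => Runs.write ?_)).mono ?_
        fun _ h => h
  · refine ⟨rfl, fun a ha => State.write_mem_of_ne _ _ _ ha, fun i => ?_⟩
    have e0 : σ.mem 0 0 = n := by simpa [hσ, initial] using hn
    have e1 : σ.mem 0 1 = m := by simpa [hσ, initial] using hm
    simp [Expr.eval, e0, e1, h0 4, hA]
  · rw [hτ.2.2]; simp
  · obtain ⟨h1, h2, h3⟩ := hτ
    obtain ⟨g1, g2, g3⟩ := hυ
    refine ⟨g1.trans h1, fun a ha ha' => by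
      rw [State.write_mem_of_ne _ _ _ ha, g2 a ha', h2 a ha], fun i => ?_⟩
    simp only [State.write_mem, Expr.eval, g3, g2 4 (by omega), h3, true_and]
    split_ifs <;> simp_all
  · rw [hτ.2.2]; simp
  · obtain ⟨h1, h2, h3⟩ := hτ
    obtain ⟨g1, g2, g3⟩ := hυ
    refine ⟨g1.trans h1, fun a ha ha' => by
      rw [State.write_mem_of_ne _ _ _ ha, g2 a ha', h2 a ha ha'], fun i => ?_⟩
    simp only [State.write_mem, Expr.eval, g3, g2 4 (by omega), h3, true_and]
    split_ifs <;> simp_all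
  · rw [hτ.2.2]; simp
  · obtain ⟨h1, h2, h3⟩ := hτ
    obtain ⟨g1, g2, g3⟩ := hυ
    refine ⟨g1.trans h1, fun t => ?_, fun x => ?_, ?_⟩
    · rw [State.write_mem_of_ne _ _ _ (by omega), g2 _ (by omega)]
      funext i
      by_cases ht : t = 0
      · subst ht
        rw [mul_zero, h2 0 (by omega) (by omega)]
        simp [hσ, initial, baseTables]
      · by_cases ht' : t = 1
        · subst ht'
          simp [h3, baseTables]
        · rw [h2 _ (by omega) (by omega), h0 _ (by omega)]
          simp [baseTables, ht, ht']
    · rw [State.write_mem_of_ne _ _ _ (by omega), g2 _ (by omega), h2 _ (by omega) (by omega),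
        h0 _ (by omega)]
      rfl
    · simp [Expr.eval, g3]
  · simp only [initCost, Expr.cost, Polynomial.eval_add, Polynomial.eval_mul, Polynomial.eval_X,
      Polynomial.eval_ofNat, Polynomial.eval_natCast]
    nlinarith

/-! ### Assembly of the program and its time bound -/

/-- The combination of initialization, tables and output. -/
theorem exists_exec (d : ℕ) (l : List (ℕ × TExpr)) (o : Out) :
    ∃ T : Polynomial ℕ, ∀ (w : List ℤ) (n m : ℕ), w.getD 0 0 = n → w.getD 1 0 = m →
      (n + m + 2) ^ (4 * (d + 1)) ≤ T.eval (n + m) ∧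
      ∃ steps final, Exec (.seq (initProg d) (.seq (fillAll l) (o.compile 0))) (initial w)
        steps final ∧ steps ≤ T.eval (n + m) ∧
        final.out = o.word ((n + m + 2) ^ (4 * (d + 1))) (filled ((n + m + 2) ^ (4 * (d + 1))) l
          (baseTables w (n + m + 2) d)) 0 := by
  -- Substituting `X + 2` turns `n + m` into `A`, and `X ^ (4 * (d + 1))` turns `A` into the range.
  -- The additional summand `X` makes the polynomial bound the range itself, hence later the sizes
  -- of the matrices.
  refine ⟨(initCost d + (fillCost l + o.cost + Polynomial.X).comp
    (Polynomial.X ^ (4 * (d + 1)))).comp (Polynomial.X + 2), fun w n m hn hm => ⟨?_, ?_⟩⟩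
  · simp only [Polynomial.eval_comp, Polynomial.eval_add, Polynomial.eval_pow, Polynomial.eval_X,
      Polynomial.eval_ofNat]
    omega
  · obtain ⟨k, τ, h1, h2, h3, h4⟩ := Runs.seq (runs_initProg d hn hm) fun τ hτ =>
      Runs.seq (runs_fillAll l _ τ hτ.2) fun υ hυ => (o.runs_compile 0 0 υ hυ.2).mono le_rfl
        (Post' := fun τ' => τ'.out = o.word _ (filled _ l (baseTables w (n + m + 2) d)) 0 ∧ True)
        fun τ' hτ' => ⟨by rw [hτ'.1, hυ.1, hτ.1, List.nil_append], trivial⟩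
    refine ⟨k, τ, h1, h2.trans ?_, h3⟩
    simp only [Polynomial.eval_comp, Polynomial.eval_add, Polynomial.eval_pow, Polynomial.eval_X,
      Polynomial.eval_ofNat]
    omega

end RAM

namespace ArcDigraph

variable {n m : ℕ} {G : ArcDigraph n m}

/-! ## Walks in acyclic digraphs -/

/-- There is a walk from `u` to `v`. -/
def Reach (G : ArcDigraph n m) (u v : Fin n) : Prop := ∃ p, G.IsWalk u v p

theorem isWalk_append {u w : Fin n} {p q : List (Fin m)} :
    G.IsWalk u w (p ++ q) ↔ ∃ v, G.IsWalk u v p ∧ G.IsWalk v w q := by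
  induction p generalizing u with
  | nil => simp [IsWalk]
  | cons a p ih => simp [IsWalk, ih, and_assoc]

theorem Reach.refl (u : Fin n) : G.Reach u u := ⟨[], rfl⟩

theorem Reach.trans {u v w : Fin n} (h : G.Reach u v) (h' : G.Reach v w) : G.Reach u w := by
  obtain ⟨p, hp⟩ := h
  obtain ⟨q, hq⟩ := h'
  exact ⟨p ++ q, isWalk_append.2 ⟨v, hp, hq⟩⟩

theorem reach_arc (a : Fin m) : G.Reach (G.tail a) (G.head a) := ⟨[a], rfl, rfl⟩

theorem Reach.cases {u w : Fin n} (h : G.Reach u w) :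
    u = w ∨ ∃ a, G.tail a = u ∧ G.Reach (G.head a) w := by
  obtain ⟨_ | ⟨a, p⟩, hp⟩ := h
  · exact .inl hp
  · exact .inr ⟨a, hp.1, p, hp.2⟩

theorem IsWalk.reach_of_mem {u v : Fin n} {p : List (Fin m)} (h : G.IsWalk u v p) {a : Fin m}
    (ha : a ∈ p) : G.Reach u (G.tail a) ∧ G.Reach (G.head a) v := by
  obtain ⟨q, r, rfl⟩ := List.append_of_mem ha
  obtain ⟨x, h1, h2, h3⟩ := isWalk_append.1 h
  exact ⟨⟨q, h2 ▸ h1⟩, ⟨r, h3⟩⟩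

theorem Acyclic.not_reach (hG : G.Acyclic) (a : Fin m) : ¬ G.Reach (G.head a) (G.tail a) := by
  rintro ⟨p, hp⟩
  exact absurd (hG (G.tail a) (a :: p) ⟨rfl, hp⟩) (by simp)

/-- Returning to a vertex would close a cycle, so simplicity may be forgotten and paths may be
concatenated freely. -/
theorem Acyclic.isPath (hG : G.Acyclic) {u v : Fin n} {p : List (Fin m)} (h : G.IsWalk u v p) :
    G.IsPath u v p := by
  refine ⟨h, ?_⟩
  induction p generalizing u with
  | nil => simp
  | cons a p ih =>
    rw [List.nodup_cons]
    refine ⟨fun hu => ?_, ih h.2⟩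
    obtain ⟨b, hb, hbu⟩ := List.mem_map.1 hu
    exact hG.not_reach b (hbu ▸ (h.reach_of_mem hb).1)

theorem Acyclic.nodup (hG : G.Acyclic) {u v : Fin n} {p : List (Fin m)} (h : G.IsWalk u v p) :
    p.Nodup := (List.nodup_cons.1 (hG.isPath h).2).2.of_map

theorem Acyclic.length_lt (hG : G.Acyclic) {u v : Fin n} {p : List (Fin m)}
    (h : G.IsWalk u v p) : p.length < n := by
  simpa [Nat.succ_le_iff] using (hG.isPath h).2.length_le_card

/-! ## Canonical paths -/

open Classical in
/-- The last arc among the first `k` arcs by which one can leave `u` towards `w`. -/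
noncomputable def nextBelow (G : ArcDigraph n m) (u w : Fin n) : ℕ → Option (Fin m)
  | 0 => none
  | k + 1 => if h : ∃ hk : k < m, G.tail ⟨k, hk⟩ = u ∧ G.Reach (G.head ⟨k, hk⟩) w
      then some ⟨k, h.1⟩ else nextBelow G u w k

/-- The canonical arc by which one leaves `u` towards `w`. -/
noncomputable def next (G : ArcDigraph n m) (u w : Fin n) : Option (Fin m) := G.nextBelow u w m

theorem nextBelow_eq_some {u w : Fin n} {k : ℕ} {a : Fin m} (h : G.nextBelow u w k = some a) :
    G.tail a = u ∧ G.Reach (G.head a) w := by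
  induction k with
  | zero => simp [nextBelow] at h
  | succ k ih =>
    rw [nextBelow] at h
    split_ifs at h with hk
    · obtain rfl := Option.some.inj h
      exact hk.2
    · exact ih h

theorem nextBelow_eq_none {u w : Fin n} {k : ℕ} (h : G.nextBelow u w k = none) (a : Fin m)
    (hak : (a : ℕ) < k) (ha : G.tail a = u) : ¬ G.Reach (G.head a) w := by
  induction k with
  | zero => omega
  | succ k ih =>
    rw [nextBelow] at h
    split_ifs at h with hk
    rcases Nat.lt_succ_iff_lt_or_eq.1 hak with hlt | rfl
    · exact ih h hlt
    · exact fun hr => hk ⟨a.2, ha, hr⟩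

theorem next_eq_some {u w : Fin n} {a : Fin m} (h : G.next u w = some a) :
    G.tail a = u ∧ G.Reach (G.head a) w := nextBelow_eq_some h

theorem eq_of_next_eq_none {u w : Fin n} (h : G.next u w = none) (hr : G.Reach u w) : u = w :=
  hr.cases.resolve_right fun ⟨a, ha, har⟩ => nextBelow_eq_none h a a.2 ha har

/-- The first `k` arcs of the canonical path from `u` to `w`. -/
noncomputable def canonBelow (G : ArcDigraph n m) : ℕ → Fin n → Fin n → List (Fin m)
  | 0, _, _ => []
  | k + 1, u, w => match G.next u w with
    | none => []
    | some a => a :: canonBelow G k (G.head a) w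

/-- The canonical path from `u` to `w`. -/
noncomputable def canon (G : ArcDigraph n m) (u w : Fin n) : List (Fin m) := G.canonBelow n u w

/-- From a vertex that reaches `w`, a canonical arc can be missing only if the vertex is `w`, so a
construction that stops early has arrived. -/
theorem canonBelow_walk {w : Fin n} (k : ℕ) {u : Fin n} (h : G.Reach u w) :
    ∃ v, G.IsWalk u v (G.canonBelow k u w) ∧ (v = w ∨ (G.canonBelow k u w).length = k) := by
  induction k generalizing u with
  | zero => exact ⟨u, rfl, .inr rfl⟩
  | succ k ih =>
    rw [canonBelow]
    cases hx : G.next u w with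
    | none => exact ⟨u, rfl, .inl (eq_of_next_eq_none hx h)⟩
    | some a =>
      obtain ⟨h1, h2⟩ := next_eq_some hx
      obtain ⟨v, h3, h4⟩ := ih h2
      exact ⟨v, ⟨h1, h3⟩, h4.imp id fun h => by simp [h]⟩

/-- A list shorter than its bound ended for want of a canonical arc, so a larger bound changes
nothing. -/
theorem canonBelow_succ {w : Fin n} (k : ℕ) {u : Fin n} (h : (G.canonBelow k u w).length < k) :
    G.canonBelow (k + 1) u w = G.canonBelow k u w := by
  induction k generalizing u with
  | zero => simp at h
  | succ k ih =>
    rw [canonBelow] at h ⊢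
    rw [canonBelow]
    cases hx : G.next u w with
    | none => rfl
    | some a =>
      simp only [hx, List.length_cons, Nat.succ_lt_succ_iff] at h ⊢
      rw [ih h]

theorem Acyclic.canon_walk (hG : G.Acyclic) {u w : Fin n} (h : G.Reach u w) :
    G.IsWalk u w (G.canon u w) := by
  obtain ⟨v, h1, rfl | h2⟩ := canonBelow_walk n h
  · exact h1
  · exact absurd h2 (hG.length_lt h1).ne

theorem Acyclic.canon_self (hG : G.Acyclic) (w : Fin n) : G.canon w w = [] :=
  hG w _ (hG.canon_walk (Reach.refl w))

/-- Unfolding lowers the bound from `n` to `n - 1`; as walks have fewer than `n` arcs, it can be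
raised to `n` again. -/
theorem Acyclic.canon_eq_cons (hG : G.Acyclic) {u w : Fin n} {a : Fin m}
    (h : G.next u w = some a) : G.canon u w = a :: G.canon (G.head a) w := by
  obtain ⟨h1, h2⟩ := next_eq_some h
  have hw := hG.canon_walk (h1 ▸ (reach_arc a).trans h2 : G.Reach u w)
  obtain ⟨k, rfl⟩ : ∃ k, n = k + 1 := ⟨n - 1, by have := u.2; omega⟩
  have hl := hG.length_lt hw
  simp only [canon] at hl ⊢
  have e : G.canonBelow (k + 1) u w = a :: G.canonBelow k (G.head a) w := by
    rw [canonBelow]; simp only [h]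
  rw [e, List.length_cons] at hl
  rw [e, canonBelow_succ k (by omega)]

theorem next_of_mem_canonBelow {w : Fin n} {a : Fin m} (k : ℕ) {u : Fin n}
    (h : a ∈ G.canonBelow k u w) : G.next (G.tail a) w = some a := by
  induction k generalizing u with
  | zero => simp [canonBelow] at h
  | succ k ih =>
    rw [canonBelow] at h
    cases hx : G.next u w with
    | none => simp [hx] at h
    | some b =>
      simp only [hx, List.mem_cons] at h
      rcases h with rfl | h
      · rw [(next_eq_some hx).1, hx]
      · exact ih h

theorem next_of_mem_canon {u w : Fin n} {a : Fin m} (h : a ∈ G.canon u w) :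
    G.next (G.tail a) w = some a := next_of_mem_canonBelow n h

/-! ## Reduced lists and the coefficients of the expansion

Lists of arcs are written with the last arc of a path first. -/

/-- The list consists of the arcs of a walk from `s` to `w`, none of which is the canonical arc
towards the tail of the arc used after it (towards `w` for the last arc). -/
def Reduced (G : ArcDigraph n m) (s : Fin n) : List (Fin m) → Fin n → Prop
  | [], w => G.Reach s w
  | a :: D, w => G.Reach (G.head a) w ∧ G.next (G.tail a) w ≠ some a ∧ Reduced G s D (G.tail a)

/-- The indicator of `B ⊆ P`. -/
def incl (B P : List (Fin m)) : ℤ := if ∀ b ∈ B, b ∈ P then 1 else 0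

/-- The arcs of `B` that are not in `Q`. -/
def rest (B Q : List (Fin m)) : List (Fin m) := B.filter fun b => b ∉ Q

/-- The coefficient of the monomial of `D` in the expansion of the monomial of `B`. -/
noncomputable def coeff (G : ArcDigraph n m) (s : Fin n) :
    List (Fin m) → Fin n → List (Fin m) → ℤ
  | [], w, B => incl B (G.canon s w)
  | a :: D, w, B => coeff G s D (G.tail a) (rest B (a :: G.canon (G.head a) w)) -
      coeff G s D (G.tail a) (rest B (G.canon (G.tail a) w))

/-- The mixed difference of a function of paths. -/
noncomputable def diff (G : ArcDigraph n m) (s : Fin n) :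
    List (Fin m) → Fin n → (List (Fin m) → ℝ) → ℝ
  | [], w, F => F (G.canon s w)
  | a :: D, w, F => diff G s D (G.tail a) fun P =>
      F (P ++ a :: G.canon (G.head a) w) - F (P ++ G.canon (G.tail a) w)

/-- With a fixed end `Q`, a monomial becomes a monomial in the prefix. This is why mixed differences
of monomials obey the recursion of `coeff`. -/
theorem incl_append (B P Q : List (Fin m)) : incl B (P ++ Q) = incl (rest B Q) P := by
  unfold incl rest
  congr 1
  simp only [List.mem_append, List.mem_filter, decide_eq_true_eq, and_imp, eq_iff_iff]
  exact forall₂_congr fun b _ => by tauto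

theorem diff_sum {s : Fin n} {ι : Type*} (S : Finset ι) (c : ι → ℝ) (D : List (Fin m)) :
    ∀ (w : Fin n) (F : ι → List (Fin m) → ℝ),
      G.diff s D w (fun P => ∑ i ∈ S, c i * F i P) = ∑ i ∈ S, c i * G.diff s D w (F i) := by
  induction D with
  | nil => intro w F; rfl
  | cons a D ih =>
    intro w F
    simp only [diff]
    rw [← ih]
    congr 1
    funext P
    rw [← Finset.sum_sub_distrib]
    exact Finset.sum_congr rfl fun i _ => by ring

theorem diff_incl {s : Fin n} (D : List (Fin m)) :
    ∀ (w : Fin n) (B : List (Fin m)),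
      G.diff s D w (fun P => (incl B P : ℝ)) = G.coeff s D w B := by
  induction D with
  | nil => intro w B; rfl
  | cons a D ih =>
    intro w B
    simp only [diff, coeff, incl_append]
    -- The subtraction is read as a signed sum of two terms, so that linearity applies.
    have := diff_sum (G := G) (s := s) (Finset.univ : Finset Bool) (fun b => if b then 1 else -1) D
      (G.tail a) (fun b P => if b then (incl (rest B (a :: G.canon (G.head a) w)) P : ℝ) else
        incl (rest B (G.canon (G.tail a) w)) P)
    simp only [Fintype.sum_bool, if_true, Bool.false_eq_true, if_false, one_mul, neg_mul, ih,
      ← sub_eq_add_neg] at this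
    rw [this]; push_cast; rfl

/-- Reducedness contains the reachability that makes all lists at which the function is evaluated
walks from `s` to `w`. -/
theorem Acyclic.diff_congr (hG : G.Acyclic) {s : Fin n} (D : List (Fin m)) :
    ∀ (w : Fin n) (F F' : List (Fin m) → ℝ), G.Reduced s D w →
      (∀ P, G.IsWalk s w P → F P = F' P) → G.diff s D w F = G.diff s D w F' := by
  induction D with
  | nil => exact fun w F F' h hF => hF _ (hG.canon_walk h)
  | cons a D ih =>
    intro w F F' h hF
    refine ih _ _ _ h.2.2 fun P hP => ?_
    rw [hF (P ++ a :: _) (isWalk_append.2 ⟨_, hP, rfl, hG.canon_walk h.1⟩),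
      hF _ (isWalk_append.2 ⟨_, hP, hG.canon_walk ((reach_arc a).trans h.1)⟩)]

open Classical in
/-- The expansion of a monomial on walks. -/
theorem Acyclic.incl_eq_sum (hG : G.Acyclic) {s : Fin n} (L : List (Fin m)) :
    ∀ u, G.IsWalk s u L.reverse → ∀ w, G.Reach u w → ∀ B,
      incl B (L.reverse ++ G.canon u w) =
        (L.sublists'.map fun D => if G.Reduced s D w then G.coeff s D w B else 0).sum := by
  induction L with
  | nil =>
    intro u hu w hw B
    obtain rfl : s = u := hu
    simp [Reduced, coeff, hw]
  | cons a L ih =>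
    intro u hu w hw B
    rw [List.reverse_cons, isWalk_append] at hu
    obtain ⟨x, hx, rfl, rfl⟩ := hu
    have hw' := (reach_arc a).trans hw
    -- The sublists without `a` account for the walk whose end from `tail a` on is replaced by the
    -- canonical path; those with `a` have to supply the difference.
    rw [List.sublists'_cons, List.map_append, List.sum_append, ← ih _ hx w hw' B, List.map_map,
      List.reverse_cons, List.append_assoc, List.singleton_append]
    by_cases hn : G.next (G.tail a) w = some a
    -- A canonical `a` changes nothing by the replacement, and no list starting with `a` is reduced.
    · rw [hG.canon_eq_cons hn, left_eq_add]
      refine List.sum_eq_zero fun z hz => ?_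
      obtain ⟨D, -, rfl⟩ := List.mem_map.1 hz
      simp [Reduced, hn]
    -- The terms with `a` are differences of expansions with target `tail a`, where the canonical
    -- end is empty; the induction hypothesis sums both.
    · have e : (fun D => if G.Reduced s D w then G.coeff s D w B else 0) ∘ List.cons a =
          fun D => (if G.Reduced s D (G.tail a) then
              G.coeff s D (G.tail a) (rest B (a :: G.canon (G.head a) w)) else 0) -
            (if G.Reduced s D (G.tail a) then
              G.coeff s D (G.tail a) (rest B (G.canon (G.tail a) w)) else 0) := by
        funext D
        simp only [Function.comp, Reduced, hw, hn, ne_eq, not_false_eq_true, true_and, coeff]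
        split_ifs <;> simp
      have sub : ∀ (l : List (List (Fin m))) (f g : List (Fin m) → ℤ),
          (l.map fun D => f D - g D).sum = (l.map f).sum - (l.map g).sum := by
        intro l f g
        induction l with
        | nil => simp
        | cons b l ih => simp only [List.map_cons, List.sum_cons, ih]; ring
      rw [e, sub, ← ih _ hx _ (Reach.refl _), ← ih _ hx _ (Reach.refl _), hG.canon_self,
        List.append_nil, ← incl_append, ← incl_append]
      ring

/-- An arc `b` that can be used after arriving at `u` lies on no walk to `u`, so the monomial
vanishes on these walks; no removal in the recursion ever deletes `b`. -/
theorem Acyclic.coeff_eq_zero_of_after (hG : G.Acyclic) {s : Fin n} {b : Fin m}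
    (D : List (Fin m)) : ∀ (u : Fin n) (B : List (Fin m)), G.Reduced s D u → b ∈ B →
      G.Reach u (G.tail b) → G.coeff s D u B = 0 := by
  have hnot : ∀ {u x : Fin n}, G.Reach u (G.tail b) → G.Reach x u → b ∉ G.canon x u :=
    fun hu hx hb => hG.not_reach b ((((hG.canon_walk hx).reach_of_mem hb).2).trans hu)
  induction D with
  | nil =>
    intro u B h hb hu
    rw [coeff, incl, if_neg]
    exact fun hB => hnot hu h (hB b hb)
  | cons a D ih =>
    intro u B h hb hu
    have hr : G.Reach (G.tail a) (G.tail b) := ((reach_arc a).trans h.1).trans hu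
    rw [coeff, ih _ _ h.2.2 (by
        simp only [rest, List.mem_filter, hb, true_and, decide_eq_true_eq, List.mem_cons, not_or]
        refine ⟨?_, hnot hu h.1⟩
        rintro rfl
        exact hG.not_reach b (h.1.trans hu)) hr,
      ih _ _ h.2.2 (by
        simpa [rest, hb] using hnot hu ((reach_arc a).trans h.1)) hr, sub_zero]

theorem rest_eq_self {B Q : List (Fin m)} (h : ∀ b ∈ B, b ∉ Q) : rest B Q = B :=
  List.filter_eq_self.2 fun b hb => by simpa using h b hb

theorem length_rest_lt {B Q : List (Fin m)} {b : Fin m} (hb : b ∈ B) (hQ : b ∈ Q) :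
    (rest B Q).length < B.length :=
  List.length_filter_lt_length_iff_exists.2 ⟨b, hb, by simpa using hQ⟩

/-- Each difference lowers the degree of a monomial, so `|D|` differences annihilate a monomial of
degree less than `|D|`. -/
theorem Acyclic.coeff_eq_zero_of_length (hG : G.Acyclic) {s : Fin n} (D : List (Fin m)) :
    ∀ (w : Fin n) (B : List (Fin m)), G.Reduced s D w → B.length < D.length →
      G.coeff s D w B = 0 := by
  induction D with
  | nil => intro w B _ h; simp at h
  | cons a D ih =>
    intro w B h hB
    have hw := (reach_arc a).trans h.1
    by_cases hex : ∃ b ∈ B, b ∈ a :: G.canon (G.head a) w ∨ b ∈ G.canon (G.tail a) w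
    · obtain ⟨b, hb, hbQ⟩ := hex
      have hr : G.Reach (G.tail a) (G.tail b) := by
        rcases hbQ with hbQ | hbQ
        · exact (IsWalk.reach_of_mem (G := G) (u := G.tail a) (v := w) (p := a :: _)
            ⟨rfl, hG.canon_walk h.1⟩ hbQ).1
        · exact ((hG.canon_walk hw).reach_of_mem hbQ).1
      -- For either end `Q`, the arc `b` is removed and the degree drops, or it remains and comes
      -- too late for any walk to `tail a`.
      have key : ∀ Q, G.coeff s D (G.tail a) (rest B Q) = 0 := by
        intro Q
        by_cases hQ : b ∈ Q
        · refine ih _ _ h.2.2 ?_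
          have := length_rest_lt hb hQ
          rw [List.length_cons] at hB
          omega
        · exact hG.coeff_eq_zero_of_after D _ _ h.2.2 (by simp [rest, hb, hQ]) hr
      rw [coeff, key, key, sub_zero]
    · push Not at hex
      rw [coeff, rest_eq_self fun b hb => (hex b hb).1, rest_eq_self fun b hb => (hex b hb).2,
        sub_self]

theorem Reduced.reach_of_mem {s : Fin n} {D : List (Fin m)} : ∀ {w : Fin n}, G.Reduced s D w →
    ∀ b ∈ D, G.Reach (G.head b) w := by
  induction D with
  | nil => simp
  | cons a D ih =>
    intro w h b hb
    rcases List.mem_cons.1 hb with rfl | hb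
    · exact h.1
    · exact ((ih h.2.2 b hb).trans (reach_arc a)).trans h.1

/-- The first arc of a reduced list is never on a canonical path to `w`. Hence it can be removed
only by being the distinguished arc `a`, and this forces the two lists to agree arc by arc. The
result is the identity block of the constraint matrix. -/
theorem Acyclic.coeff_reduced (hG : G.Acyclic) {s : Fin n} (D : List (Fin m)) :
    ∀ (w : Fin n) (C : List (Fin m)), G.Reduced s D w → G.Reduced s C w →
      G.coeff s D w C = if C = D then 1 else 0 := by
  induction D with
  | nil =>
    intro w C _ hC
    cases C with
    | nil => simp [coeff, incl]
    | cons c C =>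
      rw [coeff, incl, if_neg, if_neg (by simp)]
      exact fun h => hC.2.1 (next_of_mem_canon (h c (by simp)))
  | cons a D ih =>
    intro w C h hC
    have hw := (reach_arc a).trans h.1
    cases C with
    | nil => simp [coeff, rest]
    | cons c C =>
      have hc1 : c ∉ G.canon (G.head a) w := fun hc => hC.2.1 (next_of_mem_canon hc)
      have hc2 : c ∉ G.canon (G.tail a) w := fun hc => hC.2.1 (next_of_mem_canon hc)
      -- The arcs of `C` precede `c`. If one of them comes after `tail a`, then so does `c`, and `c
      -- = a` would give a cycle.
      have hbefore : ∀ b ∈ C, G.Reach (G.tail a) (G.tail b) → G.Reach (G.tail a) (G.tail c) ∧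
          c ≠ a := by
        intro b hb hr
        have h1 := hC.2.2.reach_of_mem b hb
        refine ⟨(hr.trans (reach_arc b)).trans h1, ?_⟩
        rintro rfl
        exact hG.not_reach b (h1.trans hr)
      have hQ1 : ∀ b ∈ a :: G.canon (G.head a) w, G.Reach (G.tail a) (G.tail b) := fun b hb =>
        (IsWalk.reach_of_mem (G := G) (u := G.tail a) (v := w) (p := a :: _)
          ⟨rfl, hG.canon_walk h.1⟩ hb).1
      have hQ2 : ∀ b ∈ G.canon (G.tail a) w, G.Reach (G.tail a) (G.tail b) := fun b hb =>
        ((hG.canon_walk hw).reach_of_mem hb).1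
      by_cases hca : c = a
      · subst hca
        have e1 : rest (c :: C) (c :: G.canon (G.head c) w) = C := by
          have : rest C (c :: G.canon (G.head c) w) = C :=
            rest_eq_self fun b hb hb' => (hbefore b hb (hQ1 b hb')).2 rfl
          simpa [rest] using this
        rw [coeff, e1, ih _ _ h.2.2 hC.2.2, hG.coeff_eq_zero_of_after (b := c) D _ _ h.2.2
          (by simp [rest, hc2]) (Reach.refl _), sub_zero]
        simp
      · rw [if_neg (by simp [hca]), coeff]
        -- If `c` comes after `tail a`, it survives in both terms and makes them vanish; otherwise
        -- neither end meets the list and the terms cancel.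
        by_cases hr : G.Reach (G.tail a) (G.tail c)
        · rw [hG.coeff_eq_zero_of_after (b := c) D _ _ h.2.2 (by simp [rest, hc1, hca]) hr,
            hG.coeff_eq_zero_of_after (b := c) D _ _ h.2.2 (by simp [rest, hc2]) hr, sub_zero]
        · have e : ∀ Q : List (Fin m), (∀ b ∈ Q, G.Reach (G.tail a) (G.tail b)) →
              rest (c :: C) Q = c :: C := by
            refine fun Q hQ => rest_eq_self fun b hb hbQ => ?_
            rcases List.mem_cons.1 hb with rfl | hb
            · exact hr (hQ b hbQ)
            · exact hr (hbefore b hb (hQ b hbQ)).1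
          rw [e _ hQ1, e _ hQ2, sub_self]

/-! ## The order of the arcs -/

open Classical in
/-- The number of vertices that reach `v`. -/
noncomputable def rank (G : ArcDigraph n m) (v : Fin n) : ℕ :=
  (Finset.univ.filter fun x => G.Reach x v).card

/-- Everything that reaches `tail a` reaches `v`, and `v` itself is new by acyclicity; thus ranks
give a topological order. -/
theorem Acyclic.rank_lt (hG : G.Acyclic) (a : Fin m) {v : Fin n} (h : G.Reach (G.head a) v) :
    G.rank (G.tail a) < G.rank v := by
  classical
  refine Finset.card_lt_card (Finset.ssubset_iff_subset_ne.2 ⟨fun x hx => ?_, fun he => ?_⟩)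
  · simp only [Finset.mem_filter, Finset.mem_univ, true_and] at hx ⊢
    exact (hx.trans (reach_arc a)).trans h
  · have : v ∈ Finset.univ.filter fun x => G.Reach x (G.tail a) := by
      rw [he]; simp [Reach.refl]
    simp only [Finset.mem_filter, Finset.mem_univ, true_and] at this
    exact hG.not_reach a (h.trans this)

/-- The key by which arcs are ordered. -/
noncomputable def key (G : ArcDigraph n m) (a : Fin m) : ℕ := G.rank (G.tail a) * (n + m + 2) + a

theorem key_injective (G : ArcDigraph n m) : Function.Injective G.key := by
  intro a b h
  have h1 : (a : ℕ) = G.key a % (n + m + 2) := by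
    rw [key, Nat.mul_add_mod', Nat.mod_eq_of_lt (by omega)]
  have h2 : (b : ℕ) = G.key b % (n + m + 2) := by
    rw [key, Nat.mul_add_mod', Nat.mod_eq_of_lt (by omega)]
  exact Fin.ext (by rw [h1, h2, h])

/-- Lists of arcs with decreasing keys. -/
def Sorted (G : ArcDigraph n m) (l : List (Fin m)) : Prop :=
  l.Pairwise fun a b => G.key b < G.key a

/-- The arcs of a reduced list lie ever earlier on a walk, so the ranks of their tails decrease. A
reduced list is thus determined by its set, and sets can index the coefficients. -/
theorem Acyclic.sorted_of_reduced (hG : G.Acyclic) {s : Fin n} {D : List (Fin m)} :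
    ∀ {w : Fin n}, G.Reduced s D w → G.Sorted D := by
  induction D with
  | nil => exact fun _ => List.Pairwise.nil
  | cons a D ih =>
    refine fun h => List.Pairwise.cons (fun b hb => ?_) (ih h.2.2)
    have := hG.rank_lt b (h.2.2.reach_of_mem b hb)
    unfold key
    have := Nat.mul_le_mul_right (n + m + 2) this
    rw [Nat.succ_mul] at this
    omega

theorem Sorted.nodup {l : List (Fin m)} (h : G.Sorted l) : l.Nodup :=
  List.Pairwise.imp (fun h => by rintro rfl; exact lt_irrefl _ h) h

theorem Sorted.eq {l l' : List (Fin m)} (h : G.Sorted l) (h' : G.Sorted l')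
    (e : l.toFinset = l'.toFinset) : l = l' := by
  refine List.Perm.eq_of_pairwise (fun a b _ _ h1 h2 => absurd h1 h2.asymm) h h' ?_
  exact List.perm_of_nodup_nodup_toFinset_eq h.nodup h'.nodup e

theorem exists_sorted (G : ArcDigraph n m) (B : Finset (Fin m)) :
    ∃ l, G.Sorted l ∧ l.toFinset = B := by
  induction hc : B.card generalizing B with
  | zero => exact ⟨[], List.Pairwise.nil, by simpa using (Finset.card_eq_zero.1 hc).symm⟩
  | succ k ih =>
    obtain ⟨a, ha, hmax⟩ := B.exists_max_image G.key (Finset.card_pos.1 (by omega))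
    obtain ⟨l, hl, hlB⟩ := ih (B.erase a) (by rw [Finset.card_erase_of_mem ha, hc]; rfl)
    refine ⟨a :: l, List.Pairwise.cons (fun b hb => ?_) hl, ?_⟩
    · rw [← List.mem_toFinset, hlB, Finset.mem_erase] at hb
      exact lt_of_le_of_ne (hmax b hb.2) fun e => hb.1 (G.key_injective e)
    · rw [List.toFinset_cons, hlB, Finset.insert_erase ha]

/-- The list of the elements of a set of arcs by decreasing keys. -/
noncomputable def listOf (G : ArcDigraph n m) (B : Finset (Fin m)) : List (Fin m) :=
  (G.exists_sorted B).choose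

theorem sorted_listOf (B : Finset (Fin m)) : G.Sorted (G.listOf B) :=
  (G.exists_sorted B).choose_spec.1

@[simp] theorem listOf_toFinset (B : Finset (Fin m)) : (G.listOf B).toFinset = B :=
  (G.exists_sorted B).choose_spec.2

theorem Sorted.listOf_eq {l : List (Fin m)} (h : G.Sorted l) : G.listOf l.toFinset = l :=
  (sorted_listOf _).eq h (listOf_toFinset _)

theorem length_listOf (B : Finset (Fin m)) : (G.listOf B).length = B.card := by
  rw [← List.toFinset_card_of_nodup (sorted_listOf B).nodup, listOf_toFinset]

theorem mem_listOf {B : Finset (Fin m)} {a : Fin m} : a ∈ G.listOf B ↔ a ∈ B := by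
  rw [← List.mem_toFinset, listOf_toFinset]

/-! ## The linearizable cost functions -/

/-- The coefficient of `D` in the cost function `q`. -/
noncomputable def costCoeff (G : ArcDigraph n m) (s t : Fin n) {d : ℕ} (q : OrderCost m d)
    (D : List (Fin m)) : ℝ :=
  ∑ B : ArcSubset m d, q B * (G.coeff s D t (G.listOf B.1) : ℝ)

theorem orderCost_eq {d : ℕ} (G : ArcDigraph n m) (q : OrderCost m d) (p : List (Fin m)) :
    orderCost q p = ∑ B : ArcSubset m d, q B * (incl (G.listOf B.1) p : ℝ) := by
  rw [orderCost, Finset.sum_filter]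
  refine Finset.sum_congr rfl fun B _ => ?_
  have : (∀ b ∈ G.listOf B.1, b ∈ p) ↔ B.1 ⊆ p.toFinset := by
    simp [Finset.subset_iff, mem_listOf]
  simp [incl, this]

theorem linearCost_eq (c : Fin m → ℝ) (p : List (Fin m)) :
    linearCost c p = ∑ a : Fin m, c a * (incl [a] p : ℝ) := by
  rw [linearCost, ← Finset.sum_subset (Finset.subset_univ p.toFinset)]
  · refine Finset.sum_congr rfl fun a ha => ?_
    simp [incl, List.mem_toFinset.1 ha]
  · intro a _ ha
    simp [incl, show a ∉ p by simpa using ha]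

theorem sum_map_sublists'_of_nonempty {α : Type*} {h : List α → ℝ} (hh : ∀ D, D ≠ [] → h D = 0)
    (L : List α) : (L.sublists'.map h).sum = h [] := by
  induction L with
  | nil => simp
  | cons a L ih =>
    rw [List.sublists'_cons, List.map_append, List.sum_append, ih, add_eq_left]
    refine List.sum_eq_zero fun z hz => ?_
    simp only [List.map_map, List.mem_map] at hz
    obtain ⟨D, -, rfl⟩ := hz
    exact hh _ (by simp)

/-- An expansion without higher terms is a constant plus a sum over single arcs. -/
theorem sum_map_sublists' {α : Type*} (h : List α → ℝ) (hh : ∀ D, 2 ≤ D.length → h D = 0)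
    (L : List α) : (L.sublists'.map h).sum = h [] + (L.map fun a => h [a]).sum := by
  induction L with
  | nil => simp
  | cons a L ih =>
    rw [List.sublists'_cons, List.map_append, List.sum_append, ih, List.map_map,
      sum_map_sublists'_of_nonempty (h := h ∘ List.cons a) (fun D hD => hh _ ?_), List.map_cons,
      List.sum_cons]
    · simp only [Function.comp]; ring
    · rw [List.length_cons]
      have := List.length_pos_iff.2 hD
      omega

open Classical in
theorem Acyclic.orderCost_eq_sum (hG : G.Acyclic) {s t : Fin n} {d : ℕ} (q : OrderCost m d)
    {p : List (Fin m)} (hp : G.IsWalk s t p) :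
    orderCost q p = (p.reverse.sublists'.map fun D =>
      if G.Reduced s D t then G.costCoeff s t q D else 0).sum := by
  have sum_comm : ∀ (l : List (List (Fin m))) (f : ArcSubset m d → List (Fin m) → ℝ),
      ∑ B, (l.map fun D => f B D).sum = (l.map fun D => ∑ B, f B D).sum := by
    intro l f
    induction l with
    | nil => simp
    | cons b l ih => simp [Finset.sum_add_distrib, ih]
  have e : ∀ B : ArcSubset m d, q B * (incl (G.listOf B.1) p : ℝ) =
      (p.reverse.sublists'.map fun D =>
        if G.Reduced s D t then q B * (G.coeff s D t (G.listOf B.1) : ℝ) else 0).sum := by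
    intro B
    have := hG.incl_eq_sum p.reverse t (by rwa [List.reverse_reverse]) t (Reach.refl t)
      (G.listOf B.1)
    rw [List.reverse_reverse, hG.canon_self, List.append_nil] at this
    rw [this, ← eq_intCast (Int.castRingHom ℝ), map_list_sum, ← List.sum_map_mul_left, List.map_map]
    congr 2
    funext D
    simp only [Function.comp]
    split_ifs <;> simp
  rw [G.orderCost_eq q p, Finset.sum_congr rfl fun B _ => e B, sum_comm]
  congr 2
  funext D
  by_cases h : G.Reduced s D t <;> simp [h, costCoeff]

/-- A cost function is linearizable iff its higher coefficients vanish. -/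
theorem Acyclic.linearizable_iff (hG : G.Acyclic) {s t : Fin n} (hst : s ≠ t) {d : ℕ}
    (q : OrderCost m d) :
    G.Linearizable s t q ↔ ∀ D, G.Reduced s D t → 2 ≤ D.length → G.costCoeff s t q D = 0 := by
  classical
  constructor
  · rintro ⟨c, hc⟩ D hD hD2
    -- The mixed difference along `D` extracts the coefficient of the cost function and annihilates
    -- linear costs; both functions agree on all walks from `s` to `t`.
    have h1 : G.diff s D t (orderCost q) = G.costCoeff s t q D := by
      rw [show orderCost q = fun p => ∑ B : ArcSubset m d, q B * (incl (G.listOf B.1) p : ℝ) from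
        funext (G.orderCost_eq q), diff_sum, costCoeff]
      simp only [diff_incl]
    have h2 : G.diff s D t (linearCost c) = 0 := by
      rw [show linearCost c = fun p => ∑ a : Fin m, c a * (incl [a] p : ℝ) from
        funext (linearCost_eq c), diff_sum]
      refine Finset.sum_eq_zero fun a _ => ?_
      rw [diff_incl, hG.coeff_eq_zero_of_length D t [a] hD hD2]
      simp
    rw [← h1, ← h2]
    exact hG.diff_congr D t _ _ hD fun P hP => hc P (hG.isPath hP)
  · intro h
    -- The arc costs are the coefficients of degree one; the constant coefficient is charged to
    -- every arc leaving `s`, exactly one of which is on each path, since `s ≠ t`.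
    refine ⟨fun a => (if G.Reduced s [a] t then G.costCoeff s t q [a] else 0) +
      (if G.tail a = s then (if G.Reduced s [] t then G.costCoeff s t q [] else 0) else 0),
      fun p hp => ?_⟩
    rw [hG.orderCost_eq_sum q hp.1, sum_map_sublists', linearCost, Finset.sum_add_distrib,
      List.map_reverse, List.sum_reverse, ← List.sum_toFinset _ (hG.nodup hp.1), add_comm]
    · congr 1
      obtain _ | ⟨a, p⟩ := p
      · exact absurd hp.1 hst
      · rw [Finset.sum_eq_single_of_mem a (by simp), if_pos hp.1.1]
        intro b hb hba
        rw [if_neg]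
        intro hbs
        have hb' : b ∈ p := by simpa [hba] using hb
        -- A second arc leaving `s` would mean that the path returns to `s`.
        exact hG.not_reach a (hp.1.1.trans hbs.symm ▸ (hp.1.2.reach_of_mem hb').1)
    · intro D hD
      split_ifs with hr
      · exact h D hr hD
      · rfl

theorem Acyclic.costCoeff_eq_zero (hG : G.Acyclic) {s t : Fin n} {d : ℕ} (q : OrderCost m d)
    {D : List (Fin m)} (hD : G.Reduced s D t) (hd : d < D.length) : G.costCoeff s t q D = 0 := by
  refine Finset.sum_eq_zero fun B _ => ?_
  rw [hG.coeff_eq_zero_of_length D t _ hD (by rw [length_listOf]; exact B.2.trans_lt hd)]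
  simp

/-- The set `B` indexes a basis element of the functions of paths. -/
def ReducedSet (G : ArcDigraph n m) (s t : Fin n) {d : ℕ} (B : ArcSubset m d) : Prop :=
  G.Reduced s (G.listOf B.1) t

/-- The coefficients, indexed by sets. -/
noncomputable def setCoeff (G : ArcDigraph n m) (s t : Fin n) {d : ℕ} (D B : ArcSubset m d) : ℤ :=
  G.coeff s (G.listOf D.1) t (G.listOf B.1)

/-- Reduced lists with more than `d` arcs impose no condition, for degree reasons; the others
correspond to their sets. -/
theorem Acyclic.linearizable_iff_set (hG : G.Acyclic) {s t : Fin n} (hst : s ≠ t) {d : ℕ}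
    (q : OrderCost m d) : G.Linearizable s t q ↔
      ∀ D : ArcSubset m d, G.ReducedSet s t D → 2 ≤ D.1.card →
        ∑ B, q B * (G.setCoeff s t D B : ℝ) = 0 := by
  rw [hG.linearizable_iff hst]
  constructor
  · intro h D hD hD2
    exact h _ hD (by rwa [length_listOf])
  · intro h D hD hD2
    by_cases hd : D.length ≤ d
    · have hl : G.listOf D.toFinset = D := (hG.sorted_of_reduced hD).listOf_eq
      have hc : D.toFinset.card = D.length :=
        List.toFinset_card_of_nodup (hG.sorted_of_reduced hD).nodup
      have := h ⟨D.toFinset, by rwa [hc]⟩ (by rwa [ReducedSet, hl]) (by rwa [hc])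
      simpa only [setCoeff, hl, costCoeff] using this
    · exact hG.costCoeff_eq_zero q hD (by omega)

theorem Acyclic.setCoeff_reduced (hG : G.Acyclic) {s t : Fin n} {d : ℕ} {C D : ArcSubset m d}
    (hC : G.ReducedSet s t C) (hD : G.ReducedSet s t D) [Decidable (C = D)] :
    G.setCoeff s t D C = if C = D then 1 else 0 := by
  rw [setCoeff, hG.coeff_reduced _ t _ hD hC]
  have : G.listOf C.1 = G.listOf D.1 ↔ C = D := by
    refine ⟨fun h => Subtype.ext ?_, fun h => by rw [h]⟩
    rw [← listOf_toFinset (G := G) C.1, h, listOf_toFinset]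
  simp only [this]

end ArcDigraph

/-! ### Linear algebra: kernel of a matrix with an identity block -/

/-- The basis of the kernel of a matrix in reduced echelon form, restricted to some of its rows. -/
theorem exists_basis_of_reduced {β : Type*} [Fintype β] [DecidableEq β] (red small : β → Prop)
    [DecidablePred red] [DecidablePred small] (α : β → β → ℤ)
    (hα : ∀ C D, red C → red D → α D C = if C = D then 1 else 0) (L : Submodule ℝ (β → ℝ))
    (hL : ∀ q, q ∈ L ↔ ∀ D, red D → ¬ small D → ∑ B, q B * (α D B : ℝ) = 0)
    {K : ℕ} (r : Fin K → β) (hr : Function.Injective r) (hr' : ∀ B, (∃ j, r j = B) ↔ ¬ red B ∨ small B) :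
    ∃ b : Module.Basis (Fin K) ℝ L, ∀ j B, (b j : β → ℝ) B =
      (((if r j = B then 1 else 0) - (if ¬ red (r j) ∧ red B then α B (r j) else 0) : ℤ) : ℝ) := by
  have hsum : ∀ f : β → ℝ, ∑ j, f (r j) = ∑ C, if ¬ red C ∨ small C then f C else 0 := by
    intro f
    rw [← Finset.sum_filter, ← Finset.sum_image (g := r) (f := f) (fun _ _ _ _ h => hr h)]
    refine Finset.sum_congr ?_ fun _ _ => rfl
    ext B
    simp [hr']
  -- For `C` that is not reduced, the unit vector is corrected at the reduced coordinates so that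
  -- every coefficient vanishes, small ones included; a reduced small `C` needs no correction.
  set v : β → β → ℝ := fun C B =>
    (((if C = B then 1 else 0) - (if ¬ red C ∧ red B then α B C else 0) : ℤ) : ℝ) with hv
  have hvL : ∀ j, v (r j) ∈ L := by
    intro j
    rw [hL]
    intro D hD hDs
    by_cases hj : red (r j)
    · have e : ∀ B, v (r j) B * (α D B : ℝ) = if r j = B then (α D (r j) : ℝ) else 0 := by
        intro B
        by_cases hB : r j = B
        · subst hB; simp [hv, hj]
        · simp [hv, hj, hB]
      rw [Finset.sum_congr rfl fun B _ => e B, Finset.sum_ite_eq, if_pos (Finset.mem_univ _),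
        hα _ _ hj hD, if_neg, Int.cast_zero]
      rintro rfl
      exact ((hr' _).1 ⟨j, rfl⟩).elim (fun h => h hj) hDs
    · have e : ∀ B, v (r j) B * (α D B : ℝ) = (if r j = B then (α D (r j) : ℝ) else 0) -
          (if D = B then (α D (r j) : ℝ) else 0) := by
        intro B
        by_cases hB : r j = B
        · subst hB
          have : D ≠ r j := by rintro rfl; exact hj hD
          simp [hv, hj, this]
        · by_cases hB' : red B
          · by_cases hDB : D = B
            · subst hDB; simp [hv, hj, hB, hB', hα D D hD hD]
            · simp [hv, hj, hB, hB', hDB, hα B D hB' hD, show ¬ B = D from fun h => hDB h.symm]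
          · have : D ≠ B := by rintro rfl; exact hB' hD
            simp [hv, hB, hB', this]
      rw [Finset.sum_congr rfl fun B _ => e B, Finset.sum_sub_distrib]
      simp
  have hli : LinearIndependent ℝ fun j => (⟨v (r j), hvL j⟩ : L) := by
    rw [Fintype.linearIndependent_iff]
    intro c hc
    have hc' : ∀ B, ∑ j, c j * v (r j) B = 0 := by
      intro B
      have := congrFun (congrArg Subtype.val hc) B
      simpa using this
    -- Corrections live on reduced coordinates only, so the other coordinates isolate these vectors;
    -- once they are gone, unit vectors remain.
    have h1 : ∀ j, ¬ red (r j) → c j = 0 := by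
      intro j hj
      rw [← hc' (r j), Finset.sum_eq_single j]
      · simp [hv, hj]
      · intro i _ hi
        simp [hv, hj, hr.ne hi]
      · simp
    intro j
    by_cases hj : red (r j)
    · rw [← hc' (r j), Finset.sum_eq_single j]
      · simp [hv, hj]
      · intro i _ hi
        by_cases hi' : red (r i)
        · simp [hv, hi', hr.ne hi]
        · simp [h1 i hi']
      · simp
    · exact h1 j hj
  have hspan : ⊤ ≤ Submodule.span ℝ (Set.range fun j => (⟨v (r j), hvL j⟩ : L)) := by
    rintro ⟨q, hq⟩ -
    -- The weight of a reduced `B` is the coefficient of `q` at `B`, not `q B`: this makes up for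
    -- the corrections in the other basis vectors.
    set w : β → ℝ := fun B => if red B then ∑ C, q C * (α B C : ℝ) else q B with hw
    have hred : ∀ B, red B → ∑ C, q C * (α B C : ℝ) =
        q B + ∑ C, if red C then 0 else q C * (α B C : ℝ) := by
      intro B hB
      have e : ∀ C, q C * (α B C : ℝ) =
          (if C = B then q C else 0) + if red C then 0 else q C * (α B C : ℝ) := by
        intro C
        by_cases hC : red C
        · simp [hα C B hC hB, hC]
        · have : C ≠ B := by rintro rfl; exact hC hB
          simp [hC, this]
      rw [Finset.sum_congr rfl fun C _ => e C, Finset.sum_add_distrib]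
      simp
    have hqw : (⟨q, hq⟩ : L) = ∑ j, w (r j) • (⟨v (r j), hvL j⟩ : L) := by
      apply Subtype.ext
      funext B
      have : ((∑ j, w (r j) • (⟨v (r j), hvL j⟩ : L) : L) : β → ℝ) B =
          ∑ j, w (r j) * v (r j) B := by simp
      rw [this, hsum fun C => w C * v C B]
      by_cases hB : red B
      · have e : ∀ C, (if ¬ red C ∨ small C then w C * v C B else 0) =
            (if B = C then (if small B then w B else 0) else 0) -
              if red C then 0 else q C * (α B C : ℝ) := by
          intro C
          by_cases hC : red C
          · by_cases hBC : B = C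
            · subst hBC; simp [hv, hC]
            · simp [hv, hC, hBC, show ¬ C = B from fun h => hBC h.symm]
          · have h1 : B ≠ C := by rintro rfl; exact hC hB
            simp [hv, hw, hC, hB, h1, h1.symm]
        rw [Finset.sum_congr rfl fun C _ => e C, Finset.sum_sub_distrib, Finset.sum_ite_eq,
          if_pos (Finset.mem_univ _)]
        have h2 := hred B hB
        by_cases hs : small B
        · simp only [hs, if_true, hw, hB, h2]; ring
        -- A reduced `B` that is not small carries no basis vector; its coordinate is determined by
        -- the constraint.
        · rw [(hL q).1 hq B hB hs] at h2
          simp only [hs, if_false]; linarith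
      · have e : ∀ C, (if ¬ red C ∨ small C then w C * v C B else 0) = if B = C then q B else 0 := by
          intro C
          by_cases hBC : B = C
          · subst hBC; simp [hv, hw, hB]
          · simp [hv, hB, hBC, show ¬ C = B from fun h => hBC h.symm]
        rw [Finset.sum_congr rfl fun C _ => e C]
        simp
    rw [hqw]
    exact Submodule.sum_mem _ fun j _ => Submodule.smul_mem _ _ (Submodule.subset_span ⟨j, rfl⟩)
  exact ⟨Module.Basis.mk hli hspan, fun j B => by rw [Module.Basis.mk_apply]⟩

/-! ### Codes of pairs, lists and optional arcs -/

/-- The pair `(i, j)` as a number in base `b`. -/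
def pairCode (b i j : ℕ) : ℕ := i * b + j

theorem pairCode_lt {b i j k : ℕ} (hi : i < k) (hj : j < b) : pairCode b i j < k * b := by
  have := Nat.mul_le_mul_right b (Nat.succ_le_of_lt hi)
  rw [Nat.succ_mul] at this
  unfold pairCode
  omega

/-- The first component dominates: a recursion that decreases it goes to a smaller address, whatever
happens to the second one. -/
theorem pairCode_lt_pairCode {b i j i' j' : ℕ} (hi : i < i') (hj : j < b) :
    pairCode b i j < pairCode b i' j' :=
  (pairCode_lt hi hj).trans_le (Nat.le_add_right _ _)

theorem pairCode_mod {b i j : ℕ} (hj : j < b) : pairCode b i j % b = j := by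
  rw [pairCode, Nat.mul_add_mod', Nat.mod_eq_of_lt hj]

theorem pairCode_div {b i j : ℕ} (hj : j < b) : pairCode b i j / b = i := by
  rw [pairCode, mul_comm, Nat.mul_add_div (by omega), Nat.div_eq_of_lt hj, add_zero]

/-- A list of arcs as a number, whose digits are the arcs, increased by one. -/
def listCode (b : ℕ) {m : ℕ} : List (Fin m) → ℕ
  | [] => 0
  | a :: l => pairCode b (listCode b l) (a + 1)

theorem listCode_lt {b m : ℕ} (hb : m < b) (l : List (Fin m)) : listCode b l < b ^ l.length := by
  induction l with
  | nil => simp [listCode]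
  | cons a l ih =>
    rw [listCode, List.length_cons, pow_succ]
    exact pairCode_lt ih (by omega)

theorem listCode_cons_ne_zero {b m : ℕ} (a : Fin m) (l : List (Fin m)) :
    listCode b (a :: l) ≠ 0 := by
  simp [listCode, pairCode]

theorem listCode_eq_zero {b m : ℕ} {l : List (Fin m)} : listCode b l = 0 ↔ l = [] := by
  cases l with
  | nil => simp [listCode]
  | cons a l => simp [listCode_cons_ne_zero]

/-- Remainder and quotient recover first arc and rest; as no digit is zero, lengths are recovered
too. -/
theorem listCode_injective {b m : ℕ} (hb : m < b) :
    Function.Injective (listCode b : List (Fin m) → ℕ) := by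
  intro l
  induction l with
  | nil => exact fun l' h => (listCode_eq_zero.1 h.symm).symm
  | cons a l ih =>
    intro l' h
    cases l' with
    | nil => exact absurd h (listCode_cons_ne_zero a l)
    | cons a' l' =>
      have h1 := congrArg (· % b) h
      have h2 := congrArg (· / b) h
      simp only [listCode, pairCode_mod (show (a : ℕ) + 1 < b by omega),
        pairCode_mod (show (a' : ℕ) + 1 < b by omega)] at h1
      simp only [listCode, pairCode_div (show (a : ℕ) + 1 < b by omega),
        pairCode_div (show (a' : ℕ) + 1 < b by omega)] at h2
      rw [ih h2, Fin.ext (Nat.succ_injective h1)]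

/-- An optional arc as a number. -/
def optCode {m : ℕ} : Option (Fin m) → ℕ
  | none => 0
  | some a => a + 1

theorem optCode_lt {m : ℕ} (o : Option (Fin m)) : optCode o < m + 1 := by
  cases o with
  | none => simp [optCode]
  | some a => simp [optCode]

theorem optCode_eq_succ {m : ℕ} {o : Option (Fin m)} {a : Fin m} :
    optCode o = a + 1 ↔ o = some a := by
  cases o with
  | none => simp [optCode]
  | some b => simp [optCode, Fin.ext_iff]

/-! ### Expressions for the input and for arithmetic without multiplication -/

namespace RAM

namespace TExpr

/-- The number of vertices. -/
def vertices : TExpr := .tab 0 (.const 0)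

/-- The number of arcs. -/
def arcs : TExpr := .tab 0 (.const 1)

/-- The source. -/
def source : TExpr := .tab 0 (.const 2)

/-- The sink. -/
def sink : TExpr := .tab 0 (.const 3)

/-- The tail of an arc. -/
def tailOf (e : TExpr) : TExpr := .tab 0 (.add (.const 4) e)

/-- The head of an arc. -/
def headOf (e : TExpr) : TExpr := .tab 0 (.add (.add (.const 4) arcs) e)

/-- The predecessor. -/
def pred (e : TExpr) : TExpr := .sub e (.const 1)

/-- Sum over all `x` below the value of `b`. -/
def sumBelow (x : ℕ) (b e : TExpr) : TExpr := .sum x (.ite (.lt (.var x) b) e (.const 0))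

/-- Remainders by recursion. -/
def modRule (t : ℕ) (b : TExpr) : TExpr :=
  .ite (.var 0) (.ite (.eq (.add (.tab t (pred (.var 0))) (.const 1)) b) (.const 0)
    (.add (.tab t (pred (.var 0))) (.const 1))) (.const 0)

/-- Quotients by recursion, from the table `t'` of the remainders. -/
def divRule (t t' : ℕ) : TExpr :=
  .ite (.var 0) (.add (.tab t (pred (.var 0))) (.eq (.tab t' (.var 0)) (.const 0))) (.const 0)

/-- Multiples by recursion. -/
def mulRule (t : ℕ) (b : TExpr) : TExpr :=
  .ite (.var 0) (.add (.tab t (pred (.var 0))) b) (.const 0)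

theorem fill_modRule {R t b : ℕ} {e : TExpr} {T : ℕ → ℤ → ℤ} (hb : 2 ≤ b)
    (he : ∀ T' : ℕ → ℤ → ℤ, (∀ t' ≠ t, T' t' = T t') → ∀ ρ, e.eval R T' ρ = b) (c : ℕ)
    (hc : c < R) : fill R t (modRule t e) T R t c = (c % b : ℕ) := by
  refine fill_spec (ι := {c // c < R}) (fun c => c.1) (fun c => ((c.1 % b : ℕ) : ℤ)) (fun c => c.2)
    ?_ ⟨c, hc⟩
  rintro ⟨c, hc⟩ T' hT' ih
  cases c with
  | zero => simp [modRule, eval]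
  | succ c =>
    have h := ih ⟨c, by omega⟩ (Nat.lt_succ_self c)
    have h1 : (((c + 1 : ℕ) : ℤ) = 0) = False := by simp; omega
    simp only [modRule, eval, pred, he T' hT', Function.update_self, Nat.cast_succ,
      add_sub_cancel_right, h] at h1 ⊢
    rw [if_neg (by simpa using h1)]
    have h2 : (c + 1) % b = if c % b + 1 = b then 0 else c % b + 1 := by
      have := Nat.mod_lt c (show 0 < b by omega)
      rw [Nat.add_mod, Nat.mod_eq_of_lt (show 1 < b by omega)]
      split_ifs with h
      · rw [h, Nat.mod_self]
      · exact Nat.mod_eq_of_lt (by omega)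
    rw [h2]
    have h3 : ((c % b : ℕ) : ℤ) + 1 = b ↔ c % b + 1 = b := by norm_cast
    by_cases hcb : c % b + 1 = b <;> simp only [h3, hcb] <;> simp

theorem fill_divRule {R t t' b : ℕ} {T : ℕ → ℤ → ℤ} (ht : t' ≠ t)
    (hT : ∀ c : ℕ, c < R → T t' c = (c % b : ℕ)) (c : ℕ) (hc : c < R) :
    fill R t (divRule t t') T R t c = (c / b : ℕ) := by
  refine fill_spec (ι := {c // c < R}) (fun c => c.1) (fun c => ((c.1 / b : ℕ) : ℤ)) (fun c => c.2)
    ?_ ⟨c, hc⟩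
  rintro ⟨c, hc⟩ T' hT' ih
  cases c with
  | zero => simp [divRule, eval]
  | succ c =>
    have h := ih ⟨c, by omega⟩ (Nat.lt_succ_self c)
    have h1 : (((c + 1 : ℕ) : ℤ) = 0) = False := by simp; omega
    simp only [divRule, eval, pred, Function.update_self, hT' t' ht, hT _ hc]
    rw [if_neg (by simpa using h1), Nat.cast_succ, add_sub_cancel_right, h, Nat.succ_div]
    simp only [Nat.dvd_iff_mod_eq_zero, Nat.cast_eq_zero]
    split_ifs <;> simp

theorem fill_mulRule {R t b : ℕ} {e : TExpr} {T : ℕ → ℤ → ℤ}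
    (he : ∀ T' : ℕ → ℤ → ℤ, (∀ t' ≠ t, T' t' = T t') → ∀ ρ, e.eval R T' ρ = b) (c : ℕ)
    (hc : c < R) : fill R t (mulRule t e) T R t c = (c * b : ℕ) := by
  refine fill_spec (ι := {c // c < R}) (fun c => c.1) (fun c => ((c.1 * b : ℕ) : ℤ)) (fun c => c.2)
    ?_ ⟨c, hc⟩
  rintro ⟨c, hc⟩ T' hT' ih
  cases c with
  | zero => simp [mulRule, eval]
  | succ c =>
    have h := ih ⟨c, by omega⟩ (Nat.lt_succ_self c)
    have h1 : (((c + 1 : ℕ) : ℤ) = 0) = False := by simp; omega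
    simp only [mulRule, eval, pred, Function.update_self, he T' hT']
    rw [if_neg (by simpa using h1), Nat.cast_succ, add_sub_cancel_right, h]
    push_cast; ring

/-- Sums always run over the global range; a test cuts them down to the vertices or the arcs. -/
theorem eval_sumBelow {R k : ℕ} {T : ℕ → ℤ → ℤ} {ρ : ℕ → ℤ} {x : ℕ} {b e : TExpr}
    (hb : ∀ ρ, b.eval R T ρ = k) (hk : k ≤ R) :
    (sumBelow x b e).eval R T ρ = ∑ a : Fin k, e.eval R T (Function.update ρ x (a : ℕ)) := by
  simp only [sumBelow, eval, hb, Function.update_self]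
  rw [← Finset.sum_range (fun i => e.eval R T (Function.update ρ x (i : ℕ))),
    ← Finset.sum_subset (Finset.range_mono hk)]
  · refine Finset.sum_congr rfl fun i hi => ?_
    simp [Finset.mem_range.1 hi]
  · intro i _ hi
    simp only [Finset.mem_range, not_lt] at hi
    simp [hi]

/-- The address of a pair, by the table of multiples. -/
def pair (i j : TExpr) : TExpr := .add (.tab 7 i) j

/-- The first component of a pair. -/
def fst (e : TExpr) : TExpr := .tab 6 e

/-- The second component of a pair. -/
def snd (e : TExpr) : TExpr := .tab 5 e

/-- The first arc of a list, increased by one. -/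
def hdDigit (e : TExpr) : TExpr := .tab 2 e

/-- The rest of a list. -/
def tlCode (e : TExpr) : TExpr := .tab 3 e

/-- The list with one more arc. -/
def consCode (l a : TExpr) : TExpr := .add (.tab 4 l) a

end TExpr

/-! ## The input and the arithmetic tables -/

/-- The content of the tables `0` to `7`. -/
structure Basic {n m : ℕ} (G : ArcDigraph n m) (s t : Fin n) (d : ℕ) (T : ℕ → ℤ → ℤ) : Prop where
  n_eq : T 0 0 = n
  m_eq : T 0 1 = m
  s_eq : T 0 2 = (s : ℕ)
  t_eq : T 0 3 = (t : ℕ)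
  tail_eq : ∀ a : Fin m, T 0 (4 + (a : ℕ)) = (G.tail a : ℕ)
  head_eq : ∀ a : Fin m, T 0 (4 + m + (a : ℕ)) = (G.head a : ℕ)
  base_eq : T 1 0 = (n + m + 2 : ℕ)
  lim_eq : T 1 1 = ((n + m + 2) ^ d : ℕ)
  modA : ∀ c < (n + m + 2) ^ (4 * (d + 1)), T 2 (c : ℕ) = (c % (n + m + 2) : ℕ)
  divA : ∀ c < (n + m + 2) ^ (4 * (d + 1)), T 3 (c : ℕ) = (c / (n + m + 2) : ℕ)
  mulA : ∀ c < (n + m + 2) ^ (4 * (d + 1)), T 4 (c : ℕ) = (c * (n + m + 2) : ℕ)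
  modQ : ∀ c < (n + m + 2) ^ (4 * (d + 1)), T 5 (c : ℕ) = (c % (n + m + 2) ^ (d + 1) : ℕ)
  divQ : ∀ c < (n + m + 2) ^ (4 * (d + 1)), T 6 (c : ℕ) = (c / (n + m + 2) ^ (d + 1) : ℕ)
  mulQ : ∀ c < (n + m + 2) ^ (4 * (d + 1)), T 7 (c : ℕ) = (c * (n + m + 2) ^ (d + 1) : ℕ)

/-- The rules of the tables `2` to `7`. -/
def basicRules : List (ℕ × TExpr) :=
  [(2, .modRule 2 (.tab 1 (.const 0))), (3, .divRule 3 2), (4, .mulRule 4 (.tab 1 (.const 0))),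
    (5, .modRule 5 (.tab 1 (.const 2))), (6, .divRule 6 5), (7, .mulRule 7 (.tab 1 (.const 2)))]

theorem basic_filled {n m : ℕ} (G : ArcDigraph n m) (s t : Fin n) (d : ℕ) :
    Basic G s t d (filled ((n + m + 2) ^ (4 * (d + 1))) basicRules
      (baseTables (G.inputWord s t) (n + m + 2) d)) := by
  set A := n + m + 2 with hA
  set R := A ^ (4 * (d + 1)) with hR
  set T := baseTables (G.inputWord s t) A d with hT
  have hA2 : 2 ≤ A := by omega
  have hQ2 : 2 ≤ A ^ (d + 1) := hA2.trans (Nat.le_self_pow (by omega) A)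
  have h10 : T 1 0 = (A : ℕ) := by simp [hT, baseTables]
  have h11 : T 1 1 = (A ^ d : ℕ) := by simp [hT, baseTables]
  have h12 : T 1 2 = (A ^ (d + 1) : ℕ) := by simp [hT, baseTables]
  have h0 : ∀ i : ℕ, T 0 i = (G.inputWord s t).getD i 0 := by
    intro i; simp [hT, baseTables]
  simp only [basicRules, filled]
  set T2 := fill R 2 _ T R with hT2
  set T3 := fill R 3 _ T2 R with hT3
  set T4 := fill R 4 _ T3 R with hT4
  set T5 := fill R 5 _ T4 R with hT5
  set T6 := fill R 6 _ T5 R with hT6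
  set T7 := fill R 7 _ T6 R with hT7
  have e2 : ∀ t ≠ 2, T2 t = T t := fun t ht => fill_of_ne _ _ _ _ _ ht
  have e3 : ∀ t ≠ 3, T3 t = T2 t := fun t ht => fill_of_ne _ _ _ _ _ ht
  have e4 : ∀ t ≠ 4, T4 t = T3 t := fun t ht => fill_of_ne _ _ _ _ _ ht
  have e5 : ∀ t ≠ 5, T5 t = T4 t := fun t ht => fill_of_ne _ _ _ _ _ ht
  have e6 : ∀ t ≠ 6, T6 t = T5 t := fun t ht => fill_of_ne _ _ _ _ _ ht
  have e7 : ∀ t ≠ 7, T7 t = T6 t := fun t ht => fill_of_ne _ _ _ _ _ ht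
  have f0 : T7 0 = T 0 := by
    rw [e7 _ (by omega), e6 _ (by omega), e5 _ (by omega), e4 _ (by omega), e3 _ (by omega),
      e2 _ (by omega)]
  have f1 : T7 1 = T 1 := by
    rw [e7 _ (by omega), e6 _ (by omega), e5 _ (by omega), e4 _ (by omega), e3 _ (by omega),
      e2 _ (by omega)]
  have g2 : ∀ c : ℕ, c < R → T2 2 c = (c % A : ℕ) :=
    TExpr.fill_modRule hA2 fun T' hT' ρ => by simp [TExpr.eval, hT' 1, h10]
  have g3 : ∀ c : ℕ, c < R → T3 3 c = (c / A : ℕ) := TExpr.fill_divRule (by omega) g2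
  have g4 : ∀ c : ℕ, c < R → T4 4 c = (c * A : ℕ) :=
    TExpr.fill_mulRule fun T' hT' ρ => by simp [TExpr.eval, hT' 1, e3 1, e2 1, h10]
  have g5 : ∀ c : ℕ, c < R → T5 5 c = (c % A ^ (d + 1) : ℕ) :=
    TExpr.fill_modRule hQ2 fun T' hT' ρ => by simp [TExpr.eval, hT' 1, e4 1, e3 1, e2 1, h12]
  have g6 : ∀ c : ℕ, c < R → T6 6 c = (c / A ^ (d + 1) : ℕ) := TExpr.fill_divRule (by omega) g5
  have g7 : ∀ c : ℕ, c < R → T7 7 c = (c * A ^ (d + 1) : ℕ) :=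
    TExpr.fill_mulRule fun T' hT' ρ => by
      simp [TExpr.eval, hT' 1, e6 1, e5 1, e4 1, e3 1, e2 1, h12]
  have hw : ∀ i : ℕ, i < m + m → (G.inputWord s t).getD (4 + i) 0 =
      (List.ofFn (fun a => ((G.tail a : ℕ) : ℤ)) ++ List.ofFn (fun a => ((G.head a : ℕ) : ℤ))).getD
        i 0 := by
    intro i _
    rw [ArcDigraph.inputWord, List.append_assoc, add_comm]
    rfl
  exact {
    n_eq := by rw [f0]; exact h0 0
    m_eq := by rw [f0]; exact h0 1
    s_eq := by rw [f0]; exact h0 2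
    t_eq := by rw [f0]; exact h0 3
    tail_eq := fun a => by
      rw [f0, show (4 : ℤ) + (a : ℕ) = ((4 + a : ℕ) : ℤ) by push_cast; rfl, h0, hw _ (by omega),
        List.getD_append _ _ _ _ (by simp)]
      simp [List.getD_eq_getElem?_getD]
    head_eq := fun a => by
      rw [f0, show (4 : ℤ) + m + (a : ℕ) = ((4 + (m + a) : ℕ) : ℤ) by push_cast; ring, h0,
        hw _ (by omega), List.getD_append_right _ _ _ _ (by simp)]
      simp [List.getD_eq_getElem?_getD]
    base_eq := by rw [f1, h10]
    lim_eq := by rw [f1, h11]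
    modA := by
      rw [e7 _ (by omega), e6 _ (by omega), e5 _ (by omega), e4 _ (by omega), e3 _ (by omega)]
      exact g2
    divA := by
      rw [e7 _ (by omega), e6 _ (by omega), e5 _ (by omega), e4 _ (by omega)]
      exact g3
    mulA := by
      rw [e7 _ (by omega), e6 _ (by omega), e5 _ (by omega)]
      exact g4
    modQ := by
      rw [e7 _ (by omega), e6 _ (by omega)]
      exact g5
    divQ := by
      rw [e7 _ (by omega)]
      exact g6
    mulQ := g7 }

theorem Basic.congr {n m : ℕ} {G : ArcDigraph n m} {s t : Fin n} {d : ℕ} {T T' : ℕ → ℤ → ℤ}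
    (h : Basic G s t d T) (hT : ∀ i < 8, T' i = T i) : Basic G s t d T' := by
  obtain ⟨h1, h2, h3, h4, h5, h6, h7, h8, h9, h10, h11, h12, h13, h14⟩ := h
  constructor <;> rw [hT _ (by omega)] <;> assumption

end RAM

/-! ### Reachability by boundedly many arcs -/

namespace ArcDigraph

variable {n m : ℕ}

/-- There is a walk with at most `k` arcs. -/
def ReachBelow (G : ArcDigraph n m) : ℕ → Fin n → Fin n → Prop
  | 0, u, w => u = w
  | k + 1, u, w => u = w ∨ ∃ a, G.tail a = u ∧ ReachBelow G k (G.head a) w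

theorem reachBelow_of_walk {G : ArcDigraph n m} {w : Fin n} (p : List (Fin m)) :
    ∀ {u : Fin n} {k : ℕ}, G.IsWalk u w p → p.length ≤ k → G.ReachBelow k u w := by
  induction p with
  | nil =>
    rintro u (_ | k) h _
    · exact h
    · exact .inl h
  | cons a p ih =>
    rintro u (_ | k) h hk
    · simp at hk
    · exact .inr ⟨a, h.1, ih h.2 (by simpa using hk)⟩

theorem ReachBelow.reach {G : ArcDigraph n m} {w : Fin n} {k : ℕ} :
    ∀ {u : Fin n}, G.ReachBelow k u w → G.Reach u w := by
  induction k with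
  | zero => rintro u rfl; exact Reach.refl _
  | succ k ih =>
    rintro u (rfl | ⟨a, rfl, h⟩)
    · exact Reach.refl _
    · exact (reach_arc a).trans (ih h)

theorem Acyclic.reachBelow_iff {G : ArcDigraph n m} (hG : G.Acyclic) {u w : Fin n} :
    G.ReachBelow n u w ↔ G.Reach u w :=
  ⟨ReachBelow.reach, fun ⟨p, hp⟩ => reachBelow_of_walk p hp (hG.length_lt hp).le⟩

end ArcDigraph

/-! ### Arithmetic of addresses -/

namespace RAM

open TExpr

section

variable {n m : ℕ} {G : ArcDigraph n m} {s t : Fin n} {d : ℕ} {T : ℕ → ℤ → ℤ}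

/-- The base of the codes of pairs. -/
local notation "Q" => (n + m + 2) ^ (d + 1)

/-- The range. -/
local notation "R" => (n + m + 2) ^ (4 * (d + 1))

/-- The exponent `d + 1` instead of `d` leaves room for vertices, arcs and counters also when `d =
0`. -/
theorem lt_base {i : ℕ} (h : i < n + m + 2) : i < Q :=
  h.trans_le (Nat.le_self_pow (by omega) _)

theorem range_eq : R = Q * Q * Q * Q := by
  rw [mul_comm 4, pow_mul]; ring

theorem base_pos : 0 < Q := lt_base (by omega)

theorem base_le_range : Q ≤ R := Nat.pow_le_pow_right (by omega) (by omega)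

theorem lt_range {i : ℕ} (h : i < n + m + 2) : i < R := (lt_base h).trans_le base_le_range

theorem pairCode_lt_range {i j : ℕ} (hi : i < Q * Q * Q) (hj : j < Q) : pairCode Q i j < R :=
  (pairCode_lt hi hj).trans_le range_eq.ge

theorem pairCode_lt_range₂ {i j : ℕ} (hi : i < Q) (hj : j < Q) : pairCode Q i j < R :=
  pairCode_lt_range (hi.trans_le (by
    rw [mul_assoc]; exact Nat.le_mul_of_pos_right _ (Nat.mul_pos base_pos base_pos))) hj

theorem pairCode_lt_range₃ {i j k : ℕ} (hi : i < Q) (hj : j < Q) (hk : k < Q) :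
    pairCode Q (pairCode Q i j) k < R :=
  pairCode_lt_range ((pairCode_lt hi hj).trans_le (Nat.le_mul_of_pos_right _ base_pos)) hk

theorem pairCode_lt_range₄ {i j k l : ℕ} (hi : i < Q) (hj : j < Q) (hk : k < Q) (hl : l < Q) :
    pairCode Q (pairCode Q (pairCode Q i j) k) l < R :=
  pairCode_lt_range (pairCode_lt (pairCode_lt hi hj) hk) hl

theorem Basic.pair_eq (h : Basic G s t d T) {i : ℕ} (hi : i < R) (j : ℕ) :
    T 7 (i : ℕ) + (j : ℕ) = (pairCode Q i j : ℕ) := by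
  rw [h.mulQ i hi, pairCode]; push_cast; rfl

theorem Basic.fst_eq (h : Basic G s t d T) {i j : ℕ} (hij : pairCode Q i j < R) (hj : j < Q) :
    T 6 (pairCode Q i j : ℕ) = i := by
  rw [h.divQ _ hij, pairCode_div hj]

theorem Basic.snd_eq (h : Basic G s t d T) {i j : ℕ} (hij : pairCode Q i j < R) (hj : j < Q) :
    T 5 (pairCode Q i j : ℕ) = j := by
  rw [h.modQ _ hij, pairCode_mod hj]

theorem listCode_lt_base {l : List (Fin m)} (hl : l.length ≤ d) :
    listCode (n + m + 2) l < Q :=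
  (listCode_lt (by omega) l).trans_le (Nat.pow_le_pow_right (by omega) (by omega))

theorem Basic.digit_eq (h : Basic G s t d T) {a : Fin m} {l : List (Fin m)}
    (hl : (a :: l).length ≤ d) : T 2 (listCode (n + m + 2) (a :: l) : ℕ) = (a : ℕ) + 1 := by
  rw [h.modA _ ((listCode_lt_base hl).trans_le base_le_range), listCode, pairCode_mod (by omega)]
  push_cast; rfl

theorem Basic.rest_eq (h : Basic G s t d T) {a : Fin m} {l : List (Fin m)}
    (hl : (a :: l).length ≤ d) :
    T 3 (listCode (n + m + 2) (a :: l) : ℕ) = listCode (n + m + 2) l := by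
  rw [h.divA _ ((listCode_lt_base hl).trans_le base_le_range), listCode, pairCode_div (by omega)]

theorem Basic.eval_vertices (h : Basic G s t d T) (ρ : ℕ → ℤ) : vertices.eval R T ρ = n := h.n_eq

theorem Basic.eval_arcs (h : Basic G s t d T) (ρ : ℕ → ℤ) : arcs.eval R T ρ = m := h.m_eq

theorem Basic.eval_source (h : Basic G s t d T) (ρ : ℕ → ℤ) : source.eval R T ρ = (s : ℕ) := h.s_eq

theorem Basic.eval_sink (h : Basic G s t d T) (ρ : ℕ → ℤ) : sink.eval R T ρ = (t : ℕ) := h.t_eq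

theorem Basic.eval_tailOf (h : Basic G s t d T) {e : TExpr} {ρ : ℕ → ℤ} {a : Fin m}
    (he : e.eval R T ρ = (a : ℕ)) : (tailOf e).eval R T ρ = (G.tail a : ℕ) := by
  simp only [tailOf, eval, he, h.tail_eq]

theorem Basic.eval_headOf (h : Basic G s t d T) {e : TExpr} {ρ : ℕ → ℤ} {a : Fin m}
    (he : e.eval R T ρ = (a : ℕ)) : (headOf e).eval R T ρ = (G.head a : ℕ) := by
  simp only [headOf, eval, he, h.eval_arcs, h.head_eq]

theorem Basic.eval_pair (h : Basic G s t d T) {x y : TExpr} {ρ : ℕ → ℤ} {i j : ℕ}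
    (hx : x.eval R T ρ = i) (hy : y.eval R T ρ = j) (hi : i < R) :
    (pair x y).eval R T ρ = (pairCode Q i j : ℕ) := by
  simp only [pair, eval, hx, hy, h.pair_eq hi]

theorem Basic.eval_fst (h : Basic G s t d T) {x : TExpr} {ρ : ℕ → ℤ} {i j : ℕ}
    (hx : x.eval R T ρ = (pairCode Q i j : ℕ)) (hij : pairCode Q i j < R) (hj : j < Q) :
    (fst x).eval R T ρ = i := by
  simp only [fst, eval, hx, h.fst_eq hij hj]

theorem Basic.eval_snd (h : Basic G s t d T) {x : TExpr} {ρ : ℕ → ℤ} {i j : ℕ}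
    (hx : x.eval R T ρ = (pairCode Q i j : ℕ)) (hij : pairCode Q i j < R) (hj : j < Q) :
    (snd x).eval R T ρ = j := by
  simp only [snd, eval, hx, h.snd_eq hij hj]

theorem eval_pred {x : TExpr} {ρ : ℕ → ℤ} {i : ℕ} {N : ℕ} (hx : x.eval N T ρ = (i : ℕ) + 1) :
    (pred x).eval N T ρ = i := by
  simp only [pred, eval, hx]; ring

theorem cast_fin_inj {k : ℕ} {u w : Fin k} : ((u : ℕ) : ℤ) = (w : ℕ) ↔ u = w := by
  rw [Nat.cast_inj, Fin.ext_iff]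

theorem Basic.eval_pair₂ (h : Basic G s t d T) {x y : TExpr} {ρ : ℕ → ℤ} {i j : ℕ}
    (hx : x.eval R T ρ = i) (hy : y.eval R T ρ = j) (hi : i < Q) :
    (pair x y).eval R T ρ = (pairCode Q i j : ℕ) :=
  h.eval_pair hx hy (hi.trans_le base_le_range)

theorem Basic.eval_pair₃ (h : Basic G s t d T) {x y z : TExpr} {ρ : ℕ → ℤ} {i j k : ℕ}
    (hx : x.eval R T ρ = i) (hy : y.eval R T ρ = j) (hz : z.eval R T ρ = k) (hi : i < Q)
    (hj : j < Q) :
    (pair (pair x y) z).eval R T ρ = (pairCode Q (pairCode Q i j) k : ℕ) :=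
  h.eval_pair (h.eval_pair₂ hx hy hi) hz (pairCode_lt_range₂ hi hj)

theorem Basic.eval_pair₄ (h : Basic G s t d T) {x y z v : TExpr} {ρ : ℕ → ℤ} {i j k l : ℕ}
    (hx : x.eval R T ρ = i) (hy : y.eval R T ρ = j) (hz : z.eval R T ρ = k)
    (hv : v.eval R T ρ = l) (hi : i < Q) (hj : j < Q) (hk : k < Q) :
    (pair (pair (pair x y) z) v).eval R T ρ =
      (pairCode Q (pairCode Q (pairCode Q i j) k) l : ℕ) :=
  h.eval_pair (h.eval_pair₃ hx hy hz hi hj) hv (pairCode_lt_range₃ hi hj hk)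

theorem Basic.decode₂ (h : Basic G s t d T) {e : TExpr} {ρ : ℕ → ℤ} {i j : ℕ}
    (he : e.eval R T ρ = (pairCode Q i j : ℕ)) (hi : i < Q) (hj : j < Q) :
    (fst e).eval R T ρ = i ∧ (snd e).eval R T ρ = j :=
  ⟨h.eval_fst he (pairCode_lt_range₂ hi hj) hj, h.eval_snd he (pairCode_lt_range₂ hi hj) hj⟩

theorem Basic.decode₃ (h : Basic G s t d T) {e : TExpr} {ρ : ℕ → ℤ} {i j k : ℕ}
    (he : e.eval R T ρ = (pairCode Q (pairCode Q i j) k : ℕ)) (hi : i < Q) (hj : j < Q)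
    (hk : k < Q) : (fst (fst e)).eval R T ρ = i ∧ (snd (fst e)).eval R T ρ = j ∧
      (snd e).eval R T ρ = k :=
  have h3 := pairCode_lt_range₃ hi hj hk
  have h2 := h.decode₂ (h.eval_fst he h3 hk) hi hj
  ⟨h2.1, h2.2, h.eval_snd he h3 hk⟩

theorem Basic.decode₄ (h : Basic G s t d T) {e : TExpr} {ρ : ℕ → ℤ} {i j k l : ℕ}
    (he : e.eval R T ρ = (pairCode Q (pairCode Q (pairCode Q i j) k) l : ℕ)) (hi : i < Q)
    (hj : j < Q) (hk : k < Q) (hl : l < Q) :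
    (fst (fst (fst e))).eval R T ρ = i ∧ (snd (fst (fst e))).eval R T ρ = j ∧
      (snd (fst e)).eval R T ρ = k ∧ (snd e).eval R T ρ = l :=
  have h4 := pairCode_lt_range₄ hi hj hk hl
  have h3 := h.decode₃ (h.eval_fst he h4 hl) hi hj hk
  ⟨h3.1, h3.2.1, h3.2.2, h.eval_snd he h4 hl⟩

theorem vertex_lt (u : Fin n) : (u : ℕ) < Q := lt_base (by omega)

theorem arc_lt (a : Fin m) : (a : ℕ) < Q := lt_base (by omega)

theorem sum_boole_pos {ι : Type*} [Fintype ι] (p : ι → Prop) [DecidablePred p] :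
    (0 < ∑ i, if p i then (1 : ℤ) else 0) ↔ ∃ i, p i := by
  rw [Finset.sum_boole]
  simp [Finset.card_pos, Finset.filter_nonempty_iff]

/-! ## Reachability -/

/-- The rule for reachability by at most `r` arcs, addressed by `((r, u), w)`. -/
def reachRule : TExpr :=
  .ite (.eq (snd (fst (.var 0))) (snd (.var 0))) (.const 1)
    (.ite (fst (fst (.var 0)))
      (.lt (.const 0) (sumBelow 1 arcs (.ite (.eq (tailOf (.var 1)) (snd (fst (.var 0))))
        (.tab 8 (pair (pair (pred (fst (fst (.var 0)))) (headOf (.var 1))) (snd (.var 0))))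
        (.const 0))))
      (.const 0))

-- The number `r` of arcs allowed is the leading component of the address and drops in each call.
-- Existence of an arc is tested by positivity of a sum of truth values.
open Classical in
theorem Basic.fill_reachRule (h : Basic G s t d T) {r : ℕ} (hr : r < Q) (u w : Fin n) :
    fill R 8 reachRule T R 8 (pairCode Q (pairCode Q r u) w : ℕ) =
      if G.ReachBelow r u w then 1 else 0 := by
  refine fill_spec (ι := {r // r < Q} × Fin n × Fin n)
    (fun i => pairCode Q (pairCode Q i.1 i.2.1) i.2.2)
    (fun i => if G.ReachBelow i.1 i.2.1 i.2.2 then 1 else 0)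
    (fun i => pairCode_lt_range₃ i.1.2 (vertex_lt _) (vertex_lt _)) ?_ ⟨⟨r, hr⟩, u, w⟩
  rintro ⟨⟨r, hr⟩, u, w⟩ T' hT' ih
  have h' : Basic G s t d T' := h.congr fun i hi => hT' i (by omega)
  have key : ∀ ρ : ℕ → ℤ, ρ 0 = (pairCode Q (pairCode Q r u) w : ℕ) → _ := fun ρ hρ =>
    h'.decode₃ (e := .var 0) (ρ := ρ) hρ hr (vertex_lt u) (vertex_lt w)
  obtain ⟨k1, k2, k3⟩ := key (Function.update 0 0 _) (Function.update_self ..)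
  simp only [reachRule, eval, k1, k2, k3, cast_fin_inj]
  cases r with
  | zero => by_cases huw : u = w <;> simp [ArcDigraph.ReachBelow, huw]
  | succ r =>
    rw [eval_sumBelow h'.eval_arcs (lt_range (by omega)).le]
    have e : ∀ a : Fin m, (TExpr.ite (.eq (tailOf (.var 1)) (snd (fst (.var 0))))
        (.tab 8 (pair (pair (pred (fst (fst (.var 0)))) (headOf (.var 1))) (snd (.var 0))))
        (.const 0)).eval R T' (Function.update (Function.update 0 0
          (pairCode Q (pairCode Q (r + 1) u) w : ℕ)) 1 (a : ℕ)) =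
        if G.tail a = u ∧ G.ReachBelow r (G.head a) w then 1 else 0 := by
      intro a
      obtain ⟨k1, k2, k3⟩ := key (Function.update (Function.update 0 0
          (pairCode Q (pairCode Q (r + 1) u) w : ℕ)) 1 (a : ℕ)) (by
            rw [Function.update_of_ne (by omega), Function.update_self])
      have ha : (TExpr.var 1).eval R T' (Function.update (Function.update 0 0
          (pairCode Q (pairCode Q (r + 1) u) w : ℕ)) 1 (a : ℕ)) = (a : ℕ) := Function.update_self ..
      have hr' : r < Q := by omega
      have e1 := h'.eval_pair₃ (eval_pred (by rw [k1]; push_cast; rfl))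
        (h'.eval_headOf ha) k3 hr' (vertex_lt _)
      have := ih ⟨⟨r, hr'⟩, G.head a, w⟩ (pairCode_lt_pairCode
        (pairCode_lt_pairCode (Nat.lt_succ_self r) (vertex_lt _)) (vertex_lt _))
      simp only [eval, h'.eval_tailOf ha, k2, e1, cast_fin_inj] at this ⊢
      rw [this]
      by_cases h1 : G.tail a = u <;> simp [h1]
    have hr0 : ((r + 1 : ℕ) : ℤ) ≠ 0 := by omega
    rw [Finset.sum_congr rfl fun a _ => e a, if_neg hr0]
    simp only [sum_boole_pos, ArcDigraph.ReachBelow]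
    by_cases huw : u = w <;> simp [huw]

variable (d) in
/-- Table `8` describes reachability. -/
def ReachTable (G : ArcDigraph n m) (f : ℤ → ℤ) : Prop :=
  ∀ u w : Fin n, (G.Reach u w → f (pairCode Q (pairCode Q n u) w : ℕ) = 1) ∧
    (¬ G.Reach u w → f (pairCode Q (pairCode Q n u) w : ℕ) = 0)

theorem Basic.reachTable (h : Basic G s t d T) (hG : G.Acyclic) :
    ReachTable d G (fill R 8 reachRule T R 8) := by
  classical
  intro u w
  rw [h.fill_reachRule (lt_base (by omega)), hG.reachBelow_iff]
  exact ⟨fun h => if_pos h, fun h => if_neg h⟩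

/-- The truth value of reachability. -/
def reachExpr (x y : TExpr) : TExpr := .tab 8 (pair (pair vertices x) y)

open Classical in
theorem Basic.eval_reachExpr (h : Basic G s t d T) (h8 : ReachTable d G (T 8)) {x y : TExpr}
    {ρ : ℕ → ℤ} {u w : Fin n} (hx : x.eval R T ρ = (u : ℕ)) (hy : y.eval R T ρ = (w : ℕ)) :
    (reachExpr x y).eval R T ρ = if G.Reach u w then 1 else 0 := by
  rw [reachExpr, eval, h.eval_pair₃ (h.eval_vertices ρ) hx hy (lt_base (by omega)) (vertex_lt u)]
  split_ifs with hr
  · exact (h8 u w).1 hr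
  · exact (h8 u w).2 hr

/-! ## Canonical arcs and canonical paths -/

/-- The rule for the canonical arcs, addressed by `((k, u), w)`. -/
def nextRule : TExpr :=
  .ite (fst (fst (.var 0)))
    (.ite (.eq (tailOf (pred (fst (fst (.var 0))))) (snd (fst (.var 0))))
      (.ite (reachExpr (headOf (pred (fst (fst (.var 0))))) (snd (.var 0)))
        (fst (fst (.var 0)))
        (.tab 9 (pair (pair (pred (fst (fst (.var 0)))) (snd (fst (.var 0)))) (snd (.var 0)))))
      (.tab 9 (pair (pair (pred (fst (fst (.var 0)))) (snd (fst (.var 0)))) (snd (.var 0)))))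
    (.const 0)

variable (d) in
/-- Table `9` describes the canonical arcs. -/
def NextTable (G : ArcDigraph n m) (f : ℤ → ℤ) : Prop :=
  ∀ u w : Fin n, f (pairCode Q (pairCode Q m u) w : ℕ) = optCode (G.next u w)

/-- The recursion is on the number of arcs taken into account; the entries for `m` are those used
afterwards. -/
theorem Basic.nextTable (h : Basic G s t d T) (h8 : ReachTable d G (T 8)) :
    NextTable d G (fill R 9 nextRule T R 9) := by
  intro u w
  refine fill_spec (ι := {k // k ≤ m} × Fin n × Fin n)
    (fun i => pairCode Q (pairCode Q i.1 i.2.1) i.2.2)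
    (fun i => optCode (G.nextBelow i.2.1 i.2.2 i.1))
    (fun i => pairCode_lt_range₃ (lt_base (by have := i.1.2; omega)) (vertex_lt _) (vertex_lt _)) ?_
      ⟨⟨m, le_rfl⟩, u, w⟩
  rintro ⟨⟨k, hk⟩, u, w⟩ T' hT' ih
  have h' : Basic G s t d T' := h.congr fun i hi => hT' i (by omega)
  have h8' : ReachTable d G (T' 8) := by rwa [hT' 8 (by omega)]
  obtain ⟨k1, k2, k3⟩ := h'.decode₃ (e := .var 0)
    (ρ := Function.update 0 0 (pairCode Q (pairCode Q k u) w : ℕ)) (Function.update_self ..)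
    (lt_base (by omega)) (vertex_lt u) (vertex_lt w)
  cases k with
  | zero =>
    simp only [nextRule, eval, k1]
    simp [ArcDigraph.nextBelow, optCode]
  | succ k =>
    have k4 := eval_pred (i := k) (by rw [k1]; push_cast; rfl)
    have k5 := h'.eval_pair₃ k4 k2 k3 (lt_base (by omega)) (vertex_lt u)
    have := ih ⟨⟨k, by omega⟩, u, w⟩ (pairCode_lt_pairCode
      (pairCode_lt_pairCode (Nat.lt_succ_self k) (vertex_lt _)) (vertex_lt _))
    have hk0 : ((k + 1 : ℕ) : ℤ) ≠ 0 := by omega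
    have k4' : _ = (((⟨k, hk⟩ : Fin m) : ℕ) : ℤ) := k4
    simp only [nextRule, eval, k1, h'.eval_tailOf k4', k2, cast_fin_inj,
      h'.eval_reachExpr h8' (h'.eval_headOf k4') k3, k5] at this ⊢
    rw [if_neg hk0, this, ArcDigraph.nextBelow]
    by_cases h1 : G.tail ⟨k, hk⟩ = u
    · by_cases h2 : G.Reach (G.head ⟨k, hk⟩) w
      · rw [dif_pos ⟨hk, h1, h2⟩]; simp [h1, h2, optCode]
      · rw [dif_neg (fun h => h2 h.2.2)]; simp [h1, h2]
    · rw [dif_neg (fun h => h1 h.2.1)]; simp [h1]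

/-- The canonical arc, increased by one. -/
def nextExpr (x y : TExpr) : TExpr := .tab 9 (pair (pair arcs x) y)

theorem Basic.eval_nextExpr (h : Basic G s t d T) (h9 : NextTable d G (T 9)) {x y : TExpr}
    {ρ : ℕ → ℤ} {u w : Fin n} (hx : x.eval R T ρ = (u : ℕ)) (hy : y.eval R T ρ = (w : ℕ)) :
    (nextExpr x y).eval R T ρ = optCode (G.next u w) := by
  rw [nextExpr, eval, h.eval_pair₃ (h.eval_arcs ρ) hx hy (lt_base (by omega)) (vertex_lt u), h9]

/-- The rule for the arcs of canonical paths, addressed by `(((k, u), w), a)`. -/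
def canonRule : TExpr :=
  .ite (fst (fst (fst (.var 0))))
    (.ite (nextExpr (snd (fst (fst (.var 0)))) (snd (fst (.var 0))))
      (.ite (.eq (nextExpr (snd (fst (fst (.var 0)))) (snd (fst (.var 0))))
          (.add (snd (.var 0)) (.const 1)))
        (.const 1)
        (.tab 10 (pair (pair (pair (pred (fst (fst (fst (.var 0)))))
          (headOf (pred (nextExpr (snd (fst (fst (.var 0)))) (snd (fst (.var 0)))))))
          (snd (fst (.var 0)))) (snd (.var 0)))))
      (.const 0))
    (.const 0)

variable (d) in
open Classical in
/-- Table `10` describes the canonical paths. -/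
def CanonTable (G : ArcDigraph n m) (f : ℤ → ℤ) : Prop :=
  ∀ (u w : Fin n) (a : Fin m), f (pairCode Q (pairCode Q (pairCode Q n u) w) a : ℕ) =
    if a ∈ G.canon u w then 1 else 0

/-- The call moves to the head of the canonical arc, and the address drops because the length bound
leads it. -/
theorem Basic.canonTable (h : Basic G s t d T) (h9 : NextTable d G (T 9)) :
    CanonTable d G (fill R 10 canonRule T R 10) := by
  classical
  intro u w a
  refine fill_spec (ι := {k // k ≤ n} × Fin n × Fin n × Fin m)
    (fun i => pairCode Q (pairCode Q (pairCode Q i.1 i.2.1) i.2.2.1) i.2.2.2)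
    (fun i => if i.2.2.2 ∈ G.canonBelow i.1 i.2.1 i.2.2.1 then 1 else 0)
    (fun i => pairCode_lt_range₄ (lt_base (by have := i.1.2; omega)) (vertex_lt _) (vertex_lt _)
      (arc_lt _)) ?_ ⟨⟨n, le_rfl⟩, u, w, a⟩
  rintro ⟨⟨k, hk⟩, u, w, a⟩ T' hT' ih
  have h' : Basic G s t d T' := h.congr fun i hi => hT' i (by omega)
  have h9' : NextTable d G (T' 9) := by rwa [hT' 9 (by omega)]
  obtain ⟨k1, k2, k3, k4⟩ := h'.decode₄ (e := .var 0)
    (ρ := Function.update 0 0 (pairCode Q (pairCode Q (pairCode Q k u) w) a : ℕ))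
    (Function.update_self ..) (lt_base (by omega)) (vertex_lt u) (vertex_lt w) (arc_lt a)
  cases k with
  | zero =>
    simp only [canonRule, eval, k1]
    simp [ArcDigraph.canonBelow]
  | succ k =>
    have k5 := eval_pred (i := k) (by rw [k1]; push_cast; rfl)
    have k6 := h'.eval_nextExpr h9' k2 k3
    have hk0 : ((k + 1 : ℕ) : ℤ) ≠ 0 := by omega
    simp only [canonRule, eval, k1, k4, k6] at ih ⊢
    rw [if_neg hk0, ArcDigraph.canonBelow]
    cases hx : G.next u w with
    | none => simp [optCode]
    | some b =>
      have k7 : _ = ((b : ℕ) : ℤ) := eval_pred (i := b) (by rw [k6, hx, optCode]; push_cast; rfl)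
      have k8 := h'.eval_pair₄ k5 (h'.eval_headOf k7) k3 k4 (lt_base (by omega)) (vertex_lt _)
        (vertex_lt _)
      have := ih ⟨⟨k, by omega⟩, G.head b, w, a⟩ (pairCode_lt_pairCode (pairCode_lt_pairCode
        (pairCode_lt_pairCode (Nat.lt_succ_self k) (vertex_lt _)) (vertex_lt _)) (arc_lt _))
      simp only at this
      rw [k8, this]
      have h1 : (((b : ℕ) + 1 : ℕ) : ℤ) ≠ 0 := by omega
      have h2 : (((b : ℕ) + 1 : ℕ) : ℤ) = ((a : ℕ) : ℤ) + 1 ↔ a = b := by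
        rw [Fin.ext_iff]; omega
      simp only [optCode, h1, h2, if_false, List.mem_cons]
      by_cases hab : a = b <;> simp [hab]

/-- The truth value of membership in a canonical path. -/
def canonExpr (x y z : TExpr) : TExpr := .tab 10 (pair (pair (pair vertices x) y) z)

open Classical in
theorem Basic.eval_canonExpr (h : Basic G s t d T) (h10 : CanonTable d G (T 10)) {x y z : TExpr}
    {ρ : ℕ → ℤ} {u w : Fin n} {a : Fin m} (hx : x.eval R T ρ = (u : ℕ))
    (hy : y.eval R T ρ = (w : ℕ)) (hz : z.eval R T ρ = (a : ℕ)) :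
    (canonExpr x y z).eval R T ρ = if a ∈ G.canon u w then 1 else 0 := by
  rw [canonExpr, eval, h.eval_pair₄ (h.eval_vertices ρ) hx hy hz (lt_base (by omega))
    (vertex_lt u) (vertex_lt w), h10]

/-! ## The listing of the sets -/

/-- The rule for the keys. -/
def keyRule : TExpr :=
  consCode (sumBelow 1 vertices (reachExpr (.var 1) (tailOf (.var 0)))) (.var 0)

/-- Table `11` contains the keys. -/
def KeyTable (G : ArcDigraph n m) (f : ℤ → ℤ) : Prop :=
  ∀ a : Fin m, f (a : ℕ) = (G.key a : ℕ)

theorem Basic.keyTable (h : Basic G s t d T) (h8 : ReachTable d G (T 8)) :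
    KeyTable G (fill R 11 keyRule T R 11) := by
  classical
  intro a
  refine fill_spec (ι := Fin m) (fun a => a) (fun a => (G.key a : ℕ))
    (fun a => lt_range (by omega)) ?_ a
  intro a T' hT' _
  have h' : Basic G s t d T' := h.congr fun i hi => hT' i (by omega)
  have h8' : ReachTable d G (T' 8) := by rwa [hT' 8 (by omega)]
  have k1 : (TExpr.var 0).eval R T' (Function.update 0 0 ((a : ℕ) : ℤ)) = (a : ℕ) :=
    Function.update_self ..
  rw [keyRule, consCode, eval, k1, eval, eval_sumBelow h'.eval_vertices (lt_range (by omega)).le]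
  have e : ∀ x : Fin n, (reachExpr (.var 1) (tailOf (.var 0))).eval R T'
      (Function.update (Function.update 0 0 ((a : ℕ) : ℤ)) 1 (x : ℕ)) =
      if G.Reach x (G.tail a) then 1 else 0 := fun x =>
    h'.eval_reachExpr h8' (Function.update_self ..) (h'.eval_tailOf (by
      rw [eval, Function.update_of_ne (by omega), Function.update_self]))
  rw [Finset.sum_congr rfl fun x _ => e x, Finset.sum_boole, h'.mulA _ (lt_range ?_)]
  · rw [ArcDigraph.key, ArcDigraph.rank]; push_cast; rfl
  · have := Finset.card_le_univ (Finset.univ.filter fun x => G.Reach x (G.tail a))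
    rw [Fintype.card_fin] at this
    omega

/-- The rule for the codes of sorted lists. -/
def validRule : TExpr :=
  .ite (.var 0)
    (.ite (hdDigit (.var 0))
      (.ite (.lt (hdDigit (.var 0)) (.add arcs (.const 1)))
        (.ite (.tab 12 (tlCode (.var 0)))
          (.ite (tlCode (.var 0))
            (.lt (.tab 11 (pred (hdDigit (tlCode (.var 0))))) (.tab 11 (pred (hdDigit (.var 0)))))
            (.const 1))
          (.const 0))
        (.const 0))
      (.const 0))
    (.const 1)

variable (d) in
open Classical in
/-- Table `12` describes the codes of sorted lists. -/
def ValidTable (G : ArcDigraph n m) (f : ℤ → ℤ) : Prop :=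
  ∀ c < R, f (c : ℕ) = if ∃ l, G.Sorted l ∧ listCode (n + m + 2) l = c then 1 else 0

theorem sorted_cons_cons {a b : Fin m} {l : List (Fin m)} :
    G.Sorted (a :: b :: l) ↔ G.key b < G.key a ∧ G.Sorted (b :: l) := by
  constructor
  · intro h
    exact ⟨(List.pairwise_cons.1 h).1 b (by simp), (List.pairwise_cons.1 h).2⟩
  · rintro ⟨h1, h2⟩
    refine List.pairwise_cons.2 ⟨fun x hx => ?_, h2⟩
    rcases List.mem_cons.1 hx with rfl | hx
    · exact h1
    · exact ((List.pairwise_cons.1 h2).1 x hx).trans h1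

/-- A nonzero code is valid if its last digit stands for an arc, its quotient is valid, and this arc
has a larger key than the first arc of the quotient, if any; by transitivity no further comparison
is needed. -/
theorem Basic.validTable (h : Basic G s t d T) (h11 : KeyTable G (T 11)) :
    ValidTable d G (fill R 12 validRule T R 12) := by
  classical
  intro c hc
  refine fill_spec (ι := {c // c < R}) (fun c => c.1)
    (fun c => if ∃ l, G.Sorted l ∧ listCode (n + m + 2) l = c then 1 else 0)
    (fun c => c.2) ?_ ⟨c, hc⟩
  rintro ⟨c, hc⟩ T' hT' ih
  have h' : Basic G s t d T' := h.congr fun i hi => hT' i (by omega)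
  have h11' : KeyTable G (T' 11) := by rwa [hT' 11 (by omega)]
  have hA : m < n + m + 2 := by omega
  by_cases hc0 : c = 0
  · subst hc0
    rw [if_pos ⟨[], List.Pairwise.nil, rfl⟩]
    simp [validRule, eval]
  have hdiv : c / (n + m + 2) < c := Nat.div_lt_self (by omega) (by omega)
  have hi := ih ⟨c / (n + m + 2), hdiv.trans hc⟩ hdiv
  have hcz : (c : ℤ) ≠ 0 := by exact_mod_cast hc0
  simp only [validRule, eval, pred, hdDigit, tlCode, Function.update_self, h'.divA c hc,
    h'.modA c hc, hcz, if_false, h'.eval_arcs] at hi ⊢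
  rw [hi]
  have hcode : pairCode (n + m + 2) (c / (n + m + 2)) (c % (n + m + 2)) = c := by
    rw [pairCode]; exact Nat.div_add_mod' c _
  set x := c % (n + m + 2) with hx
  set c' := c / (n + m + 2) with hc'
  have hxA : x < n + m + 2 := Nat.mod_lt _ (by omega)
  have hcons : ∀ (b : Fin m) l, listCode (n + m + 2) (b :: l) = c →
      (b : ℕ) + 1 = x ∧ listCode (n + m + 2) l = c' := by
    intro b l hl
    have hb : (b : ℕ) + 1 < n + m + 2 := by omega
    constructor
    · rw [hx, ← hl, listCode, pairCode_mod hb]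
    · rw [hc', ← hl, listCode, pairCode_div hb]
  -- These digits stand for no arc, so no list has the code `c`.
  by_cases hxm : x = 0 ∨ m < x
  · rw [if_neg (c := ∃ l, G.Sorted l ∧ listCode (n + m + 2) l = c)]
    · rcases hxm with hxm | hxm
      · simp [hxm]
      · rw [if_pos (c := (if (x : ℤ) < m + 1 then (1 : ℤ) else 0) = 0)]
        · simp
        · rw [if_neg]; omega
    · rintro ⟨_ | ⟨b, l⟩, -, hl⟩
      · exact hc0 hl.symm
      · have := (hcons b l hl).1
        omega
  push Not at hxm
  obtain ⟨a, ha⟩ : ∃ a : Fin m, (a : ℕ) + 1 = x := ⟨⟨x - 1, by omega⟩, by simp only; omega⟩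
  have h1 : (x : ℤ) ≠ 0 := by exact_mod_cast hxm.1
  have h2 : (x : ℤ) < m + 1 := by omega
  simp only [h1, h2, if_true, if_false, one_ne_zero]
  by_cases hl' : ∃ l, G.Sorted l ∧ listCode (n + m + 2) l = c'
  · obtain ⟨l, hls, hlc⟩ := hl'
    rw [if_neg (by rw [if_pos ⟨l, hls, hlc⟩]; exact one_ne_zero)]
    have hiff : (∃ l, G.Sorted l ∧ listCode (n + m + 2) l = c) ↔ G.Sorted (a :: l) := by
      constructor
      · rintro ⟨_ | ⟨b, l2⟩, h3, h4⟩
        · exact absurd h4.symm hc0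
        · obtain ⟨h5, h6⟩ := hcons b l2 h4
          obtain rfl : b = a := Fin.ext (by omega)
          obtain rfl := listCode_injective hA (h6.trans hlc.symm)
          exact h3
      · exact fun h => ⟨_, h, by rw [listCode, hlc, ha, hcode]⟩
    simp only [hiff]
    cases l with
    | nil =>
      have : c' = 0 := hlc.symm
      rw [if_pos (by exact_mod_cast this), if_pos]
      exact List.pairwise_singleton _ _
    | cons b l =>
      have hc'0 : c' ≠ 0 := hlc ▸ listCode_cons_ne_zero b l
      rw [if_neg (by exact_mod_cast hc'0), h'.modA c' (hdiv.trans hc), ← hlc, listCode,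
        pairCode_mod (by omega), ← ha]
      simp only [sorted_cons_cons, hls, and_true, Nat.cast_succ, add_sub_cancel_right, h11' a,
        h11' b, Nat.cast_lt]
  · rw [if_pos (by rw [if_neg hl']), if_neg]
    rintro ⟨_ | ⟨b, l⟩, h3, h4⟩
    · exact hc0 h4.symm
    · exact hl' ⟨l, (List.pairwise_cons.1 h3).2, (hcons b l h4).2⟩

/-- The rule for membership in a list, addressed by `(l, a)`. -/
def memRule : TExpr :=
  .ite (fst (.var 0))
    (.ite (.eq (hdDigit (fst (.var 0))) (.add (snd (.var 0)) (.const 1))) (.const 1)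
      (.tab 13 (pair (tlCode (fst (.var 0))) (snd (.var 0)))))
    (.const 0)

variable (n m d) in
open Classical in
/-- Table `13` describes membership in lists. -/
def MemTable (f : ℤ → ℤ) : Prop :=
  ∀ (l : List (Fin m)) (a : Fin m), l.length ≤ d →
    f (pairCode Q (listCode (n + m + 2) l) a : ℕ) = if a ∈ l then 1 else 0

theorem listCode_lt_cons (a : Fin m) (l : List (Fin m)) :
    listCode (n + m + 2) l < listCode (n + m + 2) (a :: l) := by
  rw [listCode, pairCode]
  have := Nat.le_mul_of_pos_right (listCode (n + m + 2) l) (show 0 < n + m + 2 by omega)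
  omega

theorem Basic.eval_list (h : Basic G s t d T) {e : TExpr} {ρ : ℕ → ℤ} {a : Fin m}
    {l : List (Fin m)} (he : e.eval R T ρ = listCode (n + m + 2) (a :: l))
    (hl : (a :: l).length ≤ d) :
    e.eval R T ρ ≠ 0 ∧ (hdDigit e).eval R T ρ = (a : ℕ) + 1 ∧
      (tlCode e).eval R T ρ = listCode (n + m + 2) l := by
  refine ⟨?_, ?_, ?_⟩
  · rw [he]; exact_mod_cast listCode_cons_ne_zero a l
  · rw [hdDigit, eval, he, h.digit_eq hl]
  · rw [tlCode, eval, he, h.rest_eq hl]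

theorem Basic.memTable (h : Basic G s t d T) : MemTable n m d (fill R 13 memRule T R 13) := by
  classical
  intro l a hl
  refine fill_spec (ι := {l : List (Fin m) // l.length ≤ d} × Fin m)
    (fun i => pairCode Q (listCode (n + m + 2) i.1.1) i.2)
    (fun i => if i.2 ∈ i.1.1 then 1 else 0)
    (fun i => pairCode_lt_range₂ (listCode_lt_base i.1.2) (arc_lt _)) ?_ ⟨⟨l, hl⟩, a⟩
  rintro ⟨⟨l, hl⟩, a⟩ T' hT' ih
  have h' : Basic G s t d T' := h.congr fun i hi => hT' i (by omega)
  obtain ⟨k1, k2⟩ := h'.decode₂ (e := .var 0)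
    (ρ := Function.update 0 0 (pairCode Q (listCode (n + m + 2) l) a : ℕ))
    (Function.update_self ..) (listCode_lt_base hl) (arc_lt a)
  cases l with
  | nil =>
    simp only [memRule, eval, k1]
    simp [listCode]
  | cons b l =>
    obtain ⟨k3, k4, k5⟩ := h'.eval_list k1 hl
    have hl' : l.length ≤ d := (Nat.le_succ _).trans hl
    have k6 := h'.eval_pair₂ k5 k2 (listCode_lt_base hl')
    have := ih ⟨⟨l, hl'⟩, a⟩ (pairCode_lt_pairCode (listCode_lt_cons b l) (arc_lt _))
    simp only [memRule, eval, k3, k2, k4, k6, if_false] at this ⊢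
    rw [this]
    have h2 : ((b : ℕ) : ℤ) + 1 = ((a : ℕ) : ℤ) + 1 ↔ a = b := by rw [Fin.ext_iff]; omega
    simp only [h2, List.mem_cons]
    by_cases hab : a = b <;> simp [hab]

end

end RAM

namespace RAM

open TExpr

section

variable {n m : ℕ} {G : ArcDigraph n m} {s t : Fin n} {d : ℕ} {T : ℕ → ℤ → ℤ}

/-- The base of the codes of pairs. -/
local notation "Q" => (n + m + 2) ^ (d + 1)

/-- The range. -/
local notation "R" => (n + m + 2) ^ (4 * (d + 1))

/-! ## Coefficients -/

/-- The rule for removing the arc `o`, if any, and the canonical path from `u` to `w` from the list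
`B`, addressed by `(((B, o), u), w)`. -/
def restRule : TExpr :=
  .ite (fst (fst (fst (.var 0))))
    (.ite (.eq (hdDigit (fst (fst (fst (.var 0))))) (snd (fst (fst (.var 0)))))
      (.tab 14 (pair (pair (pair (tlCode (fst (fst (fst (.var 0))))) (snd (fst (fst (.var 0)))))
        (snd (fst (.var 0)))) (snd (.var 0))))
      (.ite (canonExpr (snd (fst (.var 0))) (snd (.var 0)) (pred (hdDigit (fst (fst (fst (.var 0)))))))
        (.tab 14 (pair (pair (pair (tlCode (fst (fst (fst (.var 0))))) (snd (fst (fst (.var 0)))))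
          (snd (fst (.var 0)))) (snd (.var 0))))
        (consCode
          (.tab 14 (pair (pair (pair (tlCode (fst (fst (fst (.var 0))))) (snd (fst (fst (.var 0)))))
            (snd (fst (.var 0)))) (snd (.var 0))))
          (hdDigit (fst (fst (fst (.var 0))))))))
    (.const 0)

variable (d) in
/-- Table `14` describes the removal of paths from lists. -/
def RestTable (G : ArcDigraph n m) (f : ℤ → ℤ) : Prop :=
  ∀ (B : List (Fin m)) (o : Option (Fin m)) (u w : Fin n), B.length ≤ d →
    f (pairCode Q (pairCode Q (pairCode Q (listCode (n + m + 2) B) (optCode o)) u) w : ℕ) =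
      listCode (n + m + 2) (ArcDigraph.rest B (o.toList ++ G.canon u w))

theorem opt_lt (o : Option (Fin m)) : optCode o < Q := lt_base (by have := optCode_lt o; omega)

theorem length_rest_le (B P : List (Fin m)) : (ArcDigraph.rest B P).length ≤ B.length :=
  List.length_filter_le _ _

/-- The list is filtered arc by arc. The optional arc lets one table serve both terms of the
recursion of `coeff`, since only one of the two ends begins with the distinguished arc. -/
theorem Basic.restTable (h : Basic G s t d T) (h10 : CanonTable d G (T 10)) :
    RestTable d G (fill R 14 restRule T R 14) := by
  classical
  intro B o u w hB
  refine fill_spec (ι := {B : List (Fin m) // B.length ≤ d} × Option (Fin m) × Fin n × Fin n)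
    (fun i => pairCode Q (pairCode Q (pairCode Q (listCode (n + m + 2) i.1.1) (optCode i.2.1))
      i.2.2.1) i.2.2.2)
    (fun i => listCode (n + m + 2) (ArcDigraph.rest i.1.1 (i.2.1.toList ++ G.canon i.2.2.1 i.2.2.2)))
    (fun i => pairCode_lt_range₄ (listCode_lt_base i.1.2) (opt_lt _) (vertex_lt _) (vertex_lt _))
    ?_ ⟨⟨B, hB⟩, o, u, w⟩
  rintro ⟨⟨B, hB⟩, o, u, w⟩ T' hT' ih
  have h' : Basic G s t d T' := h.congr fun i hi => hT' i (by omega)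
  have h10' : CanonTable d G (T' 10) := by rwa [hT' 10 (by omega)]
  obtain ⟨k1, k2, k3, k4⟩ := h'.decode₄ (e := .var 0)
    (ρ := Function.update 0 0
      (pairCode Q (pairCode Q (pairCode Q (listCode (n + m + 2) B) (optCode o)) u) w : ℕ))
    (Function.update_self ..) (listCode_lt_base hB) (opt_lt o) (vertex_lt u) (vertex_lt w)
  cases B with
  | nil =>
    simp only [restRule, eval, k1]
    simp [listCode, ArcDigraph.rest]
  | cons b B =>
    obtain ⟨k5, k6, k7⟩ := h'.eval_list k1 hB
    have hB' : B.length ≤ d := (Nat.le_succ _).trans hB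
    have k8 := h'.eval_pair₄ k7 k2 k3 k4 (listCode_lt_base hB') (opt_lt o) (vertex_lt u)
    have k9 := h'.eval_canonExpr h10' k3 k4 (eval_pred k6)
    have := ih ⟨⟨B, hB'⟩, o, u, w⟩ (pairCode_lt_pairCode (pairCode_lt_pairCode
      (pairCode_lt_pairCode (listCode_lt_cons b B) (opt_lt _)) (vertex_lt _)) (vertex_lt _))
    simp only [restRule, eval, k5, k2, k6, k8, k9, consCode, if_false] at this ⊢
    rw [this, h'.mulA _ ((listCode_lt_base ((length_rest_le _ _).trans hB')).trans_le
      base_le_range)]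
    have h2 : ((b : ℕ) : ℤ) + 1 = (optCode o : ℕ) ↔ o = some b := by
      rw [← optCode_eq_succ]; omega
    have h3 : b ∈ o.toList ++ G.canon u w ↔ o = some b ∨ b ∈ G.canon u w := by
      simp
    simp only [h2]
    by_cases hb : o = some b
    · have : ArcDigraph.rest (b :: B) (o.toList ++ G.canon u w) =
          ArcDigraph.rest B (o.toList ++ G.canon u w) := by
        rw [ArcDigraph.rest, List.filter_cons_of_neg (by
          rw [decide_eq_true_eq, not_not]; exact h3.2 (.inl hb))]; rfl
      rw [if_neg (by rw [if_pos hb]; exact one_ne_zero), this]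
    · by_cases hc : b ∈ G.canon u w
      · have : ArcDigraph.rest (b :: B) (o.toList ++ G.canon u w) =
            ArcDigraph.rest B (o.toList ++ G.canon u w) := by
          rw [ArcDigraph.rest, List.filter_cons_of_neg (by
            rw [decide_eq_true_eq, not_not]; exact h3.2 (.inr hc))]; rfl
        simp [hb, hc, this]
      · have : ArcDigraph.rest (b :: B) (o.toList ++ G.canon u w) =
            b :: ArcDigraph.rest B (o.toList ++ G.canon u w) := by
          rw [ArcDigraph.rest, List.filter_cons_of_pos (by
            rw [decide_eq_true_eq, h3]; tauto)]; rfl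
        rw [this, listCode, pairCode]
        simp [hb, hc]

/-- The code of the list without an arc and a canonical path. -/
def restExpr (B o x y : TExpr) : TExpr := .tab 14 (pair (pair (pair B o) x) y)

theorem Basic.eval_restExpr (h : Basic G s t d T) (h14 : RestTable d G (T 14))
    {e e' x y : TExpr} {ρ : ℕ → ℤ} {B : List (Fin m)} (hB : B.length ≤ d) (o : Option (Fin m))
    {u w : Fin n} (he : e.eval R T ρ = listCode (n + m + 2) B)
    (he' : e'.eval R T ρ = optCode o) (hx : x.eval R T ρ = (u : ℕ))
    (hy : y.eval R T ρ = (w : ℕ)) :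
    (restExpr e e' x y).eval R T ρ =
      listCode (n + m + 2) (ArcDigraph.rest B (o.toList ++ G.canon u w)) := by
  rw [restExpr, eval, h.eval_pair₄ he he' hx hy (listCode_lt_base hB) (opt_lt o) (vertex_lt u),
    h14 B o u w hB]

/-- The rule for reduced lists, addressed by `(D, w)`. -/
def reducedRule : TExpr :=
  .ite (fst (.var 0))
    (.ite (reachExpr (headOf (pred (hdDigit (fst (.var 0))))) (snd (.var 0)))
      (.ite (.eq (nextExpr (tailOf (pred (hdDigit (fst (.var 0))))) (snd (.var 0)))
          (hdDigit (fst (.var 0))))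
        (.const 0)
        (.tab 15 (pair (tlCode (fst (.var 0))) (tailOf (pred (hdDigit (fst (.var 0))))))))
      (.const 0))
    (reachExpr source (snd (.var 0)))

open Classical in
variable (d) in
/-- Table `15` describes reduced lists. -/
def ReducedTable (G : ArcDigraph n m) (s : Fin n) (f : ℤ → ℤ) : Prop :=
  ∀ (D : List (Fin m)) (w : Fin n), D.length ≤ d →
    f (pairCode Q (listCode (n + m + 2) D) w : ℕ) = if G.Reduced s D w then 1 else 0

theorem Basic.reducedTable (h : Basic G s t d T) (h8 : ReachTable d G (T 8))
    (h9 : NextTable d G (T 9)) : ReducedTable d G s (fill R 15 reducedRule T R 15) := by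
  classical
  intro D w hD
  refine fill_spec (ι := {D : List (Fin m) // D.length ≤ d} × Fin n)
    (fun i => pairCode Q (listCode (n + m + 2) i.1.1) i.2)
    (fun i => if G.Reduced s i.1.1 i.2 then 1 else 0)
    (fun i => pairCode_lt_range₂ (listCode_lt_base i.1.2) (vertex_lt _)) ?_ ⟨⟨D, hD⟩, w⟩
  rintro ⟨⟨D, hD⟩, w⟩ T' hT' ih
  have h' : Basic G s t d T' := h.congr fun i hi => hT' i (by omega)
  have h8' : ReachTable d G (T' 8) := by rwa [hT' 8 (by omega)]
  have h9' : NextTable d G (T' 9) := by rwa [hT' 9 (by omega)]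
  obtain ⟨k1, k2⟩ := h'.decode₂ (e := .var 0)
    (ρ := Function.update 0 0 (pairCode Q (listCode (n + m + 2) D) w : ℕ))
    (Function.update_self ..) (listCode_lt_base hD) (vertex_lt w)
  cases D with
  | nil =>
    simp only [reducedRule, eval, k1, h'.eval_reachExpr h8' (h'.eval_source _) k2]
    by_cases hr : G.Reach s w <;> simp [listCode, ArcDigraph.Reduced, hr]
  | cons a D =>
    obtain ⟨k5, k6, k7⟩ := h'.eval_list k1 hD
    have hD' : D.length ≤ d := (Nat.le_succ _).trans hD
    have k8 := eval_pred k6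
    have k9 := h'.eval_tailOf k8
    have k10 := h'.eval_pair₂ k7 k9 (listCode_lt_base hD')
    have := ih ⟨⟨D, hD'⟩, G.tail a⟩ (pairCode_lt_pairCode (listCode_lt_cons a D) (vertex_lt _))
    simp only [reducedRule, eval, k5, k6, k10, h'.eval_nextExpr h9' k9 k2, if_false,
      h'.eval_reachExpr h8' (h'.eval_headOf k8) k2] at this ⊢
    rw [this]
    have h2 : ((optCode (G.next (G.tail a) w) : ℕ) : ℤ) = ((a : ℕ) : ℤ) + 1 ↔
        G.next (G.tail a) w = some a := by
      rw [← optCode_eq_succ]; omega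
    simp only [h2, ArcDigraph.Reduced]
    by_cases h3 : G.Reach (G.head a) w
    · by_cases h4 : G.next (G.tail a) w = some a <;> simp [h3, h4]
    · simp [h3]

/-- The rule for the coefficients, addressed by `((D, w), B)`. -/
def coeffRule : TExpr :=
  .ite (fst (fst (.var 0)))
    (.sub
      (.tab 16 (pair (pair (tlCode (fst (fst (.var 0))))
        (tailOf (pred (hdDigit (fst (fst (.var 0)))))))
        (restExpr (snd (.var 0)) (hdDigit (fst (fst (.var 0))))
          (headOf (pred (hdDigit (fst (fst (.var 0)))))) (snd (fst (.var 0))))))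
      (.tab 16 (pair (pair (tlCode (fst (fst (.var 0))))
        (tailOf (pred (hdDigit (fst (fst (.var 0)))))))
        (restExpr (snd (.var 0)) (.const 0)
          (tailOf (pred (hdDigit (fst (fst (.var 0)))))) (snd (fst (.var 0)))))))
    (.eq (restExpr (snd (.var 0)) (.const 0) source (snd (fst (.var 0)))) (.const 0))

variable (d) in
/-- Table `16` contains the coefficients. -/
def CoeffTable (G : ArcDigraph n m) (s : Fin n) (f : ℤ → ℤ) : Prop :=
  ∀ (D : List (Fin m)) (w : Fin n) (B : List (Fin m)), D.length ≤ d → B.length ≤ d →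
    f (pairCode Q (pairCode Q (listCode (n + m + 2) D) w) (listCode (n + m + 2) B) : ℕ) =
      G.coeff s D w B

/-- The list `D` leads the address and gets shorter, while target and monomial change freely. For
empty `D`, inclusion in the canonical path means that its removal leaves the empty list, whose code
is `0`. -/
theorem Basic.coeffTable (h : Basic G s t d T) (h14 : RestTable d G (T 14)) :
    CoeffTable d G s (fill R 16 coeffRule T R 16) := by
  classical
  intro D w B hD hB
  refine fill_spec (ι := {D : List (Fin m) // D.length ≤ d} × Fin n ×
      {B : List (Fin m) // B.length ≤ d})
    (fun i => pairCode Q (pairCode Q (listCode (n + m + 2) i.1.1) i.2.1)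
      (listCode (n + m + 2) i.2.2.1))
    (fun i => G.coeff s i.1.1 i.2.1 i.2.2.1)
    (fun i => pairCode_lt_range₃ (listCode_lt_base i.1.2) (vertex_lt _)
      (listCode_lt_base i.2.2.2)) ?_ ⟨⟨D, hD⟩, w, ⟨B, hB⟩⟩
  rintro ⟨⟨D, hD⟩, w, ⟨B, hB⟩⟩ T' hT' ih
  have h' : Basic G s t d T' := h.congr fun i hi => hT' i (by omega)
  have h14' : RestTable d G (T' 14) := by rwa [hT' 14 (by omega)]
  obtain ⟨k1, k2, k3⟩ := h'.decode₃ (e := .var 0) (ρ := Function.update 0 0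
      (pairCode Q (pairCode Q (listCode (n + m + 2) D) w) (listCode (n + m + 2) B) : ℕ))
    (Function.update_self ..) (listCode_lt_base hD) (vertex_lt w) (listCode_lt_base hB)
  have k0 : ∀ ρ, (TExpr.const 0).eval R T' ρ = (optCode (none : Option (Fin m)) : ℕ) := fun _ => rfl
  cases D with
  | nil =>
    have k4 := h'.eval_restExpr h14' hB none k3 (k0 _) (h'.eval_source _) k2
    simp only [coeffRule, eval, k1, k4]
    simp only [listCode, Nat.cast_zero, Nat.cast_eq_zero, listCode_eq_zero, ArcDigraph.coeff,
      ArcDigraph.incl, Option.toList_none, List.nil_append, if_true]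
    congr 1
    simp [ArcDigraph.rest, List.filter_eq_nil_iff]
  | cons a D =>
    obtain ⟨k5, k6, k7⟩ := h'.eval_list k1 hD
    have hD' : D.length ≤ d := (Nat.le_succ _).trans hD
    have k8 := eval_pred k6
    have k9 := h'.eval_tailOf k8
    have k10 := h'.eval_restExpr h14' hB (some a) k3 (k6.trans (by rw [optCode]; push_cast; rfl))
      (h'.eval_headOf k8) k2
    have k11 := h'.eval_restExpr h14' hB none k3 (k0 _) k9 k2
    have step : ∀ P : List (Fin m), T' 16 (pairCode Q (pairCode Q (listCode (n + m + 2) D)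
        (G.tail a)) (listCode (n + m + 2) (ArcDigraph.rest B P)) : ℕ) =
        G.coeff s D (G.tail a) (ArcDigraph.rest B P) := fun P =>
      ih ⟨⟨D, hD'⟩, G.tail a, ⟨ArcDigraph.rest B P, (length_rest_le _ _).trans hB⟩⟩
        (pairCode_lt_pairCode (pairCode_lt_pairCode (listCode_lt_cons a D) (vertex_lt _))
          (listCode_lt_base ((length_rest_le _ _).trans hB)))
    simp only [coeffRule, eval, k5, if_false,
      h'.eval_pair₃ k7 k9 k10 (listCode_lt_base hD') (vertex_lt _),
      h'.eval_pair₃ k7 k9 k11 (listCode_lt_base hD') (vertex_lt _), step]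
    rfl

/-! ## All tables -/

/-- The rules of all tables. -/
def allRules : List (ℕ × TExpr) :=
  basicRules ++ [(8, reachRule), (9, nextRule), (10, canonRule), (11, keyRule), (12, validRule),
    (13, memRule), (14, restRule), (15, reducedRule), (16, coeffRule)]

theorem filled_append (N : ℕ) (l l' : List (ℕ × TExpr)) (T : ℕ → ℤ → ℤ) :
    filled N (l ++ l') T = filled N l' (filled N l T) := by
  induction l generalizing T with
  | nil => rfl
  | cons a l ih => exact ih _

/-- The content of all tables. -/
structure Complete (G : ArcDigraph n m) (s t : Fin n) (d : ℕ) (T : ℕ → ℤ → ℤ) : Prop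
    extends Basic G s t d T where
  valid : ValidTable d G (T 12)
  mem : MemTable n m d (T 13)
  red : ReducedTable d G s (T 15)
  coeff : CoeffTable d G s (T 16)

theorem complete_filled (hG : G.Acyclic) :
    Complete G s t d (filled R allRules (baseTables (G.inputWord s t) (n + m + 2) d)) := by
  rw [allRules, filled_append]
  have hb := basic_filled G s t d
  set T0 := filled R basicRules (baseTables (G.inputWord s t) (n + m + 2) d)
  simp only [filled]
  set T8 := fill R 8 reachRule T0 R
  set T9 := fill R 9 nextRule T8 R
  set T10 := fill R 10 canonRule T9 R
  set T11 := fill R 11 keyRule T10 R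
  set T12 := fill R 12 validRule T11 R
  set T13 := fill R 13 memRule T12 R
  set T14 := fill R 14 restRule T13 R
  set T15 := fill R 15 reducedRule T14 R
  set T16 := fill R 16 coeffRule T15 R
  have e8 : ∀ t ≠ 8, T8 t = T0 t := fun t ht => fill_of_ne _ _ _ _ _ ht
  have e9 : ∀ t ≠ 9, T9 t = T8 t := fun t ht => fill_of_ne _ _ _ _ _ ht
  have e10 : ∀ t ≠ 10, T10 t = T9 t := fun t ht => fill_of_ne _ _ _ _ _ ht
  have e11 : ∀ t ≠ 11, T11 t = T10 t := fun t ht => fill_of_ne _ _ _ _ _ ht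
  have e12 : ∀ t ≠ 12, T12 t = T11 t := fun t ht => fill_of_ne _ _ _ _ _ ht
  have e13 : ∀ t ≠ 13, T13 t = T12 t := fun t ht => fill_of_ne _ _ _ _ _ ht
  have e14 : ∀ t ≠ 14, T14 t = T13 t := fun t ht => fill_of_ne _ _ _ _ _ ht
  have e15 : ∀ t ≠ 15, T15 t = T14 t := fun t ht => fill_of_ne _ _ _ _ _ ht
  have e16 : ∀ t ≠ 16, T16 t = T15 t := fun t ht => fill_of_ne _ _ _ _ _ ht
  have b8 : Basic G s t d T8 := hb.congr fun i hi => e8 i (by omega)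
  have b9 : Basic G s t d T9 := b8.congr fun i hi => e9 i (by omega)
  have b10 : Basic G s t d T10 := b9.congr fun i hi => e10 i (by omega)
  have b11 : Basic G s t d T11 := b10.congr fun i hi => e11 i (by omega)
  have b12 : Basic G s t d T12 := b11.congr fun i hi => e12 i (by omega)
  have b13 : Basic G s t d T13 := b12.congr fun i hi => e13 i (by omega)
  have b14 : Basic G s t d T14 := b13.congr fun i hi => e14 i (by omega)
  have b15 : Basic G s t d T15 := b14.congr fun i hi => e15 i (by omega)
  have b16 : Basic G s t d T16 := b15.congr fun i hi => e16 i (by omega)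
  have g8 : ReachTable d G (T8 8) := hb.reachTable hG
  have g9 : NextTable d G (T9 9) := b8.nextTable g8
  have g10 : CanonTable d G (T10 10) := b9.canonTable g9
  have g11 : KeyTable G (T11 11) := b10.keyTable (by rwa [e10 8 (by omega), e9 8 (by omega)])
  have g12 : ValidTable d G (T12 12) := b11.validTable g11
  have g13 : MemTable n m d (T13 13) := b12.memTable
  have g14 : RestTable d G (T14 14) :=
    b13.restTable (by rwa [e13 10 (by omega), e12 10 (by omega), e11 10 (by omega)])
  have g15 : ReducedTable d G s (T15 15) := b14.reducedTable
    (by rwa [e14 8 (by omega), e13 8 (by omega), e12 8 (by omega), e11 8 (by omega),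
      e10 8 (by omega), e9 8 (by omega)])
    (by rwa [e14 9 (by omega), e13 9 (by omega), e12 9 (by omega), e11 9 (by omega),
      e10 9 (by omega)])
  have g16 : CoeffTable d G s (T16 16) := b15.coeffTable (by rwa [e15 14 (by omega)])
  exact {
    toBasic := b16
    valid := by rwa [e16 12 (by omega), e15 12 (by omega), e14 12 (by omega), e13 12 (by omega)]
    mem := by rwa [e16 13 (by omega), e15 13 (by omega), e14 13 (by omega)]
    red := by rwa [e16 15 (by omega)]
    coeff := g16 }

end

end RAM

namespace RAM

open TExpr

/-! ## Output of matrices -/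

/-- Output the matrix with rows the `x` satisfying `p`, columns the `y` satisfying `q`, and entries
`e`, where `x` is variable `0` and `y` is variable `1`. -/
def matrixOut (p q e : TExpr) : Out :=
  .seq (.emit (.sum 0 p)) (.seq (.emit (.sum 1 q))
    (.loop 0 (.when p (.loop 1 (.when q (.emit e))))))

theorem sum_boole_eq_length (N : ℕ) (P : ℕ → Prop) [DecidablePred P] :
    (∑ i ∈ Finset.range N, if P i then (1 : ℤ) else 0) = ((List.range N).filter P).length := by
  induction N with
  | zero => simp
  | succ N ih =>
    rw [Finset.sum_range_succ, ih, List.range_succ, List.filter_append, List.length_append]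
    by_cases h : P N <;> simp [h]

theorem flatMap_ite {α β : Type*} (l : List α) (P : α → Prop) [DecidablePred P] (f : α → List β) :
    (l.flatMap fun i => if P i then f i else []) = (l.filter P).flatMap f := by
  induction l with
  | nil => rfl
  | cons a l ih => by_cases h : P a <;> simp [h, ih]

/-- Rows and columns appear by increasing code. The three output matrices use the same column or row
test for sets, so their coordinates are listed in one common order. -/
theorem word_matrixOut {N : ℕ} {T : ℕ → ℤ → ℤ} {p q e : TExpr} (P P' : ℕ → Prop) [DecidablePred P]
    [DecidablePred P'] {k l : ℕ} {r : Fin k → ℕ} {c : Fin l → ℕ}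
    (hp : ∀ ρ, ∀ i < N, p.eval N T (Function.update ρ 0 (i : ℤ)) = if P i then 1 else 0)
    (hq : ∀ ρ, ∀ j < N, q.eval N T (Function.update ρ 1 (j : ℤ)) = if P' j then 1 else 0)
    (hr : (List.range N).filter P = List.ofFn r) (hc : (List.range N).filter P' = List.ofFn c)
    {X : Matrix (Fin k) (Fin l) ℤ}
    (he : ∀ i j, e.eval N T (Function.update (Function.update 0 0 (r i : ℤ)) 1 (c j : ℤ)) = X i j) :
    (matrixOut p q e).word N T 0 = matrixWord X := by
  have h1 : (TExpr.sum 0 p).eval N T 0 = k := by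
    rw [eval, Finset.sum_congr rfl fun i hi => hp 0 i (Finset.mem_range.1 hi), sum_boole_eq_length,
      hr, List.length_ofFn]
  have h2 : (TExpr.sum 1 q).eval N T 0 = l := by
    rw [eval, Finset.sum_congr rfl fun i hi => hq 0 i (Finset.mem_range.1 hi), sum_boole_eq_length,
      hc, List.length_ofFn]
  have h3 : ∀ ρ : ℕ → ℤ, (Out.loop 1 (.when q (.emit e))).word N T ρ =
      (List.ofFn c).map fun j : ℕ => e.eval N T (Function.update ρ 1 (j : ℤ)) := by
    intro ρ
    rw [← hc, List.map_eq_flatMap, ← flatMap_ite, Out.word]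
    refine List.flatMap_congr fun j hj => ?_
    rw [Out.word, hq ρ j (List.mem_range.1 hj)]
    by_cases h : P' j <;> simp [h, Out.word]
  have h4 : (Out.loop 0 (.when p (.loop 1 (.when q (.emit e))))).word N T 0 =
      (List.ofFn fun i => List.ofFn (X i)).flatten := by
    rw [Out.word]
    have : ∀ i ∈ List.range N, (Out.when p (.loop 1 (.when q (.emit e)))).word N T
        (Function.update 0 0 (i : ℤ)) = if P i then (List.ofFn c).map fun j : ℕ =>
          e.eval N T (Function.update (Function.update 0 0 (i : ℤ)) 1 (j : ℤ)) else [] := by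
      intro i hi
      rw [Out.word, hp 0 i (List.mem_range.1 hi), h3]
      by_cases h : P i <;> simp [h]
    rw [List.flatMap_congr this, flatMap_ite, hr, List.flatMap_def, List.map_ofFn]
    congr 2
    funext i
    simp only [Function.comp, List.map_ofFn]
    congr 1
    funext j
    exact he i j
  have h5 : (matrixOut p q e).word N T 0 = [(TExpr.sum 0 p).eval N T 0] ++
      ([(TExpr.sum 1 q).eval N T 0] ++
        (Out.loop 0 (.when p (.loop 1 (.when q (.emit e))))).word N T 0) := rfl
  rw [h5, h1, h2, h4]
  rfl

theorem filter_range_lt {m N : ℕ} (h : m ≤ N) :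
    (List.range N).filter (fun j => j < m) = List.ofFn fun a : Fin m => (a : ℕ) := by
  obtain ⟨k, rfl⟩ := Nat.exists_eq_add_of_le h
  rw [List.range_add, List.filter_append, List.filter_eq_self.2 (by simp),
    List.filter_eq_nil_iff.2 (by simp), List.append_nil]
  exact List.ext_getElem (by simp) (by simp)

/-- Enumerate the objects whose codes have a certain property. -/
theorem exists_enumeration {β : Type*} {N : ℕ} {code : β → ℕ} (hcode : Function.Injective code)
    (P : ℕ → Prop) [DecidablePred P] (p : β → Prop) (hP : ∀ c < N, P c ↔ ∃ B, p B ∧ code B = c)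
    (hN : ∀ B, p B → code B < N) :
    ∃ (k : ℕ) (r : Fin k → β), Function.Injective r ∧ (∀ B, (∃ i, r i = B) ↔ p B) ∧ k ≤ N ∧
      (List.range N).filter P = List.ofFn fun i => code (r i) := by
  set L := (List.range N).filter P with hL
  have hmem : ∀ c, c ∈ L ↔ c < N ∧ P c := by simp [hL]
  have hex : ∀ i : Fin L.length, ∃ B, p B ∧ code B = L.get i := fun i =>
    have h := (hmem _).1 (L.get_mem i)
    (hP _ h.1).1 h.2
  choose r hr hr' using hex
  refine ⟨L.length, r, fun i j hij => ?_, fun B => ⟨?_, fun hB => ?_⟩, ?_, ?_⟩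
  · have : L.get i = L.get j := by rw [← hr', ← hr', hij]
    exact (List.nodup_range.filter _).get_inj_iff.1 this
  · rintro ⟨i, rfl⟩
    exact hr i
  · obtain ⟨i, hi⟩ := List.get_of_mem ((hmem (code B)).2 ⟨hN B hB, (hP _ (hN B hB)).2 ⟨B, hB, rfl⟩⟩)
    exact ⟨i, hcode (by rw [hr', hi])⟩
  · simpa using List.length_filter_le P (List.range N)
  · simp only [hr', List.ofFn_get]

/-! ### Tests and entries for the output -/

section

variable {n m : ℕ} {G : ArcDigraph n m} {s t : Fin n} {d : ℕ} {T : ℕ → ℤ → ℤ}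

/-- The base of the codes of pairs. -/
local notation "Q" => (n + m + 2) ^ (d + 1)

/-- The range. -/
local notation "R" => (n + m + 2) ^ (4 * (d + 1))

/-- The test for codes of sets. -/
def setTest (x : ℕ) : TExpr :=
  .ite (.lt (.var x) (.tab 1 (.const 1))) (.tab 12 (.var x)) (.const 0)

/-- The test for codes of lists with at most one element. -/
def smallTest (x : ℕ) : TExpr := .lt (.var x) (.tab 1 (.const 0))

/-- The test for codes of reduced sets. -/
def reducedTest (x : ℕ) : TExpr := .tab 15 (pair (.var x) sink)

/-- The coefficient of the list `x` in the monomial of the list `y`. -/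
def coeffExpr (x y : ℕ) : TExpr := .tab 16 (pair (pair (.var x) sink) (.var y))

/-- The test for codes of reduced sets with at least two elements. -/
def constraintTest : TExpr :=
  .ite (setTest 0) (.ite (smallTest 0) (.const 0) (reducedTest 0)) (.const 0)

/-- The test for codes of sets that are not reduced or have at most one element. -/
def freeTest : TExpr :=
  .ite (setTest 0) (.ite (smallTest 0) (.const 1) (.eq (reducedTest 0) (.const 0))) (.const 0)

/-- The entries of the basis. -/
def basisExpr : TExpr :=
  .sub (.eq (.var 0) (.var 1)) (.ite (reducedTest 0) (.const 0)
    (.ite (reducedTest 1) (coeffExpr 1 0) (.const 0)))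

/-- The output of the listing, of the matrix and of the basis. -/
def outProg : Out :=
  .seq (matrixOut (setTest 0) (.lt (.var 1) arcs) (.tab 13 (pair (.var 0) (.var 1))))
  (.seq (matrixOut constraintTest (setTest 1) (coeffExpr 0 1))
    (matrixOut freeTest (setTest 1) basisExpr))

/-- The code of a set of arcs. -/
noncomputable def setCode (G : ArcDigraph n m) (B : ArcSubset m d) : ℕ :=
  listCode (n + m + 2) (G.listOf B.1)

theorem setCode_injective : Function.Injective (setCode (d := d) G) := fun B C h => by
  have := listCode_injective (by omega) h
  refine Subtype.ext ?_
  rw [← ArcDigraph.listOf_toFinset (G := G) B.1, this, ArcDigraph.listOf_toFinset]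

theorem length_listOf_le (B : ArcSubset m d) : (G.listOf B.1).length ≤ d := by
  rw [ArcDigraph.length_listOf]; exact B.2

theorem setCode_lt (B : ArcSubset m d) : setCode G B < R :=
  (listCode_lt_base (length_listOf_le B)).trans_le base_le_range

theorem pow_le_listCode {b : ℕ} (a : Fin m) (l : List (Fin m)) :
    b ^ l.length ≤ listCode b (a :: l) := by
  induction l generalizing a with
  | nil => simp [listCode, pairCode]
  | cons c l ih =>
    rw [listCode, List.length_cons, pow_succ, pairCode]
    exact (Nat.mul_le_mul_right b (ih c)).trans (Nat.le_add_right _ _)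

/-- Since no digit is zero, the length of a list is the number of digits of its code. Bounds on
cardinalities thus become comparisons with powers of `A`. -/
theorem listCode_lt_pow_iff {l : List (Fin m)} {k : ℕ} :
    listCode (n + m + 2) l < (n + m + 2) ^ k ↔ l.length ≤ k := by
  constructor
  · intro h
    by_contra! hl
    cases l with
    | nil => simp at hl
    | cons a l =>
      have h1 := pow_le_listCode (b := n + m + 2) a l
      rw [List.length_cons] at hl
      have h2 := Nat.pow_le_pow_right (show 0 < n + m + 2 by omega) (Nat.le_of_lt_succ hl)
      omega
  · exact fun h => (listCode_lt (by omega) l).trans_le (Nat.pow_le_pow_right (by omega) h)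

theorem exists_setCode_iff {c : ℕ} : (∃ B : ArcSubset m d, setCode G B = c) ↔
    c < (n + m + 2) ^ d ∧ ∃ l, G.Sorted l ∧ listCode (n + m + 2) l = c := by
  constructor
  · rintro ⟨B, rfl⟩
    exact ⟨listCode_lt_pow_iff.2 (length_listOf_le B), _, ArcDigraph.sorted_listOf _, rfl⟩
  · rintro ⟨h, l, hl, rfl⟩
    refine ⟨⟨l.toFinset, ?_⟩, ?_⟩
    · rw [List.toFinset_card_of_nodup hl.nodup]
      exact listCode_lt_pow_iff.1 h
    · rw [setCode, hl.listOf_eq]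

open Classical in
theorem Complete.eval_setTest (h : Complete G s t d T) (ρ : ℕ → ℤ) {c : ℕ} (hc : c < R) (x : ℕ) :
    (setTest x).eval R T (Function.update ρ x (c : ℤ)) =
      if ∃ B : ArcSubset m d, setCode G B = c then 1 else 0 := by
  simp only [setTest, eval, Function.update_self, h.lim_eq, Nat.cast_lt, h.valid c hc,
    exists_setCode_iff]
  by_cases h1 : c < (n + m + 2) ^ d <;> simp [h1]

theorem Complete.eval_smallTest (h : Complete G s t d T) {ρ : ℕ → ℤ} {x : ℕ} {B : ArcSubset m d}
    (hρ : ρ x = setCode G B) : (smallTest x).eval R T ρ = if B.1.card ≤ 1 then 1 else 0 := by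
  have := listCode_lt_pow_iff (n := n) (l := G.listOf B.1) (k := 1)
  rw [pow_one, ArcDigraph.length_listOf] at this
  simp only [smallTest, eval, hρ, h.base_eq, Nat.cast_lt, setCode, this]

open Classical in
theorem Complete.eval_reducedTest (h : Complete G s t d T) {ρ : ℕ → ℤ} {x : ℕ} {B : ArcSubset m d}
    (hρ : ρ x = setCode G B) :
    (reducedTest x).eval R T ρ = if G.ReducedSet s t B then 1 else 0 := by
  rw [reducedTest, eval, h.eval_pair₂ (x := .var x) (i := setCode G B) hρ (h.eval_sink ρ)
    (listCode_lt_base (length_listOf_le B)), setCode, h.red _ _ (length_listOf_le B)]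
  rfl

theorem Complete.eval_coeffExpr (h : Complete G s t d T) {ρ : ℕ → ℤ} {x y : ℕ}
    {D B : ArcSubset m d} (hx : ρ x = setCode G D) (hy : ρ y = setCode G B) :
    (coeffExpr x y).eval R T ρ = G.setCoeff s t D B := by
  rw [coeffExpr, eval, h.eval_pair₃ (x := .var x) (z := .var y) (i := setCode G D) (k := setCode G B) hx (h.eval_sink ρ) hy
    (listCode_lt_base (length_listOf_le D)) (vertex_lt t), setCode, setCode,
    h.coeff _ _ _ (length_listOf_le D) (length_listOf_le B)]
  rfl

-- At most one set has a given code, so a property of the set can be tested on the code.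
open Classical in
theorem Complete.eval_rowTest (h : Complete G s t d T) (ρ : ℕ → ℤ) {c : ℕ} (hc : c < R)
    {e : TExpr} (p : ArcSubset m d → Prop) [DecidablePred p]
    (he : ∀ B : ArcSubset m d, setCode G B = c →
      e.eval R T (Function.update ρ 0 (c : ℤ)) = if p B then 1 else 0) :
    (TExpr.ite (setTest 0) e (.const 0)).eval R T (Function.update ρ 0 (c : ℤ)) =
      if ∃ B : ArcSubset m d, p B ∧ setCode G B = c then 1 else 0 := by
  rw [eval, h.eval_setTest ρ hc]
  by_cases hB : ∃ B : ArcSubset m d, setCode G B = c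
  · obtain ⟨B, hB'⟩ := hB
    have hiff : (∃ C : ArcSubset m d, p C ∧ setCode G C = c) ↔ p B :=
      ⟨fun ⟨C, hC, hC'⟩ => setCode_injective (hC'.trans hB'.symm) ▸ hC, fun h => ⟨B, h, hB'⟩⟩
    rw [if_neg (by rw [if_pos ⟨B, hB'⟩]; exact one_ne_zero), he B hB']
    simp only [hiff]
  · rw [if_pos (by rw [if_neg hB]), if_neg fun ⟨B, _, hB'⟩ => hB ⟨B, hB'⟩]
    rfl

open Classical in
theorem Complete.eval_constraintTest (h : Complete G s t d T) (ρ : ℕ → ℤ) {c : ℕ} (hc : c < R) :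
    constraintTest.eval R T (Function.update ρ 0 (c : ℤ)) =
      if ∃ B : ArcSubset m d, (¬ B.1.card ≤ 1 ∧ G.ReducedSet s t B) ∧ setCode G B = c
      then 1 else 0 := by
  refine h.eval_rowTest ρ hc (fun B => ¬ B.1.card ≤ 1 ∧ G.ReducedSet s t B) fun B hB => ?_
  have hρ : Function.update ρ 0 (c : ℤ) 0 = setCode G B := by rw [Function.update_self, ← hB]
  simp only [TExpr.eval, h.eval_smallTest hρ, h.eval_reducedTest hρ]
  by_cases h1 : B.1.card ≤ 1 <;> by_cases h2 : G.ReducedSet s t B <;> simp [h1, h2]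

open Classical in
theorem Complete.eval_freeTest (h : Complete G s t d T) (ρ : ℕ → ℤ) {c : ℕ} (hc : c < R) :
    freeTest.eval R T (Function.update ρ 0 (c : ℤ)) =
      if ∃ B : ArcSubset m d, (¬ G.ReducedSet s t B ∨ B.1.card ≤ 1) ∧ setCode G B = c
      then 1 else 0 := by
  refine h.eval_rowTest ρ hc (fun B => ¬ G.ReducedSet s t B ∨ B.1.card ≤ 1) fun B hB => ?_
  have hρ : Function.update ρ 0 (c : ℤ) 0 = setCode G B := by rw [Function.update_self, ← hB]
  simp only [TExpr.eval, h.eval_smallTest hρ, h.eval_reducedTest hρ]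
  by_cases h1 : B.1.card ≤ 1 <;> by_cases h2 : G.ReducedSet s t B <;> simp [h1, h2]

open Classical in
theorem Complete.eval_basisExpr (h : Complete G s t d T) {ρ : ℕ → ℤ} {x B : ArcSubset m d}
    (h0 : ρ 0 = setCode G x) (h1 : ρ 1 = setCode G B) :
    basisExpr.eval R T ρ = (if x = B then 1 else 0) -
      if G.ReducedSet s t x then 0 else if G.ReducedSet s t B then G.setCoeff s t B x else 0 := by
  have h2 : ((setCode G x : ℕ) : ℤ) = (setCode G B : ℕ) ↔ x = B := by
    rw [Nat.cast_inj, setCode_injective.eq_iff]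
  simp only [basisExpr, TExpr.eval, h.eval_reducedTest h0, h.eval_reducedTest h1,
    h.eval_coeffExpr h1 h0, h0, h1, h2]
  by_cases h3 : G.ReducedSet s t x <;> by_cases h4 : G.ReducedSet s t B <;> simp [h3, h4]

end

end RAM

/-! ### The theorem -/

theorem mainTheorem3 (d : ℕ) :
    ∃ (prog : RAM.Prog) (T : Polynomial ℕ),
      ∀ (n m : ℕ) (G : ArcDigraph n m) (s t : Fin n),
        s ≠ t → G.Acyclic → G.PathCovered s t →
        -- the linearizable cost functions form a subspace `L`
        ∃ L : Submodule ℝ (OrderCost m d),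
          (∀ q : OrderCost m d, q ∈ L ↔ G.Linearizable s t q) ∧
          -- a matrix `M` with kernel `L`, the basis of `L` formed by the rows of `X`, and the
          -- order `e` in which the coordinates are listed in the output
          ∃ (N k K : ℕ) (e : Fin N ≃ ArcSubset m d)
            (M : Matrix (Fin k) (ArcSubset m d) ℤ) (X : Matrix (Fin K) (ArcSubset m d) ℤ)
            (b : Module.Basis (Fin K) ℝ L) (steps : ℕ) (final : RAM.State),
            LinearMap.ker (M.map (Int.cast : ℤ → ℝ)).mulVecLin = L ∧
            (∀ (j : Fin K) (B : ArcSubset m d), (b j : OrderCost m d) B = (X j B : ℝ)) ∧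
            k ≤ T.eval (n + m) ∧ N ≤ T.eval (n + m) ∧
            -- `prog` outputs the listing, `M` and the basis in polynomially many steps
            RAM.Exec prog (RAM.initial (G.inputWord s t)) steps final ∧
            steps ≤ T.eval (n + m) ∧
            final.out = RAM.matrixWord (ArcSubset.listing e)
              ++ RAM.matrixWord (M.submatrix id e) ++ RAM.matrixWord (X.submatrix id e) := by
  classical
  obtain ⟨P, hP⟩ := RAM.exists_exec d RAM.allRules RAM.outProg
  refine ⟨.seq (RAM.initProg d) (.seq (RAM.fillAll RAM.allRules) (RAM.outProg.compile 0)), P,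
    fun n m G s t hst hG _ => ?_⟩
  obtain ⟨hR, steps, final, hex, hsteps, hout⟩ := hP (G.inputWord s t) n m rfl rfl
  have hT := RAM.complete_filled (s := s) (t := t) (d := d) hG
  set R := (n + m + 2) ^ (4 * (d + 1))
  set T := RAM.filled R RAM.allRules (RAM.baseTables (G.inputWord s t) (n + m + 2) d)
  set code : ArcSubset m d → ℕ := RAM.setCode G with hcode
  have inj : Function.Injective code := RAM.setCode_injective
  -- The three enumerations, all by increasing code, give the coordinates, the constraints (rows of
  -- `M`) and the free coordinates (rows of the basis).
  obtain ⟨N, e, he, he', hN, heq⟩ := RAM.exists_enumeration (N := R) inj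
    (fun c => ∃ B, code B = c) (fun _ => True) (fun c _ => by simp) fun B _ => RAM.setCode_lt B
  obtain ⟨k, r, hr, hr', hk, hreq⟩ := RAM.exists_enumeration (N := R) inj
    (fun c => ∃ B, (¬ B.1.card ≤ 1 ∧ G.ReducedSet s t B) ∧ code B = c)
    (fun B => ¬ B.1.card ≤ 1 ∧ G.ReducedSet s t B) (fun c _ => Iff.rfl) fun B _ => RAM.setCode_lt B
  obtain ⟨K, x, hx, hx', _, hxeq⟩ := RAM.exists_enumeration (N := R) inj
    (fun c => ∃ B, (¬ G.ReducedSet s t B ∨ B.1.card ≤ 1) ∧ code B = c)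
    (fun B => ¬ G.ReducedSet s t B ∨ B.1.card ≤ 1) (fun c _ => Iff.rfl) fun B _ => RAM.setCode_lt B
  set M : Matrix (Fin k) (ArcSubset m d) ℤ := fun i B => G.setCoeff s t (r i) B with hM
  set L := LinearMap.ker (M.map (Int.cast : ℤ → ℝ)).mulVecLin with hL
  have hmem : ∀ q, q ∈ L ↔ ∀ D, G.ReducedSet s t D → ¬ D.1.card ≤ 1 →
      ∑ B, q B * (G.setCoeff s t D B : ℝ) = 0 := by
    intro q
    rw [hL, LinearMap.mem_ker, funext_iff]
    have key : ∀ i, (M.map (Int.cast : ℤ → ℝ)).mulVecLin q i =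
        ∑ B, q B * (G.setCoeff s t (r i) B : ℝ) := fun i => by
      simp only [Matrix.mulVecLin_apply, Matrix.mulVec, dotProduct]
      exact Finset.sum_congr rfl fun B _ => mul_comm _ _
    constructor
    · intro h D hD hD2
      obtain ⟨i, rfl⟩ := (hr' D).2 ⟨hD2, hD⟩
      rw [← key, h]; rfl
    · intro h i
      have := (hr' (r i)).1 ⟨i, rfl⟩
      rw [key, h _ this.2 this.1]; rfl
  obtain ⟨b, hb⟩ := exists_basis_of_reduced (G.ReducedSet s t) (fun B => B.1.card ≤ 1)
    (G.setCoeff s t) (fun C D hC hD => hG.setCoeff_reduced hC hD) L hmem x hx hx'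
  -- The enumerated objects have distinct codes below the range, which is at most the value of the
  -- polynomial; this bounds both dimensions of `M`.
  refine ⟨L, fun q => ?_, N, k, K, Equiv.ofBijective e ⟨he, fun B => (he' B).2 trivial⟩, M, _, b,
    steps, final, rfl, hb, hk.trans hR, hN.trans hR, hex, hsteps, ?_⟩
  · rw [hmem, hG.linearizable_iff_set hst]
    exact forall₂_congr fun D _ => by rw [not_le]; rfl
  rw [hout, RAM.outProg, RAM.Out.word, RAM.Out.word, List.append_assoc]
  congr 1
  · have hmR : m ≤ R := (RAM.lt_range (by omega)).le
    refine RAM.word_matrixOut (fun c => ∃ B, code B = c) (fun j => j < m)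
      (fun ρ i hi => hT.eval_setTest ρ hi 0) (fun ρ j _ => ?_) heq
      (RAM.filter_range_lt hmR) fun i a => ?_
    · simp only [RAM.TExpr.eval, Function.update_self, hT.eval_arcs, Nat.cast_lt]
    · rw [RAM.TExpr.eval, hT.eval_pair₂ (i := code (e i)) (j := a)
        (by rw [RAM.TExpr.eval, Function.update_of_ne (by omega), Function.update_self])
        (by rw [RAM.TExpr.eval, Function.update_self])
        (RAM.listCode_lt_base (RAM.length_listOf_le _)),
        hcode, RAM.setCode, hT.mem _ _ (RAM.length_listOf_le _)]
      simp only [ArcSubset.listing, ArcDigraph.mem_listOf]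
      rfl
  have h0 : ∀ i j : ℕ, Function.update (Function.update (0 : ℕ → ℤ) 0 (i : ℤ)) 1 (j : ℤ) 0 = i :=
    fun i j => by rw [Function.update_of_ne (by omega), Function.update_self]
  congr 1
  · exact RAM.word_matrixOut
      (fun c => ∃ B, (¬ B.1.card ≤ 1 ∧ G.ReducedSet s t B) ∧ code B = c)
      (fun c => ∃ B, code B = c) (fun ρ i hi => hT.eval_constraintTest ρ hi)
      (fun ρ j hj => hT.eval_setTest ρ hj 1) hreq heq fun i j =>
        hT.eval_coeffExpr (h0 _ _) (Function.update_self ..)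
  · refine RAM.word_matrixOut
      (fun c => ∃ B, (¬ G.ReducedSet s t B ∨ B.1.card ≤ 1) ∧ code B = c)
      (fun c => ∃ B, code B = c) (fun ρ i hi => hT.eval_freeTest ρ hi)
      (fun ρ j hj => hT.eval_setTest ρ hj 1) hxeq heq fun i j => ?_
    rw [hT.eval_basisExpr (x := x i) (B := e j) (h0 _ _) (Function.update_self ..)]
    change _ = (if x i = e j then (1 : ℤ) else 0) -
      if ¬ G.ReducedSet s t (x i) ∧ G.ReducedSet s t (e j) then G.setCoeff s t (e j) (x i) else 0
    by_cases h3 : G.ReducedSet s t (x i) <;> by_cases h4 : G.ReducedSet s t (e j) <;>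
      simp [h3, h4]
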